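/- **Setting.** Let $d\ge 1$. Let $\Xi=\{X_i\}_{i\in\mathcal I^\Xi}$ be a simple, stationary and isotropic (rotation-invariant in law) point process on $\mathbb R^d$ with intensity $\lambda>0$, whose second-order product density exists and equals $\lambda^2h_{SI}(|x-y|)$, where the pair correlation function $h_{SI}$ satisfies $\int_0^\infty|h_{SI}(r)-1|\,r^{d-1}\,dr<\infty$. Let $\Phi$ be a homogeneous Poisson point process on $\mathbb R^d$ with the same intensity $\lambda$. Let $g:(0,\infty)\to(0,\infty)$ be left-continuous and nondecreasing with $\lim_{t\to0^+}g(t)=0$, and put $g^{-1}(y):=\inf\{x>0: g(x)>y\}\in[0,\infty]$ (with $\inf\emptyset=\infty$). For each $\sigma\ge0$ let $S(\sigma),S_1(\sigma),S_2(\sigma),\dots$ be i.i.d. positive random variables such that $S(\sigma)\to0$ in probability as $\sigma\to\infty$ and $\limsup_{\sigma\to\infty}\mathbb E[g^{-1}(S(\sigma)b)^d]<\infty$ for every $b>0$. Let $\mathcal E:(0,\infty)\to(0,\infty)$ be nondecreasing and bounded away from $0$ and $\infty$. Write $X_i$ in hyperspherical coordinates as $(R_i,\Psi_i^{(1)},\dots,\Psi_i^{(d-1)})$,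 with elevation angles $\Psi_i^{(j)}\in[0,\pi]$ for $1\le j\le d-2$ and azimuthal angle $\Psi_i^{(d-1)}\in[0,2\pi)$ (no angles if $d=1$). Given the sensor locations, let the angles of arrival $\Theta_i^{(j)}$ ($i\in\mathcal I^\Xi$, $1\le j\le d-1$) be conditionally independent, with $\Theta_i^{(d-1)}\sim N(\Psi_i^{(d-1)}-\pi,\mathcal E(R_i))$ and $\Theta_i^{(j)}\sim N(\pi-\Psi_i^{(j)},\mathcal E(R_i))$ for $1\le j\le d-2$, the second parameter being the variance; the $S_i(\sigma)$ are independent of the locations and the angles. The observable process is $$\mathcal N^{(\sigma)}_\Xi:=\sum_{i\in\mathcal I^\Xi}\delta_{\left(g(R_i)/S_i(\sigma),\ (\Theta_i^{(1)},\dots,\Theta_i^{(d-1)})\right)}\quad\text{on }(0,\infty)\times\mathbb R^{d-1},$$ and $\mathcal N^{(\sigma)}_\Phi$ is defined in the same way from $\Phi$, with the same $g$, $\mathcal E$ and law of $S(\sigma)$. **Conclusion.** As $\sigma\to\infty$, the two observable processes have the same limiting law, in the following sense. 1. For every continuous compactly supported $f:(0,\infty)\times\mathbb R^{d-1}\to[0,\infty)$,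 $$\mathbb E\,e^{-\int f\,d\mathcal N^{(\sigma)}_\Xi}-\mathbb E\,e^{-\int f\,d\mathcal N^{(\sigma)}_\Phi}\longrightarrow0 .$$ 2. Suppose that for all sufficiently large $\sigma$ the moments $\mathbb E[g^{-1}(S(\sigma)b)^d]$ are finite for all $b>0$. Then for all sufficiently large $\sigma$ both observable processes are almost surely locally finite. Moreover $\mathbb E F(\mathcal N^{(\sigma)}_\Xi)-\mathbb E F(\mathcal N^{(\sigma)}_\Phi)\to0$ for every bounded continuous $F$ on the space of locally finite measures on $(0,\infty)\times\mathbb R^{d-1}$ with the vague topology. Consequently $\mathcal N^{(\sigma)}_\Xi$ converges in distribution as $\sigma\to\infty$ if and only if $\mathcal N^{(\sigma)}_\Phi$ does, and then their limits have the same law. -/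

import Mathlib

open MeasureTheory ProbabilityTheory Filter Topology
open scoped ENNReal NNReal CompactlySupported BoundedContinuousFunction

noncomputable section

/-! ### Random measures and point processes on Euclidean space

A point process is a random measure `Ξ : Ω → Measure E`; `Measure E` carries Mathlib's
σ-algebra, generated by the evaluations on measurable sets. -/

section PointProcesses

variable {d : ℕ} {Ω : Type*} [MeasurableSpace Ω]

/-- Almost surely locally finite, and almost surely without multiple points. -/
structure IsSimpleLocallyFinite (P : Measure Ω) (Ξ : Ω → Measure (EuclideanSpace ℝ (Fin d))) :
    Prop where
  locallyFinite : ∀ᵐ ω ∂P, IsLocallyFiniteMeasure (Ξ ω)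
  simple : ∀ᵐ ω ∂P, ∀ x, Ξ ω {x} ≤ 1

/-- The law is invariant under all translations. -/
def IsStationaryProcess (P : Measure Ω) (Ξ : Ω → Measure (EuclideanSpace ℝ (Fin d))) : Prop :=
  ∀ v : EuclideanSpace ℝ (Fin d),
    P.map (fun ω => (Ξ ω).map (fun x => x + v)) = P.map Ξ

/-- The law is invariant under all rotations about the origin. -/
def IsIsotropicProcess (P : Measure Ω) (Ξ : Ω → Measure (EuclideanSpace ℝ (Fin d))) : Prop :=
  ∀ ρ : EuclideanSpace ℝ (Fin d) ≃ₗᵢ[ℝ] EuclideanSpace ℝ (Fin d),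
    LinearMap.det (ρ.toLinearEquiv : EuclideanSpace ℝ (Fin d) →ₗ[ℝ] EuclideanSpace ℝ (Fin d)) = 1 →
      P.map (fun ω => (Ξ ω).map ρ) = P.map Ξ

/-- The mean measure is `lam` times Lebesgue measure. -/
def HasIntensity (P : Measure Ω) (Ξ : Ω → Measure (EuclideanSpace ℝ (Fin d))) (lam : ℝ) : Prop :=
  ∀ B : Set (EuclideanSpace ℝ (Fin d)), MeasurableSet B →
    ∫⁻ ω, Ξ ω B ∂P = ENNReal.ofReal lam * volume B

/-- `h` is the pair correlation function of a (simple, stationary, isotropic) point process of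
intensity `lam`: the second-order product density, i.e. the density of
`E[Ξ(dx) Ξ(dy)]`, `x ≠ y`, with respect to `dx dy`, is `lam² h(|x - y|)`. -/
structure IsPairCorrelation (P : Measure Ω) (Ξ : Ω → Measure (EuclideanSpace ℝ (Fin d)))
    (lam : ℝ) (h : ℝ → ℝ) : Prop where
  measurable : Measurable h
  nonneg : ∀ r, 0 ≤ r → 0 ≤ h r
  productDensity : ∀ f : EuclideanSpace ℝ (Fin d) × EuclideanSpace ℝ (Fin d) → ℝ≥0∞,
    Measurable f →
      ∫⁻ ω, ∫⁻ x, ∫⁻ y in {x}ᶜ, f (x, y) ∂(Ξ ω) ∂(Ξ ω) ∂P =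
        ∫⁻ x, ∫⁻ y, f (x, y) * ENNReal.ofReal (lam ^ 2 * h (dist x y))

/-- Homogeneous Poisson point process of intensity `lam`: Poisson counts, independent over
disjoint sets. -/
structure IsHomogeneousPoisson (P : Measure Ω) (Φ : Ω → Measure (EuclideanSpace ℝ (Fin d)))
    (lam : ℝ) : Prop where
  count_law : ∀ B : Set (EuclideanSpace ℝ (Fin d)), MeasurableSet B → volume B ≠ ∞ →
    P.map (fun ω => Φ ω B) =
      (poissonMeasure (lam * (volume B).toReal).toNNReal).map (Nat.cast : ℕ → ℝ≥0∞)
  count_indep : ∀ (n : ℕ) (B : Fin n → Set (EuclideanSpace ℝ (Fin d))),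
    (∀ k, MeasurableSet (B k)) → (∀ k, volume (B k) ≠ ∞) → Pairwise (Function.onFun Disjoint B) →
      iIndepFun (fun k ω => Φ ω (B k)) P

end PointProcesses

/-! ### Hyperspherical angles and ideal angles of arrival -/

/-- The angle in `[0, 2π)` of the planar vector `(u, v)`, i.e. `arctan (v / u)` on the right
branch. -/
def azimuth (u v : ℝ) : ℝ :=
  if 0 ≤ Complex.arg ⟨u, v⟩ then Complex.arg ⟨u, v⟩ else Complex.arg ⟨u, v⟩ + 2 * Real.pi

/-- The angular hyperspherical coordinates of `x ∈ ℝᵈ`. With `0`-based indices, `j = d - 2` is the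
azimuthal angle in `[0, 2π)`; every `j < d - 2` is an elevation angle in `[0, π]`, whose tangent
is `√(∑_{k > j} x_k²) / x_j`, equivalently whose cosine is `x_j / √(∑_{k ≥ j} x_k²)`. -/
def hypersphericalAngle {d : ℕ} (x : EuclideanSpace ℝ (Fin d)) (j : Fin (d - 1)) : ℝ :=
  if (j : ℕ) + 2 = d then
    azimuth (x ⟨j, by omega⟩) (x ⟨j + 1, by omega⟩)
  else
    Real.arccos (x ⟨j, by omega⟩ /
      Real.sqrt (∑ k ∈ Finset.univ.filter (fun k : Fin d => (j : ℕ) ≤ (k : ℕ)), x k ^ 2))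

/-- The noiseless angles of arrival at a sensor located at `x` (source at the origin): `Ψ - π` for
the azimuthal angle, `π - Ψ` for the elevation angles. -/
def idealAOA {d : ℕ} (x : EuclideanSpace ℝ (Fin d)) (j : Fin (d - 1)) : ℝ :=
  if (j : ℕ) + 2 = d then hypersphericalAngle x j - Real.pi
  else Real.pi - hypersphericalAngle x j

/-! ### The sensor network and its observable process -/

/-- A random sensor network: a random set of used indices `index ω ⊆ ℕ`, sensor locations `X_i`,
fading variables `S_i(σ)`, `σ ≥ 0`, and measured angles of arrival `Θ_i^{(j)}`. Locations and angles
matter only for `i ∈ index ω`. -/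
structure SensorNetwork (d : ℕ) (Ω : Type*) [MeasurableSpace Ω] where
  index : Ω → Set ℕ
  pos : ℕ → Ω → EuclideanSpace ℝ (Fin d)
  fading : ℝ≥0 → ℕ → Ω → ℝ
  aoa : ℕ → Fin (d - 1) → Ω → ℝ
  measurableSet_index : ∀ i, MeasurableSet {ω | i ∈ index ω}
  measurable_pos : ∀ i, Measurable (pos i)
  measurable_fading : ∀ σ i, Measurable (fading σ i)
  measurable_aoa : ∀ i j, Measurable (aoa i j)

/-- The space `(0, ∞) × ℝ^{d-1}` of pairs (inverse RSS, angles of arrival). -/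
abbrev Obs (d : ℕ) : Type := Set.Ioi (0 : ℝ) × (Fin (d - 1) → ℝ)

namespace SensorNetwork

variable {d : ℕ} {Ω : Type*} [MeasurableSpace Ω] (N : SensorNetwork d Ω)

/-- The point process `∑ δ_{X_i}` of sensor locations. -/
def points (ω : Ω) : Measure (EuclideanSpace ℝ (Fin d)) :=
  Measure.sum fun i : N.index ω => Measure.dirac (N.pos i ω)

/-- The observable process `∑ δ_{(g(R_i) / S_i(σ), Θ_i)}` on `(0, ∞) × ℝ^{d-1}`. -/
def observed (g : ℝ → ℝ) (σ : ℝ≥0) (ω : Ω) : Measure (Obs d) :=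
  (Measure.sum fun i : N.index ω =>
      Measure.dirac (g ‖N.pos i ω‖ / N.fading σ i ω, fun j => N.aoa i j ω)).comap
    (fun p : Obs d => ((p.1 : ℝ), p.2))

/-- The σ-algebra generated by the (indexed) sensor locations. -/
abbrev locationAlgebra : MeasurableSpace Ω :=
  (⨆ i, MeasurableSpace.comap (N.pos i) inferInstance) ⊔
    MeasurableSpace.generateFrom {A | ∃ i, A = {ω | i ∈ N.index ω}}

/-- The σ-algebra generated by the measured angles. -/
abbrev aoaAlgebra : MeasurableSpace Ω :=
  ⨆ i, ⨆ j, MeasurableSpace.comap (N.aoa i j) inferInstance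

/-- The σ-algebra generated by the fading variables at noise level `σ`. -/
abbrev fadingAlgebra (σ : ℝ≥0) : MeasurableSpace Ω :=
  ⨆ i, MeasurableSpace.comap (N.fading σ i) inferInstance

/-- The noise model with error variance function `V` and fading laws `ν σ`: for each `σ` the fading
variables are i.i.d. with law `ν σ` and independent of locations and angles; given the sensor
locations, the angles of all sensors are conditionally independent, and `Θ_i^{(j)}` has conditional
law `N(idealAOA(X_i)_j, V(R_i))`. -/
structure IsNoiseModel (P : Measure Ω) (V : ℝ → ℝ) (ν : ℝ≥0 → Measure ℝ) : Prop where
  fading_law : ∀ σ i, P.map (N.fading σ i) = ν σ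
  fading_iIndep : ∀ σ, iIndepFun (N.fading σ) P
  fading_indep : ∀ σ, Indep (N.fadingAlgebra σ) (N.locationAlgebra ⊔ N.aoaAlgebra) P
  aoa_cond : ∀ (J : Finset ℕ) (B : ℕ → Fin (d - 1) → Set ℝ), (∀ i j, MeasurableSet (B i j)) →
    ∀ G : Set Ω, MeasurableSet[N.locationAlgebra] G →
      P (G ∩ {ω | ∀ i ∈ J, i ∈ N.index ω ∧ ∀ j, N.aoa i j ω ∈ B i j}) =
        ∫⁻ ω in G ∩ {ω | ∀ i ∈ J, i ∈ N.index ω},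
          ∏ i ∈ J, ∏ j, gaussianReal (idealAOA (N.pos i ω) j) (V ‖N.pos i ω‖).toNNReal (B i j) ∂P

end SensorNetwork

/-- The generalized inverse `inf {x > 0 : g x > y}`, with `inf ∅ = ∞`. -/
def genInverse (g : ℝ → ℝ) (y : ℝ) : ℝ≥0∞ :=
  sInf (ENNReal.ofReal '' {x : ℝ | 0 < x ∧ y < g x})

/-- `E[g⁻¹(S b)^d]` for `S` with law `μ`. -/
def inverseMoment (d : ℕ) (g : ℝ → ℝ) (μ : Measure ℝ) (b : ℝ) : ℝ≥0∞ :=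
  ∫⁻ s, genInverse g (s * b) ^ d ∂μ

/-! ### Laplace functionals and the vague topology -/

/-- `exp (-t)` for `t ∈ [0, ∞]`. -/
def expNeg (t : ℝ≥0∞) : ℝ := if t = ∞ then 0 else Real.exp (-t.toReal)

/-- The Laplace functional `E[exp(-∫ f dN)]` of a random measure `N`. -/
def laplaceFunctional {Ω E : Type*} [MeasurableSpace Ω] [TopologicalSpace E] [MeasurableSpace E]
    (P : Measure Ω) (N : Ω → Measure E) (f : C_c(E, ℝ≥0)) : ℝ :=
  ∫ ω, expNeg (∫⁻ x, (f x : ℝ≥0∞) ∂(N ω)) ∂P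

section Vague

variable (E : Type*) [TopologicalSpace E] [MeasurableSpace E]

/-- The space of locally finite measures on `E`. -/
def LFMeasure : Type _ := {μ : Measure E // IsLocallyFiniteMeasure μ}

/-- The vague topology: the coarsest one making `μ ↦ ∫ f dμ` continuous for every continuous
compactly supported `f`. -/
instance LFMeasure.instTopologicalSpace : TopologicalSpace (LFMeasure E) :=
  TopologicalSpace.induced (fun (μ : LFMeasure E) (f : C_c(E, ℝ)) => ∫ x, f x ∂μ.1) inferInstance

instance LFMeasure.instMeasurableSpace : MeasurableSpace (LFMeasure E) := borel _

instance LFMeasure.instBorelSpace : BorelSpace (LFMeasure E) := ⟨rfl⟩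

variable {E}

open Classical in
/-- A locally finite measure, as an element of `LFMeasure E` (the zero measure if it is not locally
finite). -/
def toLFMeasure (μ : Measure E) : LFMeasure E :=
  if h : IsLocallyFiniteMeasure μ then ⟨μ, h⟩ else ⟨0, inferInstance⟩

end Vague

end

/-!
The observable process is asymptotically insensitive to the law of the sensor locations because a
single sensor becomes undetectable as `σ → ∞`, while the locations enter a Laplace functional only
through sums of many small contributions, whose fluctuations are controlled by second moments.

Let `f ≥ 0` be continuous with compact support, and let `p_σ(x)` be the expected value of
`1 - exp (-f (g(|x|) / S(σ), Θ_x))`, with `Θ_x` the noisy angles at `x` (`laplaceDeficit`). Given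
the locations, the marks of different sensors are independent, so the Laplace functional equals
`E ∏ (1 - p_σ(X_i))`. As `|∏ (1 - a_i) - exp (-∑ a_i)| ≤ ∑ a_i²` for `a_i ∈ [0, 1]`, it differs from
`E exp (-∑ p_σ(X_i))` by at most `λ ∫ p_σ²`. The sum `∑ p_σ(X_i)` has mean `λ ∫ p_σ`, and its
variance is at most `C ∫ p_σ²` (`HasVarianceBound`): for a Poisson process `C = λ`, and for the
process with pair correlation `h` the integrability of `|h(r) - 1| r^(d-1)` gives such a `C`, by
`p(x) p(y) ≤ p(x)² + p(y)²`. Hence both Laplace functionals are within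
`λ ∫ p_σ² + (C ∫ p_σ²)^(1/2)` of `exp (-λ ∫ p_σ)`, with possibly different `C`
(`SensorNetwork.IsNoiseModel.abs_integral_expNeg_observed_sub_exp_le`).

If `f` vanishes for first coordinates above `b`, then `p_σ(x) ≤ P(g(|x|) ≤ S(σ) b)`. The integral
of this bound is at most a constant times `E[g⁻¹(S(σ) b)^d]`, so it stays bounded; for `|x| ≥ δ`
the bound itself is at most `P(S(σ) ≥ g(δ) / b) → 0`. So `∫ p_σ² → 0`
(`tendsto_lintegral_sq_detectionProb`), which gives the first assertion.

For the second one, the same estimate bounds the mean of the observable process on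
`{first coordinate ≤ b}`; this gives local finiteness and, by Markov's inequality, tightness, since
bounds on the integrals of a sequence of cutoff functions cut out a compact set in the vague topology
(`LFMeasure.isCompact_setOf_integral_le`). By the Stone–Weierstrass theorem the algebra spanned by
the functions `μ ↦ exp (-∫ f dμ)` approximates bounded continuous functions uniformly on such
compact sets, so that tightness and asymptotically equal Laplace functionals imply asymptotically
equal laws (`LFMeasure.tendsto_integral_sub`). Tightness is used along sequences of noise levels,
where all but finitely many moments are bounded and the remaining ones are finite.
-/

noncomputable section

/-! ### Cutoff functions -/

section Cutoff

variable {E : Type*} [TopologicalSpace E]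

/-- A sequence of `[0, 1]`-valued compactly supported functions such that every compact set is
contained in `{χ n = 1}` for some `n`. -/
structure IsCutoffSequence (χ : ℕ → C_c(E, ℝ)) : Prop where
  nonneg : ∀ n x, 0 ≤ χ n x
  le_one : ∀ n x, χ n x ≤ 1
  eq_one : ∀ K : Set E, IsCompact K → ∃ n, ∀ x ∈ K, χ n x = 1

lemma IsCutoffSequence.exists_abs_le {χ : ℕ → C_c(E, ℝ)} (hχ : IsCutoffSequence χ)
    (f : C_c(E, ℝ)) : ∃ n, ∃ C : ℝ, 0 ≤ C ∧ ∀ x, |f x| ≤ C * χ n x := by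
  obtain ⟨n, hn⟩ := hχ.eq_one _ f.hasCompactSupport
  obtain ⟨C, hC⟩ := f.continuous.bounded_above_of_compact_support f.hasCompactSupport
  refine ⟨n, max C 0, le_max_right _ _, fun x => ?_⟩
  by_cases hx : x ∈ tsupport f
  · rw [hn x hx, mul_one]
    exact (hC x).trans (le_max_left _ _)
  · rw [image_eq_zero_of_notMem_tsupport hx, abs_zero]
    exact mul_nonneg (le_max_right _ _) (hχ.nonneg n x)

variable (E) in
lemma exists_isCutoffSequence [LocallyCompactSpace E] [SecondCountableTopology E] [T2Space E] :
    ∃ χ : ℕ → C_c(E, ℝ), IsCutoffSequence χ := by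
  let K : CompactExhaustion E := default
  choose f h1 _ h3 h4 using fun n => exists_continuous_one_zero_of_isCompact (K.isCompact n)
    isClosed_empty (Set.disjoint_empty _)
  refine ⟨fun n => ⟨f n, h3 n⟩, fun n x => (h4 n x).1, fun n x => (h4 n x).2, fun L hL => ?_⟩
  obtain ⟨n, hn⟩ := K.exists_superset_of_isCompact hL
  exact ⟨n, fun x hx => h1 n (hn hx)⟩

end Cutoff

/-! ### The vague topology on locally finite measures -/

section VagueTopology

variable {E : Type*} [TopologicalSpace E] [MeasurableSpace E]

instance LFMeasure.isLocallyFiniteMeasure (μ : LFMeasure E) : IsLocallyFiniteMeasure μ.1 := μ.2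

lemma LFMeasure.isInducing_integral :
    IsInducing (fun (μ : LFMeasure E) (f : C_c(E, ℝ)) => ∫ x, f x ∂μ.1) := ⟨rfl⟩

lemma LFMeasure.continuous_integral (f : C_c(E, ℝ)) :
    Continuous fun μ : LFMeasure E => ∫ x, f x ∂μ.1 :=
  (continuous_apply f).comp LFMeasure.isInducing_integral.continuous

lemma LFMeasure.isClosed_setOf_integral_le (χ : ℕ → C_c(E, ℝ)) (M : ℕ → ℝ) :
    IsClosed {μ : LFMeasure E | ∀ n, ∫ x, χ n x ∂μ.1 ≤ M n} := by
  simp only [Set.ofPred_forall]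
  exact isClosed_iInter fun n => isClosed_le (LFMeasure.continuous_integral _) continuous_const

lemma toLFMeasure_coe {μ : Measure E} (hμ : IsLocallyFiniteMeasure μ) :
    (toLFMeasure μ).1 = μ := by
  simp [toLFMeasure, hμ]

lemma toLFMeasure_coe_of_not {μ : Measure E} (hμ : ¬ IsLocallyFiniteMeasure μ) :
    (toLFMeasure μ).1 = 0 := by
  simp [toLFMeasure, hμ]

/-- The function `μ ↦ exp (-∫ f dμ)` on locally finite measures. -/
def LFMeasure.expNegIntegral (f : C_c(E, ℝ≥0)) : C(LFMeasure E, ℝ) where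
  toFun μ := Real.exp (-∫ x, f.toReal x ∂μ.1)
  continuous_toFun := (LFMeasure.continuous_integral f.toReal).neg.rexp

variable (E) in
/-- The algebra spanned by the functions `μ ↦ exp (-∫ f dμ)`. -/
def LFMeasure.expAlgebra : Subalgebra ℝ C(LFMeasure E, ℝ) :=
  Algebra.adjoin ℝ (Set.range LFMeasure.expNegIntegral)

variable [BorelSpace E]

lemma LFMeasure.integrable (μ : LFMeasure E) (f : C_c(E, ℝ)) : Integrable (fun x => f x) μ.1 :=
  f.continuous.integrable_of_hasCompactSupport f.hasCompactSupport

lemma LFMeasure.expNegIntegral_apply (f : C_c(E, ℝ≥0)) (μ : LFMeasure E) :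
    LFMeasure.expNegIntegral f μ = expNeg (∫⁻ x, (f x : ℝ≥0∞) ∂μ.1) := by
  have h1 : ∫⁻ x, (f x : ℝ≥0∞) ∂μ.1 = ENNReal.ofReal (∫ x, f.toReal x ∂μ.1) := by
    rw [ofReal_integral_eq_lintegral_ofReal (μ.integrable _)
      (ae_of_all _ fun x => by simp)]
    simp
  rw [h1, expNeg, if_neg ENNReal.ofReal_ne_top, ENNReal.toReal_ofReal
    (integral_nonneg fun x => by simp)]
  rfl

/-- The functions `μ ↦ exp (-∫ f dμ)` are closed under multiplication, so the algebra they generate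
is their linear span. -/
lemma LFMeasure.mem_span_of_mem_expAlgebra {G : C(LFMeasure E, ℝ)}
    (hG : G ∈ LFMeasure.expAlgebra E) :
    G ∈ Submodule.span ℝ (Set.range (LFMeasure.expNegIntegral (E := E))) := by
  have h1 : G ∈ Subalgebra.toSubmodule (LFMeasure.expAlgebra E) := hG
  rw [LFMeasure.expAlgebra, Algebra.adjoin_eq_span] at h1
  refine Submodule.span_mono (fun u hu => ?_) h1
  induction hu using Submonoid.closure_induction with
  | mem u hu => exact hu
  | one => exact ⟨0, by ext μ; simp [LFMeasure.expNegIntegral]⟩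
  | mul u v _ _ hu hv =>
    obtain ⟨f, rfl⟩ := hu
    obtain ⟨k, rfl⟩ := hv
    refine ⟨f + k, ?_⟩
    ext μ
    have h2 : ∫ x, (f + k).toReal x ∂μ.1 = ∫ x, f.toReal x ∂μ.1 + ∫ x, k.toReal x ∂μ.1 := by
      rw [← integral_add (μ.integrable _) (μ.integrable _)]
      simp
    simp only [LFMeasure.expNegIntegral, ContinuousMap.coe_mk, ContinuousMap.mul_apply, h2,
      neg_add, Real.exp_add]

variable [LocallyCompactSpace E] [T2Space E]

lemma IsCutoffSequence.isLocallyFiniteMeasure_iff {χ : ℕ → C_c(E, ℝ)} (hχ : IsCutoffSequence χ)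
    {μ : Measure E} :
    IsLocallyFiniteMeasure μ ↔ ∀ n, ∫⁻ x, ENNReal.ofReal (χ n x) ∂μ < ∞ := by
  constructor
  · intro h n
    exact (LFMeasure.integrable ⟨μ, h⟩ (χ n)).lintegral_lt_top
  · refine fun h => ⟨fun x => ?_⟩
    obtain ⟨K, hK, hxK⟩ := exists_compact_mem_nhds x
    obtain ⟨n, hn⟩ := hχ.eq_one K hK
    refine ⟨K, hxK, lt_of_le_of_lt ?_ (h n)⟩
    rw [← lintegral_indicator_one hK.measurableSet]
    refine lintegral_mono fun y => ?_
    by_cases hy : y ∈ K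
    · simp [hy, hn y hy]
    · simp [hy]

/-- Bounding the integrals of all cutoff functions gives a vaguely compact set: by Tychonoff's
theorem and because, by the Riesz–Markov–Kakutani theorem, the limits of positive functionals
are again integrals. -/
lemma LFMeasure.isCompact_setOf_integral_le {χ : ℕ → C_c(E, ℝ)} (hχ : IsCutoffSequence χ)
    (M : ℕ → ℝ) : IsCompact {μ : LFMeasure E | ∀ n, ∫ x, χ n x ∂μ.1 ≤ M n} := by
  rw [LFMeasure.isInducing_integral.isCompact_iff]
  choose n C hC hfC using hχ.exists_abs_le
  have hK : IsCompact (Set.univ.pi fun f : C_c(E, ℝ) =>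
      Set.Icc (-(C f * M (n f))) (C f * M (n f))) :=
    isCompact_univ_pi fun f => isCompact_Icc
  -- The positive linear functionals satisfying the bounds form a closed set.
  let S : Set (C_c(E, ℝ) → ℝ) := {L | (∀ f g, L (f + g) = L f + L g) ∧
    (∀ (c : ℝ) f, L (c • f) = c * L f) ∧ (∀ f, 0 ≤ f → 0 ≤ L f) ∧ ∀ k, L (χ k) ≤ M k}
  have hS : IsClosed S := by
    simp only [S, Set.ofPred_and, Set.ofPred_forall]
    refine (isClosed_iInter fun f => isClosed_iInter fun g => ?_).inter
      ((isClosed_iInter fun c => isClosed_iInter fun f => ?_).inter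
      ((isClosed_iInter fun f => isClosed_iInter fun _ => ?_).inter
        (isClosed_iInter fun k => ?_)))
    · exact isClosed_eq (by fun_prop) (by fun_prop)
    · exact isClosed_eq (continuous_apply _) (continuous_const.mul (continuous_apply _))
    · exact isClosed_le continuous_const (continuous_apply _)
    · exact isClosed_le (continuous_apply _) continuous_const
  -- The bounds on `∫ χ n dμ` confine every coordinate `∫ f dμ` to a compact interval.
  convert hK.inter_right hS using 1
  ext L
  constructor
  · rintro ⟨μ, hμ, rfl⟩
    refine ⟨fun f _ => ?_, fun f g => ?_, fun c f => ?_, fun f hf => ?_, hμ⟩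
    · rw [Set.mem_Icc, ← abs_le]
      calc |∫ x, f x ∂μ.1| ≤ ∫ x, |f x| ∂μ.1 := abs_integral_le_integral_abs
        _ ≤ ∫ x, C f * χ (n f) x ∂μ.1 := integral_mono (μ.integrable f).abs
          ((μ.integrable _).const_mul _) (hfC f)
        _ = C f * ∫ x, χ (n f) x ∂μ.1 := integral_const_mul _ _
        _ ≤ _ := mul_le_mul_of_nonneg_left (hμ _) (hC f)
    · exact integral_add (μ.integrable f) (μ.integrable g)
    · exact integral_const_mul _ _
    · exact integral_nonneg hf
  · rintro ⟨-, h1, h2, h3, h4⟩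
    let Λ : C_c(E, ℝ) →ₚ[ℝ] ℝ := PositiveLinearMap.mk₀
      { toFun := L, map_add' := h1, map_smul' := h2 } h3
    have hΛ : ∀ f : C_c(E, ℝ), ∫ x, f x ∂(RealRMK.rieszMeasure Λ) = L f :=
      fun f => RealRMK.integral_rieszMeasure Λ f
    exact ⟨⟨RealRMK.rieszMeasure Λ, inferInstance⟩, fun k => (hΛ _).trans_le (h4 k), funext hΛ⟩

variable [SecondCountableTopology E]

lemma LFMeasure.expAlgebra_separatesPoints :
    (LFMeasure.expAlgebra E).SeparatesPoints := by
  intro μ ν hμν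
  by_contra! hcon
  apply hμν
  have h1 : ∀ f : C_c(E, ℝ≥0), ∫ x, f.toReal x ∂μ.1 = ∫ x, f.toReal x ∂ν.1 := fun f => by
    have h2 := hcon _ ⟨LFMeasure.expNegIntegral f, Algebra.subset_adjoin ⟨f, rfl⟩, rfl⟩
    exact neg_injective (Real.exp_injective h2)
  have : TopologicalSpace.PseudoMetrizableSpace E := inferInstance
  refine Subtype.ext (Measure.ext_of_integral_eq_on_compactlySupported fun f => ?_)
  have h3 : ∀ ρ : LFMeasure E, ∫ x, f x ∂ρ.1 =
      ∫ x, f.nnrealPart.toReal x ∂ρ.1 - ∫ x, (-f).nnrealPart.toReal x ∂ρ.1 := fun ρ => by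
    rw [← integral_sub (ρ.integrable _) (ρ.integrable _)]
    conv_lhs => rw [← CompactlySupportedContinuousMap.nnrealPart_sub_nnrealPart_neg f]
    rfl
  rw [h3 μ, h3 ν, h1, h1]

variable (E) in
/-- The vague topology is induced by countably many integrals: those of the cutoff functions
`χ n` and of the products `χ n * u k`, with `u` dense in `C(E, ℝ)` for the compact-open topology.
Indeed every `f ∈ C_c` is within `ε χ n` of some `χ n * u k`. -/
lemma LFMeasure.exists_countable_isInducing : ∃ D : Option ℕ × ℕ → C_c(E, ℝ),
    IsInducing fun (μ : LFMeasure E) p => ∫ x, D p x ∂μ.1 := by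
  obtain ⟨χ, hχ⟩ := exists_isCutoffSequence E
  let u : ℕ → C(E, ℝ) := TopologicalSpace.denseSeq C(E, ℝ)
  let D : Option ℕ × ℕ → C_c(E, ℝ) := fun p => match p with
    | (none, n) => χ n
    | (some k, n) => ⟨(χ n).toContinuousMap * u k, (χ n).hasCompactSupport.mul_right⟩
  let J : LFMeasure E → (Option ℕ × ℕ → ℝ) := fun μ p => ∫ x, D p x ∂μ.1
  refine ⟨D, (?_ : IsInducing J)⟩
  have hJc : Continuous J := continuous_pi fun p => LFMeasure.continuous_integral (D p)
  rw [isInducing_iff_nhds]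
  intro μ₀
  refine le_antisymm (hJc.tendsto μ₀).le_comap ?_
  rw [LFMeasure.isInducing_integral.nhds_eq_comap, ← tendsto_iff_comap, tendsto_pi_nhds]
  intro f
  rw [Metric.tendsto_nhds]
  intro ε hε
  obtain ⟨n, hn⟩ := hχ.eq_one _ f.hasCompactSupport
  have hχf : ∀ x, χ n x * f x = f x := fun x => by
    by_cases hx : x ∈ tsupport f
    · rw [hn x hx, one_mul]
    · rw [image_eq_zero_of_notMem_tsupport hx, mul_zero]
  set a : ℝ := ∫ x, χ n x ∂μ₀.1
  have ha : 0 ≤ a := integral_nonneg fun x => hχ.nonneg n x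
  set δ : ℝ := ε / (4 * (a + 1))
  have hδ : 0 < δ := by positivity
  obtain ⟨k, hk⟩ : ∃ k, ∀ x ∈ tsupport (χ n), |u k x - f x| < δ := by
    have hopen : IsOpen {v : C(E, ℝ) | Set.MapsTo (v - f.toContinuousMap) (tsupport (χ n))
        (Metric.ball 0 δ)} :=
      (ContinuousMap.isOpen_setOfPred_mapsTo (χ n).hasCompactSupport Metric.isOpen_ball).preimage
        (continuous_id.sub continuous_const)
    obtain ⟨k, hk⟩ := (TopologicalSpace.denseRange_denseSeq C(E, ℝ)).exists_mem_open hopen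
      ⟨f.toContinuousMap, fun x _ => by simpa using hδ⟩
    refine ⟨k, fun x hx => ?_⟩
    have := hk hx
    simpa using this
  have hD : ∀ x, |D (some k, n) x - f x| ≤ δ * χ n x := fun x => by
    have h1 : D (some k, n) x - f x = χ n x * (u k x - f x) := by
      rw [mul_sub, hχf]
      rfl
    rw [h1, abs_mul, abs_of_nonneg (hχ.nonneg n x), mul_comm]
    by_cases hx : x ∈ tsupport (χ n)
    · exact mul_le_mul_of_nonneg_right (hk x hx).le (hχ.nonneg n x)
    · rw [image_eq_zero_of_notMem_tsupport hx, mul_zero, mul_zero]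
  have hint : ∀ μ : LFMeasure E, |J μ (some k, n) - ∫ x, f x ∂μ.1| ≤ δ * J μ (none, n) :=
    fun μ => by
      change |(∫ x, D (some k, n) x ∂μ.1) - ∫ x, f x ∂μ.1| ≤ δ * ∫ x, χ n x ∂μ.1
      rw [← integral_sub (μ.integrable _) (μ.integrable _), ← integral_const_mul]
      exact (abs_integral_le_integral_abs).trans (integral_mono
        ((μ.integrable _).sub (μ.integrable _)).abs ((μ.integrable _).const_mul _) hD)
  have hev : ∀ p, ∀ η > 0, ∀ᶠ μ in comap J (𝓝 (J μ₀)), |J μ p - J μ₀ p| < η :=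
    fun p η hη => by
      have := ((continuous_apply p).tendsto (J μ₀)).comp (tendsto_comap (f := J))
      exact (Metric.tendsto_nhds.1 this) η hη
  filter_upwards [hev (none, n) 1 one_pos, hev (some k, n) (ε / 4) (by positivity)] with μ h1 h2
  have h3 : J μ (none, n) ≤ a + 1 := by
    have := (abs_lt.1 h1).2
    change J μ (none, n) - a < 1 at this
    linarith
  have h4 : δ * (a + 1) = ε / 4 := by
    simp only [δ]
    field_simp
  have h5 := hint μ
  have h6 : |J μ₀ (some k, n) - ∫ x, f x ∂μ₀.1| ≤ δ * a := hint μ₀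
  have h7 : δ * J μ (none, n) ≤ ε / 4 := h4 ▸ mul_le_mul_of_nonneg_left h3 hδ.le
  have h8 : δ * a ≤ ε / 4 := h4 ▸ mul_le_mul_of_nonneg_left (by linarith) hδ.le
  rw [Real.dist_eq, abs_lt]
  rw [abs_lt] at h2
  rw [abs_le] at h5 h6
  constructor <;> linarith

/-- The Borel σ-algebra of `LFMeasure E` is generated by the integrals of test functions, because
the vague topology is induced by countably many of them. -/
lemma LFMeasure.measurable_of_integral {α : Type*} [MeasurableSpace α] {X : α → LFMeasure E}
    (hX : ∀ f : C_c(E, ℝ), Measurable fun a => ∫ x, f x ∂(X a).1) : Measurable X := by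
  obtain ⟨D, hD⟩ := LFMeasure.exists_countable_isInducing E
  have h1 : LFMeasure.instMeasurableSpace E = MeasurableSpace.comap
      (fun (μ : LFMeasure E) p => ∫ x, D p x ∂μ.1) inferInstance := by
    have h2 := borel_comap (f := fun (μ : LFMeasure E) p => ∫ x, D p x ∂μ.1) (t := inferInstance)
    rw [← hD.eq_induced, ← BorelSpace.measurable_eq (α := Option ℕ × ℕ → ℝ)] at h2
    exact h2
  rw [h1]
  exact measurable_comap_iff.2 (measurable_pi_iff.2 fun p => hX (D p))

lemma measurable_toLFMeasure : Measurable (toLFMeasure : Measure E → LFMeasure E) := by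
  classical
  refine LFMeasure.measurable_of_integral fun f => ?_
  obtain ⟨χ, hχ⟩ := exists_isCutoffSequence E
  have hm : ∀ u : C_c(E, ℝ), Measurable fun μ : Measure E => ∫⁻ x, ENNReal.ofReal (u x) ∂μ :=
    fun u => Measure.measurable_lintegral u.continuous.measurable.ennreal_ofReal
  have hset : MeasurableSet {μ : Measure E | IsLocallyFiniteMeasure μ} := by
    simp only [hχ.isLocallyFiniteMeasure_iff, Set.ofPred_forall]
    exact MeasurableSet.iInter fun n => measurableSet_lt (hm (χ n)) measurable_const
  have heq : (fun μ : Measure E => ∫ x, f x ∂(toLFMeasure μ).1) =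
      fun μ => if IsLocallyFiniteMeasure μ then (∫⁻ x, ENNReal.ofReal (f x) ∂μ).toReal -
        (∫⁻ x, ENNReal.ofReal ((-f) x) ∂μ).toReal else 0 := by
    funext μ
    split_ifs with hμ
    · rw [toLFMeasure_coe hμ]
      exact integral_eq_lintegral_pos_part_sub_lintegral_neg_part
        (LFMeasure.integrable ⟨μ, hμ⟩ f)
    · rw [toLFMeasure_coe_of_not hμ, integral_zero_measure]
  rw [heq]
  exact Measurable.ite hset ((hm f).ennreal_toReal.sub (hm (-f)).ennreal_toReal)
    measurable_const

end VagueTopology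

/-! ### Convergence of expectations from an algebra of test functions -/

/-- On a compact set, a bounded continuous function is uniformly approximated by elements of a
point-separating algebra of bounded functions that satisfy (almost) the same global bound. The
bound comes from composing an approximation with a polynomial close to the truncation at `±B`. -/
lemma exists_mem_subalgebra_near_of_bounded {Z : Type*} [TopologicalSpace Z]
    {A : Subalgebra ℝ C(Z, ℝ)} (hA : A.SeparatesPoints)
    (hAb : ∀ G ∈ A, ∃ R : ℝ, ∀ z, |G z| ≤ R) (F : C(Z, ℝ)) {B : ℝ} (hF : ∀ z, |F z| ≤ B)
    (hB : 0 ≤ B) {K : Set Z} (hK : IsCompact K) {ε : ℝ} (hε : 0 < ε) :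
    ∃ G ∈ A, (∀ z ∈ K, |F z - G z| ≤ ε) ∧ ∀ z, |G z| ≤ B + ε := by
  obtain ⟨G, hGA, hG⟩ := ContinuousMap.exists_mem_subalgebra_near_continuous_of_isCompact_of_separatesPoints
    hA F hK (half_pos hε)
  obtain ⟨R, hR⟩ := hAb G hGA
  -- Truncation at `±B`: it fixes the values of `F` and is `1`-Lipschitz.
  let c : ℝ → ℝ := fun t => max (-B) (min t B)
  have hc : Continuous c := by fun_prop
  obtain ⟨q, hq⟩ := exists_polynomial_near_of_continuousOn (-R) R c hc.continuousOn (ε / 2)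
    (half_pos hε)
  have hqG : ∀ z, |(Polynomial.aeval G q) z - c (G z)| < ε / 2 := fun z => by
    have h1 : (Polynomial.aeval G q) z = q.eval (G z) := by
      simp
    rw [h1]
    exact hq _ (abs_le.1 (hR z))
  have hcB : ∀ t, |c t| ≤ B := fun t =>
    abs_le.2 ⟨le_max_left _ _, max_le (by linarith) (min_le_right _ _)⟩
  refine ⟨Polynomial.aeval G q, Algebra.adjoin_le (Set.singleton_subset_iff.2 hGA)
    (Polynomial.aeval_mem_adjoin_singleton ℝ G), fun z hz => ?_, fun z => ?_⟩
  · have h1 : |c (G z) - F z| < ε / 2 := by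
      have h2 : c (F z) = F z := by
        have := abs_le.1 (hF z)
        simp [c, this.1, this.2]
      have h3 : |c (G z) - c (F z)| ≤ |G z - F z| := by
        refine (abs_max_sub_max_le_max _ _ _ _).trans ?_
        rw [sub_self, abs_zero]
        refine max_le (abs_nonneg _) ((abs_min_sub_min_le_max _ _ _ _).trans ?_)
        simp
      rw [h2] at h3
      exact h3.trans_lt (hG z hz)
    have h4 := hqG z
    rw [abs_lt] at h1 h4
    rw [abs_le]
    constructor <;> linarith
  · have h4 := hqG z
    have h5 := hcB (G z)
    rw [abs_lt] at h4
    rw [abs_le] at h5 ⊢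
    constructor <;> linarith

/-- If two functions are `ε`-close on `K`, a set of almost full measure, then their integrals are
close. -/
lemma abs_integral_sub_integral_le {Z : Type*} [MeasurableSpace Z] (Q : Measure Z)
    [IsProbabilityMeasure Q] {F G : Z → ℝ} (hF : Measurable F) (hG : Measurable G) {B ε η : ℝ}
    (hε : 0 ≤ ε) (hFB : ∀ z, |F z| ≤ B) (hGB : ∀ z, |G z| ≤ B + ε) {K : Set Z}
    (hK : MeasurableSet K) (hFG : ∀ z ∈ K, |F z - G z| ≤ ε) (hQ : Q.real Kᶜ ≤ η) :
    |∫ z, F z ∂Q - ∫ z, G z ∂Q| ≤ ε + (2 * B + ε) * η := by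
  have hB : ∀ z, 0 ≤ 2 * B + ε := fun z => by linarith [(abs_nonneg _).trans (hFB z)]
  have hFi : Integrable F Q := .of_bound hF.aestronglyMeasurable B (ae_of_all _ hFB)
  have hGi : Integrable G Q := .of_bound hG.aestronglyMeasurable (B + ε) (ae_of_all _ hGB)
  have hi : Integrable (Kᶜ.indicator fun _ => 2 * B + ε) Q :=
    (integrable_const _).indicator hK.compl
  have hne : Nonempty Z := Q.nonempty_of_neZero
  rw [← integral_sub hFi hGi]
  calc |∫ z, F z - G z ∂Q| ≤ ∫ z, |F z - G z| ∂Q := abs_integral_le_integral_abs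
    _ ≤ ∫ z, (ε + Kᶜ.indicator (fun _ => 2 * B + ε) z) ∂Q := by
        refine integral_mono (hFi.sub hGi).abs ((integrable_const _).add hi) fun z => ?_
        by_cases hz : z ∈ K
        · simpa [hz] using hFG z hz
        · have h1 := abs_le.1 (hFB z)
          have h2 := abs_le.1 (hGB z)
          simp only [Set.mem_compl_iff, hz, not_false_eq_true, Set.indicator_of_mem]
          rw [abs_le]
          constructor <;> linarith
    _ = ε + (2 * B + ε) * Q.real Kᶜ := by
        rw [integral_add (integrable_const _) hi, integral_indicator_const _ hK.compl]
        simp [mul_comm]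
    _ ≤ _ := by
        have := mul_le_mul_of_nonneg_left hQ (hB hne.some)
        linarith

/-- For uniformly tight families of laws, asymptotic equality of the expectations of the elements
of a point-separating algebra implies that of all bounded continuous functions. -/
lemma tendsto_integral_sub_of_separatesPoints {Z ι : Type*} [TopologicalSpace Z]
    [MeasurableSpace Z] [OpensMeasurableSpace Z] {l : Filter ι} (Q Q' : ι → Measure Z)
    [∀ i, IsProbabilityMeasure (Q i)] [∀ i, IsProbabilityMeasure (Q' i)]
    {A : Subalgebra ℝ C(Z, ℝ)} (hA : A.SeparatesPoints)
    (hAb : ∀ G ∈ A, ∃ R : ℝ, ∀ z, |G z| ≤ R)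
    (hAt : ∀ G ∈ A, Tendsto (fun i => ∫ z, G z ∂(Q i) - ∫ z, G z ∂(Q' i)) l (𝓝 0))
    (htight : ∀ ε : ℝ, 0 < ε → ∃ K : Set Z, IsCompact K ∧ IsClosed K ∧
      ∀ᶠ i in l, (Q i).real Kᶜ ≤ ε ∧ (Q' i).real Kᶜ ≤ ε) (F : Z →ᵇ ℝ) :
    Tendsto (fun i => ∫ z, F z ∂(Q i) - ∫ z, F z ∂(Q' i)) l (𝓝 0) := by
  rw [Metric.tendsto_nhds]
  intro ε hε
  set B := ‖F‖
  have hB : 0 ≤ B := norm_nonneg _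
  set δ := ε / 4
  have hδ : 0 < δ := by positivity
  set η := δ / (2 * (2 * B + δ))
  have hη : 0 < η := by positivity
  obtain ⟨K, hKc, hKcl, hK⟩ := htight η hη
  obtain ⟨G, hGA, hG1, hG2⟩ := exists_mem_subalgebra_near_of_bounded hA hAb F.toContinuousMap
    (B := B) (fun z => F.norm_coe_le_norm z) hB hKc hδ
  have hη2 : (2 * B + δ) * η = δ / 2 := by
    simp only [η]
    field_simp
  filter_upwards [hK, (Metric.tendsto_nhds.1 (hAt G hGA)) (ε / 8) (by positivity)] with i hi hGi
  have h1 := abs_integral_sub_integral_le (Q i) F.continuous.measurable G.continuous.measurable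
    hδ.le (fun z => F.norm_coe_le_norm z) hG2 hKcl.measurableSet hG1 hi.1
  have h2 := abs_integral_sub_integral_le (Q' i) F.continuous.measurable G.continuous.measurable
    hδ.le (fun z => F.norm_coe_le_norm z) hG2 hKcl.measurableSet hG1 hi.2
  rw [Real.dist_eq, sub_zero, abs_lt] at hGi ⊢
  rw [hη2, abs_le] at h1 h2
  simp only [δ] at h1 h2
  constructor <;> linarith

/-- Two uniformly tight families of laws of locally finite measures with asymptotically equal
Laplace functionals are asymptotically equal in law. -/
lemma LFMeasure.tendsto_integral_sub {E ι : Type*} [TopologicalSpace E] [MeasurableSpace E]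
    [BorelSpace E] [LocallyCompactSpace E] [SecondCountableTopology E] [T2Space E]
    {l : Filter ι} (Q Q' : ι → Measure (LFMeasure E))
    [∀ i, IsProbabilityMeasure (Q i)] [∀ i, IsProbabilityMeasure (Q' i)]
    (hlap : ∀ f : C_c(E, ℝ≥0), Tendsto (fun i => ∫ μ, LFMeasure.expNegIntegral f μ ∂(Q i) -
      ∫ μ, LFMeasure.expNegIntegral f μ ∂(Q' i)) l (𝓝 0))
    (htight : ∀ ε : ℝ, 0 < ε → ∃ K : Set (LFMeasure E), IsCompact K ∧ IsClosed K ∧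
      ∀ᶠ i in l, (Q i).real Kᶜ ≤ ε ∧ (Q' i).real Kᶜ ≤ ε) (F : LFMeasure E →ᵇ ℝ) :
    Tendsto (fun i => ∫ μ, F μ ∂(Q i) - ∫ μ, F μ ∂(Q' i)) l (𝓝 0) := by
  have hb : ∀ G ∈ LFMeasure.expAlgebra E, ∃ R : ℝ, ∀ μ, |G μ| ≤ R := fun G hG => by
    replace hG := LFMeasure.mem_span_of_mem_expAlgebra hG
    induction hG using Submodule.span_induction with
    | mem u hu =>
      obtain ⟨f, rfl⟩ := hu
      refine ⟨1, fun μ => ?_⟩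
      simp only [LFMeasure.expNegIntegral, ContinuousMap.coe_mk, Real.abs_exp]
      rw [Real.exp_le_one_iff, neg_nonpos]
      exact integral_nonneg fun x => by simp
    | zero => exact ⟨0, fun μ => by simp⟩
    | add u v _ _ hu hv =>
      obtain ⟨R, hR⟩ := hu
      obtain ⟨S, hS⟩ := hv
      exact ⟨R + S, fun μ => (abs_add_le _ _).trans (add_le_add (hR μ) (hS μ))⟩
    | smul c u _ hu =>
      obtain ⟨R, hR⟩ := hu
      refine ⟨|c| * R, fun μ => ?_⟩
      simpa [abs_mul] using mul_le_mul_of_nonneg_left (hR μ) (abs_nonneg c)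
  have hi : ∀ (R : Measure (LFMeasure E)) [IsProbabilityMeasure R], ∀ G ∈ LFMeasure.expAlgebra E,
      Integrable (fun μ => G μ) R := fun R _ G hG => by
    obtain ⟨C, hC⟩ := hb G hG
    exact .of_bound G.continuous.measurable.aestronglyMeasurable C (ae_of_all _ hC)
  refine tendsto_integral_sub_of_separatesPoints Q Q' LFMeasure.expAlgebra_separatesPoints hb
    (fun G hG => ?_) htight F
  replace hG := LFMeasure.mem_span_of_mem_expAlgebra hG
  have hsub : ∀ u ∈ Submodule.span ℝ (Set.range (LFMeasure.expNegIntegral (E := E))),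
      u ∈ LFMeasure.expAlgebra E := fun u hu =>
    Submodule.span_le (p := Subalgebra.toSubmodule (LFMeasure.expAlgebra E)).2
      Algebra.subset_adjoin hu
  induction hG using Submodule.span_induction with
  | mem u hu =>
    obtain ⟨f, rfl⟩ := hu
    exact hlap f
  | zero => simp [tendsto_const_nhds]
  | add u v hu' hv' hu hv =>
    refine ((hu.add hv).congr fun i => ?_).trans (by rw [add_zero])
    simp only [ContinuousMap.add_apply]
    rw [integral_add (hi _ u (hsub u hu')) (hi _ v (hsub v hv')),
      integral_add (hi _ u (hsub u hu')) (hi _ v (hsub v hv'))]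
    ring
  | smul c u _ hu =>
    refine ((hu.const_mul c).congr fun i => ?_).trans (by rw [mul_zero])
    simp only [ContinuousMap.smul_apply, smul_eq_mul]
    rw [integral_const_mul, integral_const_mul, mul_sub]

/-! ### The conditional law of the marks -/

section Angles

variable {d : ℕ}

lemma measurable_azimuth : Measurable fun p : ℝ × ℝ => azimuth p.1 p.2 := by
  have h1 : Measurable fun p : ℝ × ℝ => Complex.arg ⟨p.1, p.2⟩ :=
    Complex.measurable_arg.comp Complex.measurableEquivRealProd.symm.measurable
  exact Measurable.ite (measurableSet_le measurable_const h1) h1 (h1.add_const _)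

lemma measurable_idealAOA (j : Fin (d - 1)) :
    Measurable fun x : EuclideanSpace ℝ (Fin d) => idealAOA x j := by
  have hc : ∀ k : Fin d, Measurable fun x : EuclideanSpace ℝ (Fin d) => x k := fun k => by fun_prop
  have h1 : Measurable fun x : EuclideanSpace ℝ (Fin d) => hypersphericalAngle x j := by
    unfold hypersphericalAngle
    split_ifs
    · exact measurable_azimuth.comp ((hc _).prodMk (hc _))
    · exact Real.continuous_arccos.measurable.comp
        ((hc _).div (Finset.measurable_sum _ fun k _ => (hc k).pow_const 2).sqrt)
  unfold idealAOA
  split_ifs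
  · exact h1.sub_const _
  · exact h1.const_sub _

/-- The measured angles at a sensor at `x`, as a function of standard Gaussian noise `z`. -/
def noisyAOA (V : ℝ → ℝ) (x : EuclideanSpace ℝ (Fin d)) (z : Fin (d - 1) → ℝ) (j : Fin (d - 1)) :
    ℝ :=
  idealAOA x j + Real.sqrt (V ‖x‖) * z j

lemma measurable_noisyAOA {V : ℝ → ℝ} (hV : Measurable V) :
    Measurable fun p : EuclideanSpace ℝ (Fin d) × (Fin (d - 1) → ℝ) => noisyAOA V p.1 p.2 := by
  refine measurable_pi_iff.2 fun j => ?_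
  refine ((measurable_idealAOA j).comp measurable_fst).add (Measurable.mul ?_ ?_)
  · exact ((hV.comp measurable_norm).comp measurable_fst).sqrt
  · exact (measurable_pi_apply j).comp measurable_snd

lemma map_noise_gaussianReal (m v : ℝ) :
    (gaussianReal 0 1).map (fun z => m + Real.sqrt v * z) = gaussianReal m v.toNNReal := by
  have h1 : (fun z => m + Real.sqrt v * z) = (fun y => m + y) ∘ fun z => Real.sqrt v * z := rfl
  rw [h1, ← Measure.map_map (by fun_prop) (by fun_prop), gaussianReal_map_const_mul,
    gaussianReal_map_const_add]
  congr 1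
  · simp
  · ext
    simp [Real.sq_sqrt', Real.coe_toNNReal']

/-- The standard noise of a sensor: Gaussian noise for each angle, and the fading variable, of
law `ρ`. -/
abbrev noiseLaw (d : ℕ) (ρ : Measure ℝ) : Measure ((Fin (d - 1) → ℝ) × ℝ) :=
  (Measure.pi fun _ => gaussianReal 0 1).prod ρ

/-- The expected value of a function of location, angles of arrival and fading, for a sensor
at `x`. -/
def markAverage (V : ℝ → ℝ) (ρ : Measure ℝ)
    (u : EuclideanSpace ℝ (Fin d) × ((Fin (d - 1) → ℝ) × ℝ) → ℝ≥0∞)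
    (x : EuclideanSpace ℝ (Fin d)) : ℝ≥0∞ :=
  ∫⁻ w, u (x, (noisyAOA V x w.1, w.2)) ∂(noiseLaw d ρ)

lemma measurable_markMap {V : ℝ → ℝ} (hV : Measurable V) :
    Measurable fun p : EuclideanSpace ℝ (Fin d) × ((Fin (d - 1) → ℝ) × ℝ) =>
      (p.1, (noisyAOA V p.1 p.2.1, p.2.2)) :=
  measurable_fst.prodMk (((measurable_noisyAOA hV).comp
    (measurable_fst.prodMk measurable_snd.fst)).prodMk measurable_snd.snd)

lemma measurable_markAverage {V : ℝ → ℝ} (hV : Measurable V) (ρ : Measure ℝ) [SFinite ρ]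
    {u : EuclideanSpace ℝ (Fin d) × ((Fin (d - 1) → ℝ) × ℝ) → ℝ≥0∞} (hu : Measurable u) :
    Measurable (markAverage V ρ u) :=
  Measurable.lintegral_prod_right' (hu.comp (measurable_markMap hV))

lemma noiseLaw_preimage_box (V : ℝ → ℝ) (ρ : Measure ℝ) [SFinite ρ]
    (x : EuclideanSpace ℝ (Fin d)) {B : Fin (d - 1) → Set ℝ} (hB : ∀ j, MeasurableSet (B j))
    (D : Set ℝ) :
    noiseLaw d ρ {w | noisyAOA V x w.1 ∈ Set.univ.pi B ∧ w.2 ∈ D} =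
      (∏ j, gaussianReal (idealAOA x j) (V ‖x‖).toNNReal (B j)) * ρ D := by
  have h1 : {w : (Fin (d - 1) → ℝ) × ℝ | noisyAOA V x w.1 ∈ Set.univ.pi B ∧ w.2 ∈ D} =
      (Set.univ.pi fun j => (fun z => idealAOA x j + Real.sqrt (V ‖x‖) * z) ⁻¹' B j) ×ˢ D := by
    ext w
    simp [noisyAOA]
  rw [h1, Measure.prod_prod, Measure.pi_pi]
  congr 1
  refine Finset.prod_congr rfl fun j _ => ?_
  rw [← map_noise_gaussianReal, Measure.map_apply (by fun_prop) (hB j)]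

/-- Measurable boxes in the space of (location, (angles, fading)). -/
def markBoxes (d : ℕ) : Set (Set (EuclideanSpace ℝ (Fin d) × ((Fin (d - 1) → ℝ) × ℝ))) :=
  Set.image2 (· ×ˢ ·) {C | MeasurableSet C} (Set.image2 (· ×ˢ ·)
    (Set.univ.pi '' Set.univ.pi fun _ => {s | MeasurableSet s}) {D | MeasurableSet D})

lemma isPiSystem_markBoxes : IsPiSystem (markBoxes d) :=
  MeasurableSpace.isPiSystem_measurableSet.prod
    (isPiSystem_pi.prod MeasurableSpace.isPiSystem_measurableSet)

lemma isCountablySpanning_markBoxes : IsCountablySpanning (markBoxes d) :=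
  isCountablySpanning_measurableSet.prod
    ((IsCountablySpanning.pi fun _ => isCountablySpanning_measurableSet).prod
      isCountablySpanning_measurableSet)

lemma generateFrom_markBoxes :
    MeasurableSpace.generateFrom (markBoxes d) = Prod.instMeasurableSpace :=
  generateFrom_eq_prod MeasurableSpace.generateFrom_measurableSet
    (generateFrom_eq_prod generateFrom_pi MeasurableSpace.generateFrom_measurableSet
      (IsCountablySpanning.pi fun _ => isCountablySpanning_measurableSet)
      isCountablySpanning_measurableSet)
    isCountablySpanning_measurableSet
    ((IsCountablySpanning.pi fun _ => isCountablySpanning_measurableSet).prod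
      isCountablySpanning_measurableSet)

end Angles

section Marks

variable {d : ℕ} {Ω : Type*} [MeasurableSpace Ω] {N : SensorNetwork d Ω}

namespace SensorNetwork

variable (N) in
/-- Location, measured angles and fading of the `i`-th sensor. -/
def mark (σ : ℝ≥0) (i : ℕ) (ω : Ω) : EuclideanSpace ℝ (Fin d) × ((Fin (d - 1) → ℝ) × ℝ) :=
  (N.pos i ω, (fun j => N.aoa i j ω, N.fading σ i ω))

lemma measurable_mark (σ : ℝ≥0) (i : ℕ) : Measurable (N.mark σ i) :=
  (N.measurable_pos i).prodMk ((measurable_pi_iff.2 fun j => N.measurable_aoa i j).prodMk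
    (N.measurable_fading σ i))

lemma locationAlgebra_le : N.locationAlgebra ≤ ‹MeasurableSpace Ω› := by
  refine sup_le (iSup_le fun i => (N.measurable_pos i).comap_le) ?_
  refine MeasurableSpace.generateFrom_le ?_
  rintro _ ⟨i, rfl⟩
  exact N.measurableSet_index i

lemma measurable_pos_locationAlgebra (i : ℕ) : Measurable[N.locationAlgebra] (N.pos i) :=
  measurable_iff_comap_le.2 (le_sup_of_le_left (le_iSup (fun i =>
    MeasurableSpace.comap (N.pos i) inferInstance) i))

lemma measurableSet_index_locationAlgebra (i : ℕ) :
    MeasurableSet[N.locationAlgebra] {ω | i ∈ N.index ω} := by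
  have h1 : MeasurableSpace.generateFrom {A | ∃ i, A = {ω | i ∈ N.index ω}} ≤ N.locationAlgebra :=
    le_sup_right
  exact h1 _ (MeasurableSpace.measurableSet_generateFrom ⟨i, rfl⟩)

lemma measurable_aoa_aoaAlgebra (i : ℕ) (j : Fin (d - 1)) :
    Measurable[N.aoaAlgebra] (N.aoa i j) :=
  measurable_iff_comap_le.2 (le_iSup_of_le i (le_iSup (fun j =>
    MeasurableSpace.comap (N.aoa i j) inferInstance) j))

lemma measurable_fading_fadingAlgebra (σ : ℝ≥0) (i : ℕ) :
    Measurable[N.fadingAlgebra σ] (N.fading σ i) :=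
  measurable_iff_comap_le.2 (le_iSup (fun i =>
    MeasurableSpace.comap (N.fading σ i) inferInstance) i)

variable {P : Measure Ω} [IsProbabilityMeasure P] {V : ℝ → ℝ} {ν : ℝ≥0 → Measure ℝ}

lemma IsNoiseModel.measure_box (hN : N.IsNoiseModel P V ν) (σ : ℝ≥0) (J : Finset ℕ)
    {G : Set Ω} (hG : MeasurableSet[N.locationAlgebra] G) (hGJ : ∀ ω ∈ G, ∀ i ∈ J, i ∈ N.index ω)
    {C : ℕ → Set (EuclideanSpace ℝ (Fin d))} (hC : ∀ i, MeasurableSet (C i))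
    {B : ℕ → Fin (d - 1) → Set ℝ} (hB : ∀ i j, MeasurableSet (B i j))
    {D : ℕ → Set ℝ} (hD : ∀ i, MeasurableSet (D i)) :
    P (G ∩ {ω | ∀ i ∈ J, N.mark σ i ω ∈ C i ×ˢ (Set.univ.pi (B i) ×ˢ D i)}) =
      ∫⁻ ω in G, ∏ i ∈ J, (C i).indicator (fun x =>
        (∏ j, gaussianReal (idealAOA x j) (V ‖x‖).toNNReal (B i j)) * ν σ (D i))
          (N.pos i ω) ∂P := by
  have hloc := N.locationAlgebra_le
  -- The conditions on the locations are absorbed into the event `G'`, those on the angles and the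
  -- fading variables are separated by independence.
  set G' : Set Ω := (⋂ i ∈ J, N.pos i ⁻¹' C i) ∩ G with hG'_def
  have hG' : MeasurableSet[N.locationAlgebra] G' :=
    MeasurableSet.inter (Finset.measurableSet_biInter J fun i _ =>
      N.measurable_pos_locationAlgebra i (hC i)) hG
  set A : Set Ω := {ω | ∀ i ∈ J, i ∈ N.index ω ∧ ∀ j, N.aoa i j ω ∈ B i j} with hA_def
  have hA : MeasurableSet[N.locationAlgebra ⊔ N.aoaAlgebra] A := by
    have h1 : A = ⋂ i ∈ J, ({ω | i ∈ N.index ω} ∩ ⋂ j, N.aoa i j ⁻¹' B i j) := by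
      ext ω
      simp [A]
    rw [h1]
    refine Finset.measurableSet_biInter J fun i _ => MeasurableSet.inter ?_ ?_
    · exact (le_sup_left : N.locationAlgebra ≤ _) _ (N.measurableSet_index_locationAlgebra i)
    · exact MeasurableSet.iInter fun j => (le_sup_right : N.aoaAlgebra ≤ N.locationAlgebra ⊔ _) _
        (N.measurable_aoa_aoaAlgebra i j (hB i j))
  have hS : MeasurableSet[N.fadingAlgebra σ] (⋂ i ∈ J, N.fading σ i ⁻¹' D i) :=
    Finset.measurableSet_biInter J fun i _ => N.measurable_fading_fadingAlgebra σ i (hD i)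
  have hset : G ∩ {ω | ∀ i ∈ J, N.mark σ i ω ∈ C i ×ˢ (Set.univ.pi (B i) ×ˢ D i)} =
      (⋂ i ∈ J, N.fading σ i ⁻¹' D i) ∩ (G' ∩ A) := by
    ext ω
    simp only [Set.mem_inter_iff, Set.mem_ofPred_eq, mark, Set.mem_prod, Set.mem_pi, Set.mem_univ,
      true_implies, Set.mem_iInter, Set.mem_preimage, G', A]
    constructor
    · rintro ⟨h1, h2⟩
      exact ⟨fun i hi => (h2 i hi).2.2, ⟨fun i hi => (h2 i hi).1, h1⟩,
        fun i hi => ⟨hGJ ω h1 i hi, (h2 i hi).2.1⟩⟩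
    · rintro ⟨h1, ⟨h3, h2⟩, h4⟩
      exact ⟨h2, fun i hi => ⟨h3 i hi, (h4 i hi).2, h1 i hi⟩⟩
  have hG'J : G' ∩ {ω | ∀ i ∈ J, i ∈ N.index ω} = G' :=
    Set.inter_eq_left.2 fun ω hω => hGJ ω hω.2
  rw [hset, (Indep_iff _ _ _).1 (hN.fading_indep σ) _ _ hS
    (MeasurableSet.inter ((le_sup_left : N.locationAlgebra ≤ _) _ hG') hA),
    (hN.fading_iIndep σ).measure_inter_preimage_eq_mul J (fun i _ => hD i),
    hN.aoa_cond J B hB G' hG', hG'J, mul_comm]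
  have h2 : ∀ i, P (N.fading σ i ⁻¹' D i) = ν σ (D i) := fun i => by
    rw [← hN.fading_law σ i, Measure.map_apply (N.measurable_fading σ i) (hD i)]
  simp only [h2]
  have hfin : ∏ i ∈ J, ν σ (D i) ≠ ∞ := by
    simp only [← h2]
    exact ENNReal.prod_ne_top fun i _ => measure_ne_top _ _
  rw [← lintegral_mul_const' _ _ hfin, hG'_def,
    ← setLIntegral_indicator (hloc _ (Finset.measurableSet_biInter J fun i _ =>
      N.measurable_pos_locationAlgebra i (hC i)))]
  refine lintegral_congr fun ω => ?_
  by_cases hω : ∀ i ∈ J, N.pos i ω ∈ C i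
  · rw [Set.indicator_of_mem (by simpa using hω), ← Finset.prod_mul_distrib]
    exact Finset.prod_congr rfl fun i hi => by rw [Set.indicator_of_mem (hω i hi)]
  · rw [Set.indicator_of_notMem (by simpa using hω)]
    push Not at hω
    obtain ⟨i, hi, hiω⟩ := hω
    exact (Finset.prod_eq_zero hi (Set.indicator_of_notMem hiω _)).symm

/-- Given the locations, the marks of finitely many sensors are conditionally independent: their
joint law is that of locations together with independent standard noise. -/
lemma IsNoiseModel.map_mark (hN : N.IsNoiseModel P V ν) (hV : Measurable V) (σ : ℝ≥0)
    [IsProbabilityMeasure (ν σ)] (J : Finset ℕ) {G : Set Ω}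
    (hG : MeasurableSet[N.locationAlgebra] G) (hGJ : ∀ ω ∈ G, ∀ i ∈ J, i ∈ N.index ω) :
    (P.restrict G).map (fun ω (i : J) => N.mark σ i ω) =
      ((P.restrict G).prod (Measure.pi fun _ : J => noiseLaw d (ν σ))).map
        fun p (i : J) => (N.pos i p.1, (noisyAOA V (N.pos i p.1) (p.2 i).1, (p.2 i).2)) := by
  have hm1 : Measurable fun ω (i : J) => N.mark σ i ω :=
    measurable_pi_iff.2 fun i => N.measurable_mark σ i
  have hm2 : Measurable fun (p : Ω × (J → (Fin (d - 1) → ℝ) × ℝ)) (i : J) =>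
      (N.pos i p.1, (noisyAOA V (N.pos i p.1) (p.2 i).1, (p.2 i).2)) :=
    measurable_pi_iff.2 fun i => (measurable_markMap hV).comp
      (((N.measurable_pos i).comp measurable_fst).prodMk
        ((measurable_pi_apply i).comp measurable_snd))
  have hbox : ∀ s ∈ Set.univ.pi '' Set.univ.pi (fun _ : J => markBoxes d),
      (P.restrict G).map (fun ω (i : J) => N.mark σ i ω) s =
      ((P.restrict G).prod (Measure.pi fun _ : J => noiseLaw d (ν σ))).map
        (fun p (i : J) => (N.pos i p.1, (noisyAOA V (N.pos i p.1) (p.2 i).1, (p.2 i).2))) s := by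
    rintro _ ⟨t, ht, rfl⟩
    have h1 : ∀ i : ℕ, ∃ (C : Set (EuclideanSpace ℝ (Fin d))) (B : Fin (d - 1) → Set ℝ)
        (D : Set ℝ), MeasurableSet C ∧ (∀ j, MeasurableSet (B j)) ∧ MeasurableSet D ∧
          ∀ hi : i ∈ J, t ⟨i, hi⟩ = C ×ˢ (Set.univ.pi B ×ˢ D) := fun i => by
      by_cases hi : i ∈ J
      · obtain ⟨C, hC, _, ⟨_, ⟨B, hB, rfl⟩, D, hD, rfl⟩, hs⟩ := ht ⟨i, hi⟩ (Set.mem_univ _)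
        exact ⟨C, B, D, hC, fun j => hB j (Set.mem_univ _), hD, fun _ => hs.symm⟩
      · exact ⟨∅, fun _ => ∅, ∅, .empty, fun _ => .empty, .empty, fun h => absurd h hi⟩
    choose C B D hC hB hD htb using h1
    have hbm : ∀ i, MeasurableSet (C i ×ˢ (Set.univ.pi (B i) ×ˢ D i)) := fun i =>
      (hC i).prod ((MeasurableSet.univ_pi (hB i)).prod (hD i))
    have hs : Set.univ.pi t = {y : J → _ | ∀ i : J, y i ∈ C i ×ˢ (Set.univ.pi (B i) ×ˢ D i)} := by
      ext y
      simp only [Set.mem_pi, Set.mem_univ, true_implies, Set.mem_ofPred_eq]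
      exact forall_congr' fun i => by rw [htb i i.2]
    have hsm : MeasurableSet (Set.univ.pi t) :=
      MeasurableSet.univ_pi fun i => htb i i.2 ▸ hbm i
    rw [Measure.map_apply hm1 hsm, Measure.map_apply hm2 hsm,
      Measure.restrict_apply (hm1 hsm), Measure.prod_apply (hm2 hsm)]
    have h2 : (fun ω (i : J) => N.mark σ i ω) ⁻¹' Set.univ.pi t ∩ G =
        G ∩ {ω | ∀ i ∈ J, N.mark σ i ω ∈ C i ×ˢ (Set.univ.pi (B i) ×ˢ D i)} := by
      rw [hs, Set.inter_comm]
      ext ω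
      simp
    rw [h2, hN.measure_box σ J hG hGJ hC hB hD]
    refine lintegral_congr fun ω => ?_
    have h3 : Prod.mk ω ⁻¹' ((fun (p : Ω × (J → (Fin (d - 1) → ℝ) × ℝ)) (i : J) =>
        (N.pos i p.1, (noisyAOA V (N.pos i p.1) (p.2 i).1, (p.2 i).2))) ⁻¹' Set.univ.pi t) =
        Set.univ.pi fun i : J => {w | N.pos i ω ∈ C i ∧
          (noisyAOA V (N.pos i ω) w.1 ∈ Set.univ.pi (B i) ∧ w.2 ∈ D i)} := by
      rw [hs]
      ext w
      simp
    rw [h3, Measure.pi_pi, ← Finset.prod_coe_sort J]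
    refine Finset.prod_congr rfl fun i _ => ?_
    by_cases hi : N.pos i ω ∈ C i
    · simp only [hi, true_and, Set.indicator_of_mem]
      exact (noiseLaw_preimage_box V (ν σ) (N.pos i ω) (hB i) (D i)).symm
    · simp [hi]
  refine ext_of_generate_finite _ ?_ (IsPiSystem.pi fun _ => isPiSystem_markBoxes) hbox ?_
  · exact (generateFrom_eq_pi (fun _ => generateFrom_markBoxes)
      fun _ => isCountablySpanning_markBoxes).symm
  · refine hbox _ ⟨fun _ => Set.univ, fun i _ => ?_, Set.pi_univ _⟩
    exact ⟨Set.univ, by simp, Set.univ, ⟨Set.univ, ⟨fun _ => Set.univ, by simp,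
      Set.pi_univ _⟩, Set.univ, by simp, Set.univ_prod_univ⟩, Set.univ_prod_univ⟩

/-- Averaging a product over finitely many sensors: given the locations, each factor may be
replaced by its average over the noise. -/
lemma IsNoiseModel.setLIntegral_prod_mark (hN : N.IsNoiseModel P V ν) (hV : Measurable V)
    (σ : ℝ≥0) [IsProbabilityMeasure (ν σ)] (J : Finset ℕ) {G : Set Ω}
    (hG : MeasurableSet[N.locationAlgebra] G) (hGJ : ∀ ω ∈ G, ∀ i ∈ J, i ∈ N.index ω)
    {u : EuclideanSpace ℝ (Fin d) × ((Fin (d - 1) → ℝ) × ℝ) → ℝ≥0∞} (hu : Measurable u) :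
    ∫⁻ ω in G, ∏ i ∈ J, u (N.mark σ i ω) ∂P =
      ∫⁻ ω in G, ∏ i ∈ J, markAverage V (ν σ) u (N.pos i ω) ∂P := by
  have hm1 : Measurable fun ω (i : J) => N.mark σ i ω :=
    measurable_pi_iff.2 fun i => N.measurable_mark σ i
  have hm2 : Measurable fun (p : Ω × (J → (Fin (d - 1) → ℝ) × ℝ)) (i : J) =>
      (N.pos i p.1, (noisyAOA V (N.pos i p.1) (p.2 i).1, (p.2 i).2)) :=
    measurable_pi_iff.2 fun i => (measurable_markMap hV).comp
      (((N.measurable_pos i).comp measurable_fst).prodMk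
        ((measurable_pi_apply i).comp measurable_snd))
  have hU : Measurable fun y : J → EuclideanSpace ℝ (Fin d) × ((Fin (d - 1) → ℝ) × ℝ) =>
      ∏ i, u (y i) := Finset.measurable_prod _ fun i _ => hu.comp (measurable_pi_apply i)
  have h1 : ∫⁻ ω in G, ∏ i ∈ J, u (N.mark σ i ω) ∂P =
      ∫⁻ y, ∏ i, u (y i) ∂((P.restrict G).map (fun ω (i : J) => N.mark σ i ω)) := by
    rw [lintegral_map hU hm1]
    exact lintegral_congr fun ω => (Finset.prod_coe_sort J fun i => u (N.mark σ i ω)).symm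
  rw [h1, hN.map_mark hV σ J hG hGJ, lintegral_map hU hm2]
  refine (lintegral_prod _ (hU.comp hm2).aemeasurable).trans ?_
  refine lintegral_congr fun ω => ?_
  have hv : ∀ i : J, Measurable fun w : (Fin (d - 1) → ℝ) × ℝ =>
      u (N.pos i ω, (noisyAOA V (N.pos i ω) w.1, w.2)) := fun i =>
    hu.comp ((measurable_markMap hV).comp measurable_prodMk_left)
  have hind := iIndepFun_pi (μ := fun _ : J => noiseLaw d (ν σ)) (fun i => (hv i).aemeasurable)
  have h2 := lintegral_prod_eq_prod_lintegral_of_indepFun Finset.univ _ hind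
    fun i => (hv i).comp (measurable_pi_apply i)
  rw [← Finset.prod_coe_sort J]
  refine h2.trans (Finset.prod_congr rfl fun i _ => ?_)
  exact (measurePreserving_eval (fun _ : J => noiseLaw d (ν σ)) i).lintegral_comp (hv i)

end SensorNetwork

end Marks

/-! ### Exponentials of sums and products -/

section ExpNeg

lemma expNeg_of_ne_top {t : ℝ≥0∞} (ht : t ≠ ∞) : expNeg t = Real.exp (-t.toReal) := if_neg ht

lemma expNeg_nonneg (t : ℝ≥0∞) : 0 ≤ expNeg t := by
  unfold expNeg
  split_ifs
  exacts [le_rfl, (Real.exp_pos _).le]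

lemma expNeg_le_one (t : ℝ≥0∞) : expNeg t ≤ 1 := by
  unfold expNeg
  split_ifs
  · exact zero_le_one
  · exact Real.exp_le_one_iff.2 (neg_nonpos.2 ENNReal.toReal_nonneg)

@[simp] lemma expNeg_zero : expNeg 0 = 1 := by simp [expNeg]

lemma expNeg_add (s t : ℝ≥0∞) : expNeg (s + t) = expNeg s * expNeg t := by
  by_cases hs : s = ∞
  · simp [expNeg, hs]
  by_cases ht : t = ∞
  · simp [expNeg, ht]
  rw [expNeg_of_ne_top hs, expNeg_of_ne_top ht, expNeg_of_ne_top (ENNReal.add_ne_top.2 ⟨hs, ht⟩),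
    ENNReal.toReal_add hs ht, neg_add, Real.exp_add]

lemma expNeg_sum {ι : Type*} (s : Finset ι) (a : ι → ℝ≥0∞) :
    expNeg (∑ i ∈ s, a i) = ∏ i ∈ s, expNeg (a i) := by
  classical
  induction s using Finset.induction_on with
  | empty => simp
  | insert i s hi ih => rw [Finset.sum_insert hi, Finset.prod_insert hi, expNeg_add, ih]

lemma expNeg_eq_toReal_exp (t : ℝ≥0∞) : expNeg t = (EReal.exp (-(t : EReal))).toReal := by
  by_cases ht : t = ∞
  · simp [expNeg, ht]
  · lift t to ℝ≥0 using ht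
    rw [expNeg_of_ne_top ENNReal.coe_ne_top]
    have h1 : (-((t : ℝ≥0∞) : EReal)) = ((-(t : ℝ) : ℝ) : EReal) := by
      rw [EReal.coe_neg]
      rfl
    rw [h1, EReal.exp_coe, ENNReal.toReal_ofReal (Real.exp_pos _).le]
    rfl

lemma continuous_expNeg : Continuous expNeg := by
  have h1 : expNeg = fun t : ℝ≥0∞ => (EReal.exp (-(t : EReal))).toReal :=
    funext expNeg_eq_toReal_exp
  rw [h1]
  have h2 : Continuous fun t : ℝ≥0∞ => EReal.exp (-(t : EReal)) :=
    ENNReal.continuous_exp.comp (continuous_neg.comp continuous_coe_ennreal_ereal)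
  refine continuous_iff_continuousAt.2 fun t => ?_
  refine (ENNReal.tendsto_toReal ?_).comp h2.continuousAt
  refine ne_top_of_le_ne_top ENNReal.one_ne_top ?_
  rw [EReal.exp_le_one_iff, EReal.neg_le_zero]
  exact EReal.coe_ennreal_nonneg t

lemma abs_prod_sub_prod_le_sum {ι : Type*} (s : Finset ι) {a b : ι → ℝ}
    (ha : ∀ i, |a i| ≤ 1) (hb : ∀ i, |b i| ≤ 1) :
    |∏ i ∈ s, a i - ∏ i ∈ s, b i| ≤ ∑ i ∈ s, |a i - b i| := by
  classical
  induction s using Finset.induction_on with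
  | empty => simp
  | insert i s hi ih =>
    rw [Finset.prod_insert hi, Finset.prod_insert hi, Finset.sum_insert hi]
    have h1 : |∏ i ∈ s, b i| ≤ 1 := by
      rw [Finset.abs_prod]
      exact Finset.prod_le_one (fun _ _ => abs_nonneg _) fun i _ => hb i
    calc |a i * ∏ i ∈ s, a i - b i * ∏ i ∈ s, b i|
        = |a i * (∏ i ∈ s, a i - ∏ i ∈ s, b i) + (a i - b i) * ∏ i ∈ s, b i| := by ring_nf
      _ ≤ |a i * (∏ i ∈ s, a i - ∏ i ∈ s, b i)| + |(a i - b i) * ∏ i ∈ s, b i| := abs_add_le _ _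
      _ ≤ 1 * |∏ i ∈ s, a i - ∏ i ∈ s, b i| + |a i - b i| * 1 := by
          rw [abs_mul, abs_mul]
          exact add_le_add (mul_le_mul_of_nonneg_right (ha i) (abs_nonneg _))
            (mul_le_mul_of_nonneg_left h1 (abs_nonneg _))
      _ ≤ _ := by linarith

/-- The product `∏ (1 - p i)` and the exponential `exp (-∑ p i)` differ by at most `∑ p i ^ 2`. -/
lemma abs_prod_one_sub_sub_expNeg_sum_le {ι : Type*} (s : Finset ι) {p : ι → ℝ≥0∞}
    (hp : ∀ i, p i ≤ 1) :
    |∏ i ∈ s, (1 - (p i).toReal) - expNeg (∑ i ∈ s, p i)| ≤ ∑ i ∈ s, (p i).toReal ^ 2 := by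
  have hp1 : ∀ i, (p i).toReal ≤ 1 := fun i => ENNReal.toReal_le_of_le_ofReal zero_le_one
    (by simpa using hp i)
  rw [expNeg_sum]
  refine (abs_prod_sub_prod_le_sum s (fun i => ?_) fun i => ?_).trans
    (Finset.sum_le_sum fun i _ => ?_)
  · rw [abs_of_nonneg (by linarith [hp1 i])]
    linarith [ENNReal.toReal_nonneg (a := p i)]
  · rw [abs_of_nonneg (expNeg_nonneg _)]
    exact expNeg_le_one _
  · rw [expNeg_of_ne_top (ne_top_of_le_ne_top ENNReal.one_ne_top (hp i)), abs_sub_comm]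
    have h1 := Real.abs_exp_sub_one_sub_id_le (x := -(p i).toReal) (by
      rw [abs_neg, abs_of_nonneg ENNReal.toReal_nonneg]
      exact hp1 i)
    rw [neg_sq] at h1
    rwa [sub_sub, ← sub_eq_add_neg] at h1

lemma tendsto_integral_expNeg_sum {Ω : Type*} [MeasurableSpace Ω] (P : Measure Ω)
    [IsProbabilityMeasure P] {a : ℕ → Ω → ℝ≥0∞} (ha : ∀ i, Measurable (a i)) :
    Tendsto (fun n => ∫ ω, expNeg (∑ i ∈ Finset.range n, a i ω) ∂P) atTop
      (𝓝 (∫ ω, expNeg (∑' i, a i ω) ∂P)) := by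
  refine tendsto_integral_of_dominated_convergence (fun _ => 1) (fun n => ?_)
    (integrable_const _) (fun n => ae_of_all _ fun ω => ?_) (ae_of_all _ fun ω => ?_)
  · exact (continuous_expNeg.measurable.comp
      (Finset.measurable_sum _ fun i _ => ha i)).aestronglyMeasurable
  · rw [Real.norm_of_nonneg (expNeg_nonneg _)]
    exact expNeg_le_one _
  · exact (continuous_expNeg.tendsto _).comp ENNReal.summable.hasSum.tendsto_sum_nat

/-- If the mean of `Y` is `a` and its variance at most `c`, then `E exp (-Y)` is within `√c` of
`exp (-a)`. -/
lemma abs_integral_expNeg_sub_le {Ω : Type*} [MeasurableSpace Ω] (P : Measure Ω)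
    [IsProbabilityMeasure P] {Y : Ω → ℝ≥0∞} (hY : Measurable Y) {a c : ℝ≥0∞} (ha : a ≠ ∞)
    (hc : c ≠ ∞) (h1 : ∫⁻ ω, Y ω ∂P = a) (h2 : ∫⁻ ω, Y ω ^ 2 ∂P ≤ a ^ 2 + c) :
    |∫ ω, expNeg (Y ω) ∂P - Real.exp (-a.toReal)| ≤ Real.sqrt c.toReal := by
  have hfin : ∀ᵐ ω ∂P, Y ω < ∞ := ae_lt_top hY (h1 ▸ ha)
  set Z : Ω → ℝ := fun ω => (Y ω).toReal
  have hZm : Measurable Z := hY.ennreal_toReal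
  have hZ1 : ∫ ω, Z ω ∂P = a.toReal := by
    rw [integral_toReal hY.aemeasurable hfin, h1]
  have hZi : Integrable Z P := integrable_toReal_of_lintegral_ne_top hY.aemeasurable (h1 ▸ ha)
  have h2' : ∫⁻ ω, Y ω ^ 2 ∂P ≠ ∞ :=
    ne_top_of_le_ne_top (ENNReal.add_ne_top.2 ⟨ENNReal.pow_ne_top ha, hc⟩) h2
  have hZ2i : Integrable (fun ω => Z ω ^ 2) P := by
    have := integrable_toReal_of_lintegral_ne_top (hY.pow_const 2).aemeasurable h2'
    simpa [Z, ENNReal.toReal_pow] using this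
  have hZ2 : ∫ ω, Z ω ^ 2 ∂P ≤ a.toReal ^ 2 + c.toReal := by
    have h3 : ∫ ω, Z ω ^ 2 ∂P = (∫⁻ ω, Y ω ^ 2 ∂P).toReal := by
      rw [← integral_toReal (hY.pow_const 2).aemeasurable
        (hfin.mono fun ω h => ENNReal.pow_lt_top h)]
      simp [Z, ENNReal.toReal_pow]
    rw [h3, ← ENNReal.toReal_pow, ← ENNReal.toReal_add (ENNReal.pow_ne_top ha) hc]
    exact ENNReal.toReal_mono (ENNReal.add_ne_top.2 ⟨ENNReal.pow_ne_top ha, hc⟩) h2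
  -- By Cauchy–Schwarz, `E |Y - a| ≤ √c`.
  set W : Ω → ℝ := fun ω => |Z ω - a.toReal|
  have hWm : Measurable W := (hZm.sub_const _).abs
  have hW2 : ∀ ω, W ω ^ 2 = Z ω ^ 2 - 2 * a.toReal * Z ω + a.toReal ^ 2 := fun ω => by
    simp only [W, sq_abs]
    ring
  have hW2i : Integrable (fun ω => W ω ^ 2) P := by
    simp only [hW2]
    exact (hZ2i.sub (hZi.const_mul _)).add (integrable_const _)
  have hW2c : ∫ ω, W ω ^ 2 ∂P ≤ c.toReal := by
    have h3 : ∫ ω, W ω ^ 2 ∂P = ∫ ω, Z ω ^ 2 ∂P - 2 * a.toReal * ∫ ω, Z ω ∂P + a.toReal ^ 2 := by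
      have h4 := integral_add (hZ2i.sub (hZi.const_mul (2 * a.toReal)))
        (integrable_const (μ := P) (a.toReal ^ 2))
      have h5 := integral_sub hZ2i (hZi.const_mul (2 * a.toReal))
      rw [integral_const_mul] at h5
      simp only [hW2]
      simp only [Pi.sub_apply] at h4
      rw [h4, h5]
      simp
    rw [h3, hZ1]
    linarith
  have hWi : Integrable W P := (hZi.sub (integrable_const _)).abs
  have hWL : MemLp W 2 P := (memLp_two_iff_integrable_sq hWm.aestronglyMeasurable).2 hW2i
  have hvar := variance_nonneg W P
  rw [variance_eq_sub hWL] at hvar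
  have hWc : ∫ ω, W ω ∂P ≤ Real.sqrt c.toReal := by
    refine Real.le_sqrt_of_sq_le ?_
    have : (P[W ^ 2] : ℝ) = ∫ ω, W ω ^ 2 ∂P := rfl
    linarith
  refine le_trans ?_ hWc
  have hEi : Integrable (fun ω => expNeg (Y ω)) P :=
    .of_bound (continuous_expNeg.measurable.comp hY).aestronglyMeasurable 1
      (ae_of_all _ fun ω => by
        rw [Real.norm_of_nonneg (expNeg_nonneg _)]
        exact expNeg_le_one _)
  have h4 : ∫ ω, expNeg (Y ω) ∂P - Real.exp (-a.toReal) =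
      ∫ ω, (expNeg (Y ω) - Real.exp (-a.toReal)) ∂P := by
    rw [integral_sub hEi (integrable_const _)]
    simp
  rw [h4]
  refine abs_integral_le_integral_abs.trans
    (integral_mono_ae (hEi.sub (integrable_const _)).abs hWi ?_)
  filter_upwards [hfin] with ω hω
  rw [expNeg_of_ne_top hω.ne]
  -- `t ↦ exp (-t)` is `1`-Lipschitz on `[0, ∞)`.
  have hlip : ∀ s t : ℝ, 0 ≤ s → 0 ≤ t → s ≤ t → Real.exp (-s) - Real.exp (-t) ≤ t - s := by
    intro s t hs _ hst
    have h5 : Real.exp (-t) = Real.exp (-s) * Real.exp (-(t - s)) := by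
      rw [← Real.exp_add]
      ring_nf
    have h6 := Real.add_one_le_exp (-(t - s))
    have h7 : Real.exp (-s) ≤ 1 := Real.exp_le_one_iff.2 (by linarith)
    have h8 := Real.exp_pos (-s)
    have h9 : Real.exp (-(t - s)) ≤ 1 := Real.exp_le_one_iff.2 (by linarith)
    rw [h5]
    nlinarith
  rcases le_total (Z ω) a.toReal with h | h
  · rw [abs_of_nonneg (sub_nonneg.2 (Real.exp_le_exp.2 (neg_le_neg h)))]
    refine (hlip _ _ ENNReal.toReal_nonneg ENNReal.toReal_nonneg h).trans ?_
    simp only [W]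
    rw [abs_sub_comm]
    exact le_abs_self _
  · rw [abs_sub_comm, abs_of_nonneg (sub_nonneg.2 (Real.exp_le_exp.2 (neg_le_neg h)))]
    exact (hlip _ _ ENNReal.toReal_nonneg ENNReal.toReal_nonneg h).trans (le_abs_self _)

end ExpNeg

/-! ### Integrals over the observable process -/

section Observed

variable {d : ℕ}

/-- The inclusion of `(0, ∞) × ℝ^{d-1}` into `ℝ × ℝ^{d-1}`. -/
def obsInclusion (p : Obs d) : ℝ × (Fin (d - 1) → ℝ) := ((p.1 : ℝ), p.2)

lemma measurableEmbedding_obsInclusion : MeasurableEmbedding (obsInclusion (d := d)) :=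
  (MeasurableEmbedding.subtype_coe measurableSet_Ioi).prodMap MeasurableEmbedding.id

/-- The contribution `φ (g R / S, Θ)` of a sensor with given location, angles and fading to the
integral of `φ` over the observable process; it vanishes where `g R / S ≤ 0`. -/
def obsIntegrand (g : ℝ → ℝ) (φ : Obs d → ℝ≥0∞)
    (y : EuclideanSpace ℝ (Fin d) × ((Fin (d - 1) → ℝ) × ℝ)) : ℝ≥0∞ :=
  Function.extend obsInclusion φ 0 (g ‖y.1‖ / y.2.2, y.2.1)

lemma measurable_obsIntegrand {g : ℝ → ℝ} (hg : Measurable g) {φ : Obs d → ℝ≥0∞}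
    (hφ : Measurable φ) : Measurable (obsIntegrand g φ) := by
  refine (measurableEmbedding_obsInclusion.measurable_extend hφ measurable_zero).comp ?_
  exact ((hg.comp measurable_fst.norm).div measurable_snd.snd).prodMk measurable_snd.fst

lemma lintegral_comap_obsInclusion (μ : Measure (ℝ × (Fin (d - 1) → ℝ))) {φ : Obs d → ℝ≥0∞}
    (hφ : Measurable φ) :
    ∫⁻ p, φ p ∂(μ.comap obsInclusion) = ∫⁻ y, Function.extend obsInclusion φ 0 y ∂μ := by
  have he := measurableEmbedding_obsInclusion (d := d)
  have hm := he.measurable_extend hφ (g' := 0) measurable_zero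
  have h1 : ∀ p, φ p = Function.extend obsInclusion φ 0 (obsInclusion p) := fun p =>
    (he.injective.extend_apply φ 0 p).symm
  rw [lintegral_congr h1, ← he.lintegral_map, he.map_comap,
    ← lintegral_indicator he.measurableSet_range]
  refine lintegral_congr fun y => ?_
  by_cases hy : y ∈ Set.range (obsInclusion (d := d))
  · rw [Set.indicator_of_mem hy]
  · rw [Set.indicator_of_notMem hy, Function.extend_apply' _ _ _ hy]
    rfl

end Observed

namespace SensorNetwork

variable {d : ℕ} {Ω : Type*} [MeasurableSpace Ω] {N : SensorNetwork d Ω}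

lemma lintegral_points (N : SensorNetwork d Ω) (ω : Ω) {f : EuclideanSpace ℝ (Fin d) → ℝ≥0∞}
    (hf : Measurable f) :
    ∫⁻ x, f x ∂(N.points ω) = ∑' i, (N.index ω).indicator (fun i => f (N.pos i ω)) i := by
  rw [points, lintegral_sum_measure, ← tsum_subtype]
  simp only [lintegral_dirac' _ hf]

lemma lintegral_observed (N : SensorNetwork d Ω) {g : ℝ → ℝ} (σ : ℝ≥0) (ω : Ω)
    {φ : Obs d → ℝ≥0∞} (hφ : Measurable φ) :
    ∫⁻ p, φ p ∂(N.observed g σ ω) =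
      ∑' i, (N.index ω).indicator (fun i => obsIntegrand g φ (N.mark σ i ω)) i := by
  have hm := measurableEmbedding_obsInclusion.measurable_extend hφ (g' := 0) measurable_zero
  rw [← tsum_subtype]
  refine (lintegral_comap_obsInclusion _ hφ).trans ?_
  rw [lintegral_sum_measure]
  simp only [lintegral_dirac' _ hm]
  rfl

lemma measurable_index_indicator {f : ℕ → Ω → ℝ≥0∞} (hf : ∀ i, Measurable (f i)) (i : ℕ) :
    Measurable fun ω => (N.index ω).indicator (fun i => f i ω) i := by
  have h1 : (fun ω => (N.index ω).indicator (fun i => f i ω) i) =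
      {ω | i ∈ N.index ω}.indicator (f i) := by
    funext ω
    by_cases h : i ∈ N.index ω <;> simp [h]
  rw [h1]
  exact (hf i).indicator (N.measurableSet_index i)

lemma measurable_points (N : SensorNetwork d Ω) : Measurable N.points := by
  refine Measure.measurable_of_measurable_coe _ fun B hB => ?_
  have h1 : Measurable (B.indicator (1 : EuclideanSpace ℝ (Fin d) → ℝ≥0∞)) :=
    measurable_one.indicator hB
  simp only [← lintegral_indicator_one hB, N.lintegral_points _ h1]
  exact Measurable.tsum fun i => measurable_index_indicator
    (fun i => h1.comp (N.measurable_pos i)) i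

lemma measurable_observed (N : SensorNetwork d Ω) {g : ℝ → ℝ} (hg : Measurable g) (σ : ℝ≥0) :
    Measurable (N.observed g σ) := by
  refine Measure.measurable_of_measurable_coe _ fun B hB => ?_
  have h1 : Measurable (B.indicator (1 : Obs d → ℝ≥0∞)) := measurable_one.indicator hB
  simp only [← lintegral_indicator_one hB, N.lintegral_observed σ _ h1]
  exact Measurable.tsum fun i => measurable_index_indicator
    (fun i => (measurable_obsIntegrand hg h1).comp (N.measurable_mark σ i)) i

variable {P : Measure Ω} [IsProbabilityMeasure P] {V : ℝ → ℝ} {ν : ℝ≥0 → Measure ℝ}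

/-- Given the locations, each factor of a product over the used sensors in `K` may be replaced by
its average over the noise. The sensors in `J` are known to be used; the induction on `K` splits
according to whether a sensor of `K` is used, and moves it to `J` if it is. -/
lemma IsNoiseModel.setLIntegral_prod_mul_prod (hN : N.IsNoiseModel P V ν) (hV : Measurable V)
    (σ : ℝ≥0) [IsProbabilityMeasure (ν σ)]
    {u : EuclideanSpace ℝ (Fin d) × ((Fin (d - 1) → ℝ) × ℝ) → ℝ≥0∞} (hu : Measurable u)
    (K J : Finset ℕ) (hKJ : Disjoint K J) {G : Set Ω}
    (hG : MeasurableSet[N.locationAlgebra] G) (hGJ : ∀ ω ∈ G, ∀ i ∈ J, i ∈ N.index ω) :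
    ∫⁻ ω in G, (∏ i ∈ K, (N.index ω).mulIndicator (fun i => u (N.mark σ i ω)) i) *
        ∏ i ∈ J, u (N.mark σ i ω) ∂P =
      ∫⁻ ω in G, (∏ i ∈ K, (N.index ω).mulIndicator
        (fun i => markAverage V (ν σ) u (N.pos i ω)) i) *
        ∏ i ∈ J, markAverage V (ν σ) u (N.pos i ω) ∂P := by
  induction K using Finset.induction_on generalizing J G with
  | empty =>
    simp only [Finset.prod_empty, one_mul]
    exact hN.setLIntegral_prod_mark hV σ J hG hGJ hu
  | insert k K hk ih =>
    rw [Finset.disjoint_insert_left] at hKJ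
    have hkm := N.measurableSet_index_locationAlgebra k
    have hkm' : MeasurableSet {ω | k ∈ N.index ω} := N.measurableSet_index k
    have hGm : MeasurableSet G := N.locationAlgebra_le _ hG
    have hin := ih (insert k J) (Finset.disjoint_insert_right.2 ⟨hk, hKJ.2⟩)
      (MeasurableSet.inter hG hkm) (fun ω hω i hi => by
        rcases Finset.mem_insert.1 hi with rfl | hi
        exacts [hω.2, hGJ ω hω.1 i hi])
    have hout := ih J hKJ.2 (MeasurableSet.diff hG hkm) fun ω hω i hi => hGJ ω hω.1 i hi
    rw [← lintegral_inter_add_sdiff _ G hkm', ← lintegral_inter_add_sdiff _ G hkm']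
    congr 1
    · refine Eq.trans ?_ (hin.trans ?_)
      · refine setLIntegral_congr_fun (hGm.inter hkm') fun ω hω => ?_
        have hω2 : k ∈ N.index ω := hω.2
        rw [Finset.prod_insert hk, Finset.prod_insert hKJ.1, Set.mulIndicator_of_mem hω2]
        ring
      · refine setLIntegral_congr_fun (hGm.inter hkm') fun ω hω => ?_
        have hω2 : k ∈ N.index ω := hω.2
        rw [Finset.prod_insert hk, Finset.prod_insert hKJ.1, Set.mulIndicator_of_mem hω2]
        ring
    · refine Eq.trans ?_ (hout.trans ?_)
      · refine setLIntegral_congr_fun (hGm.diff hkm') fun ω hω => ?_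
        have hω2 : k ∉ N.index ω := hω.2
        rw [Finset.prod_insert hk, Set.mulIndicator_of_notMem hω2, one_mul]
      · refine setLIntegral_congr_fun (hGm.diff hkm') fun ω hω => ?_
        have hω2 : k ∉ N.index ω := hω.2
        rw [Finset.prod_insert hk, Set.mulIndicator_of_notMem hω2, one_mul]

/-- Campbell's formula for the marked process. -/
lemma IsNoiseModel.lintegral_tsum_mark (hN : N.IsNoiseModel P V ν) (hV : Measurable V)
    (σ : ℝ≥0) [IsProbabilityMeasure (ν σ)]
    {u : EuclideanSpace ℝ (Fin d) × ((Fin (d - 1) → ℝ) × ℝ) → ℝ≥0∞} (hu : Measurable u) :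
    ∫⁻ ω, ∑' i, (N.index ω).indicator (fun i => u (N.mark σ i ω)) i ∂P =
      ∫⁻ ω, ∫⁻ x, markAverage V (ν σ) u x ∂(N.points ω) ∂P := by
  have hm := measurable_markAverage hV (ν σ) hu
  have ha : ∀ i, Measurable fun ω => (N.index ω).indicator (fun i => u (N.mark σ i ω)) i :=
    measurable_index_indicator fun i => hu.comp (N.measurable_mark σ i)
  have hb : ∀ i, Measurable fun ω =>
      (N.index ω).indicator (fun i => markAverage V (ν σ) u (N.pos i ω)) i :=
    measurable_index_indicator fun i => hm.comp (N.measurable_pos i)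
  simp only [N.lintegral_points _ hm]
  rw [lintegral_tsum fun i => (ha i).aemeasurable, lintegral_tsum fun i => (hb i).aemeasurable]
  refine tsum_congr fun i => ?_
  have h1 := hN.setLIntegral_prod_mark hV σ {i} (N.measurableSet_index_locationAlgebra i)
    (fun ω hω k hk => by rwa [Finset.mem_singleton.1 hk]) hu
  simp only [Finset.prod_singleton] at h1
  rw [← lintegral_indicator (N.measurableSet_index i),
    ← lintegral_indicator (N.measurableSet_index i)] at h1
  convert h1 using 2
  · funext ω
    by_cases h : i ∈ N.index ω <;> simp [h]
  · funext ω
    by_cases h : i ∈ N.index ω <;> simp [h]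

end SensorNetwork

/-! ### Comparison of Laplace functionals -/

section Deficit

variable {d : ℕ}

/-- The expected deficit `1 - E exp (-φ (g R / S, Θ))` of a sensor at `x`. It controls the Laplace
functional of the observable process, and tends to the probability that the sensor is seen in
`{φ > 0}` as `φ` is multiplied by a constant tending to `∞`. -/
def laplaceDeficit (V : ℝ → ℝ) (ρ : Measure ℝ) (g : ℝ → ℝ) (φ : Obs d → ℝ≥0∞)
    (x : EuclideanSpace ℝ (Fin d)) : ℝ≥0∞ :=
  markAverage V ρ (fun y => ENNReal.ofReal (1 - expNeg (obsIntegrand g φ y))) x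

lemma measurable_expNeg_obsIntegrand {g : ℝ → ℝ} (hg : Measurable g) {φ : Obs d → ℝ≥0∞}
    (hφ : Measurable φ) : Measurable fun y => expNeg (obsIntegrand g φ y) :=
  continuous_expNeg.measurable.comp (measurable_obsIntegrand hg hφ)

lemma measurable_laplaceDeficit {V : ℝ → ℝ} (hV : Measurable V) (ρ : Measure ℝ) [SFinite ρ]
    {g : ℝ → ℝ} (hg : Measurable g) {φ : Obs d → ℝ≥0∞} (hφ : Measurable φ) :
    Measurable (laplaceDeficit V ρ g φ) :=
  measurable_markAverage hV ρ
    ((measurable_expNeg_obsIntegrand hg hφ).const_sub 1).ennreal_ofReal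

lemma markAverage_expNeg_add_laplaceDeficit {V : ℝ → ℝ} (hV : Measurable V) (ρ : Measure ℝ)
    [IsProbabilityMeasure ρ] {g : ℝ → ℝ} (hg : Measurable g) {φ : Obs d → ℝ≥0∞}
    (hφ : Measurable φ) (x : EuclideanSpace ℝ (Fin d)) :
    markAverage V ρ (fun y => ENNReal.ofReal (expNeg (obsIntegrand g φ y))) x +
      laplaceDeficit V ρ g φ x = 1 := by
  have hm : Measurable fun w : (Fin (d - 1) → ℝ) × ℝ =>
      (x, (noisyAOA V x w.1, w.2)) := (measurable_markMap hV).comp measurable_prodMk_left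
  have hm2 : Measurable fun w : (Fin (d - 1) → ℝ) × ℝ =>
      ENNReal.ofReal (expNeg (obsIntegrand g φ (x, (noisyAOA V x w.1, w.2)))) :=
    (measurable_expNeg_obsIntegrand hg hφ).ennreal_ofReal.comp hm
  rw [laplaceDeficit, markAverage, markAverage, ← lintegral_add_left hm2]
  have h1 : ∀ t : ℝ≥0∞, ENNReal.ofReal (expNeg t) + ENNReal.ofReal (1 - expNeg t) = 1 := fun t => by
    rw [← ENNReal.ofReal_add (expNeg_nonneg _) (sub_nonneg.2 (expNeg_le_one _))]
    simp
  simp [h1]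

lemma laplaceDeficit_le_one {V : ℝ → ℝ} (hV : Measurable V) (ρ : Measure ℝ)
    [IsProbabilityMeasure ρ] {g : ℝ → ℝ} (hg : Measurable g) {φ : Obs d → ℝ≥0∞}
    (hφ : Measurable φ) (x : EuclideanSpace ℝ (Fin d)) : laplaceDeficit V ρ g φ x ≤ 1 := by
  rw [← markAverage_expNeg_add_laplaceDeficit hV ρ hg hφ x]
  exact le_add_self

end Deficit

namespace SensorNetwork

variable {d : ℕ} {Ω : Type*} [MeasurableSpace Ω] {N : SensorNetwork d Ω}
  {P : Measure Ω} [IsProbabilityMeasure P] {V : ℝ → ℝ} {ν : ℝ≥0 → Measure ℝ}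

lemma IsNoiseModel.integral_expNeg_sum_mark (hN : N.IsNoiseModel P V ν) (hV : Measurable V)
    (σ : ℝ≥0) [IsProbabilityMeasure (ν σ)] {g : ℝ → ℝ} (hg : Measurable g)
    {φ : Obs d → ℝ≥0∞} (hφ : Measurable φ) (s : Finset ℕ) :
    ∫ ω, expNeg (∑ i ∈ s, (N.index ω).indicator
        (fun i => obsIntegrand g φ (N.mark σ i ω)) i) ∂P =
      ∫ ω, ∏ i ∈ s, (1 - ((N.index ω).indicator
        (fun i => laplaceDeficit V (ν σ) g φ (N.pos i ω)) i).toReal) ∂P := by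
  have hu := (measurable_expNeg_obsIntegrand hg hφ).ennreal_ofReal
  have h1 := hN.setLIntegral_prod_mul_prod hV σ hu s ∅ (Finset.disjoint_empty_right _)
    (G := Set.univ) MeasurableSet.univ (by simp)
  simp only [Finset.prod_empty, mul_one, Measure.restrict_univ] at h1
  have h2 : ∀ ω, expNeg (∑ i ∈ s, (N.index ω).indicator
      (fun i => obsIntegrand g φ (N.mark σ i ω)) i) = (∏ i ∈ s, (N.index ω).mulIndicator
        (fun i => ENNReal.ofReal (expNeg (obsIntegrand g φ (N.mark σ i ω)))) i).toReal := fun ω => by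
    rw [expNeg_sum, ENNReal.toReal_prod]
    refine Finset.prod_congr rfl fun i _ => ?_
    by_cases h : i ∈ N.index ω
    · simp [h, ENNReal.toReal_ofReal (expNeg_nonneg _)]
    · simp [h]
  have h3 : ∀ ω, ∏ i ∈ s, (1 - ((N.index ω).indicator
      (fun i => laplaceDeficit V (ν σ) g φ (N.pos i ω)) i).toReal) =
      (∏ i ∈ s, (N.index ω).mulIndicator (fun i => markAverage V (ν σ)
        (fun y => ENNReal.ofReal (expNeg (obsIntegrand g φ y))) (N.pos i ω)) i).toReal := fun ω => by
    rw [ENNReal.toReal_prod]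
    refine Finset.prod_congr rfl fun i _ => ?_
    by_cases h : i ∈ N.index ω
    · have h4 := markAverage_expNeg_add_laplaceDeficit hV (ν σ) hg hφ (N.pos i ω)
      have h5 := congrArg ENNReal.toReal h4
      rw [ENNReal.toReal_add (ne_top_of_le_ne_top ENNReal.one_ne_top (h4 ▸ le_self_add))
        (ne_top_of_le_ne_top ENNReal.one_ne_top (h4 ▸ le_add_self)), ENNReal.toReal_one] at h5
      simp only [h, Set.indicator_of_mem, Set.mulIndicator_of_mem]
      linarith
    · simp [h]
  have h4 : ∀ v : ℕ → Ω → ℝ≥0∞, (∀ i, Measurable (v i)) → (∀ i ω, v i ω ≤ 1) →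
      ∫ ω, (∏ i ∈ s, (N.index ω).mulIndicator (fun i => v i ω) i).toReal ∂P =
      (∫⁻ ω, ∏ i ∈ s, (N.index ω).mulIndicator (fun i => v i ω) i ∂P).toReal := by
    intro v hv hv1
    refine integral_toReal (Finset.measurable_prod _ fun i _ => ?_).aemeasurable
      (ae_of_all _ fun ω => lt_of_le_of_lt (Finset.prod_le_one (fun _ _ => zero_le) fun i _ => ?_)
        ENNReal.one_lt_top)
    · classical
      have h5 : (fun ω => (N.index ω).mulIndicator (fun i => v i ω) i) =
          {ω | i ∈ N.index ω}.piecewise (v i) 1 := by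
        funext ω
        by_cases h : i ∈ N.index ω <;> simp [h]
      rw [h5]
      exact (hv i).piecewise (N.measurableSet_index i) measurable_one
    · by_cases h : i ∈ N.index ω <;> simp [h, hv1]
  simp only [h2, h3]
  rw [h4 (fun i ω => ENNReal.ofReal (expNeg (obsIntegrand g φ (N.mark σ i ω))))
      (fun i => hu.comp (N.measurable_mark σ i)) fun i ω => ?_,
    h4 (fun i ω => markAverage V (ν σ) (fun y => ENNReal.ofReal (expNeg (obsIntegrand g φ y)))
      (N.pos i ω)) (fun i => (measurable_markAverage hV (ν σ) hu).comp (N.measurable_pos i)) fun i ω => ?_]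
  · exact congrArg ENNReal.toReal h1
  · rw [← markAverage_expNeg_add_laplaceDeficit hV (ν σ) hg hφ (N.pos i ω)]
    exact le_self_add
  · simpa using expNeg_le_one _

/-- The Laplace functional of the observable process differs little from `E exp (-∑ p (X_i))`, with
`p` the deficit function. -/
lemma IsNoiseModel.abs_integral_expNeg_observed_sub_le (hN : N.IsNoiseModel P V ν)
    (hV : Measurable V) (σ : ℝ≥0) [IsProbabilityMeasure (ν σ)] {g : ℝ → ℝ} (hg : Measurable g)
    {φ : Obs d → ℝ≥0∞} (hφ : Measurable φ)
    (hfin : ∫⁻ ω, ∫⁻ x, laplaceDeficit V (ν σ) g φ x ^ 2 ∂(N.points ω) ∂P ≠ ∞) :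
    |∫ ω, expNeg (∫⁻ p, φ p ∂(N.observed g σ ω)) ∂P -
        ∫ ω, expNeg (∫⁻ x, laplaceDeficit V (ν σ) g φ x ∂(N.points ω)) ∂P| ≤
      (∫⁻ ω, ∫⁻ x, laplaceDeficit V (ν σ) g φ x ^ 2 ∂(N.points ω) ∂P).toReal := by
  set p := laplaceDeficit V (ν σ) g φ
  have hpm : Measurable p := measurable_laplaceDeficit hV (ν σ) hg hφ
  have hp1 : ∀ x, p x ≤ 1 := laplaceDeficit_le_one hV (ν σ) hg hφ
  have ha : ∀ i, Measurable fun ω =>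
      (N.index ω).indicator (fun i => obsIntegrand g φ (N.mark σ i ω)) i :=
    measurable_index_indicator fun i =>
      (measurable_obsIntegrand hg hφ).comp (N.measurable_mark σ i)
  have hb : ∀ i, Measurable fun ω => (N.index ω).indicator (fun i => p (N.pos i ω)) i :=
    measurable_index_indicator fun i => hpm.comp (N.measurable_pos i)
  simp only [N.lintegral_observed σ _ hφ, N.lintegral_points _ hpm]
  -- Conditional independence is a statement about finitely many sensors, hence the limit.
  refine le_of_tendsto ((tendsto_integral_expNeg_sum P ha).sub
    (tendsto_integral_expNeg_sum P hb)).abs (Eventually.of_forall fun n => ?_)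
  rw [hN.integral_expNeg_sum_mark hV σ hg hφ]
  set b : ℕ → Ω → ℝ≥0∞ := fun i ω => (N.index ω).indicator (fun i => p (N.pos i ω)) i
  have hb1 : ∀ i ω, b i ω ≤ 1 := fun i ω =>
    Set.indicator_le' (fun i _ => hp1 _) (fun _ _ => zero_le_one) i
  have hbR : ∀ i ω, (b i ω).toReal ≤ 1 := fun i ω => ENNReal.toReal_le_of_le_ofReal zero_le_one
    (by simpa using hb1 i ω)
  have hI1 : Integrable (fun ω => ∏ i ∈ Finset.range n, (1 - (b i ω).toReal)) P := by
    refine .of_bound (Finset.measurable_prod _ fun i _ =>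
      (hb i).ennreal_toReal.const_sub 1).aestronglyMeasurable 1 (ae_of_all _ fun ω => ?_)
    rw [Real.norm_eq_abs, Finset.abs_prod]
    refine Finset.prod_le_one (fun _ _ => abs_nonneg _) fun i _ => ?_
    rw [abs_of_nonneg (by linarith [hbR i ω])]
    linarith [ENNReal.toReal_nonneg (a := b i ω)]
  have hI2 : Integrable (fun ω => expNeg (∑ i ∈ Finset.range n, b i ω)) P := by
    refine .of_bound (continuous_expNeg.measurable.comp
      (Finset.measurable_sum _ fun i _ => hb i)).aestronglyMeasurable 1 (ae_of_all _ fun ω => ?_)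
    rw [Real.norm_of_nonneg (expNeg_nonneg _)]
    exact expNeg_le_one _
  have hI3 : Integrable (fun ω => ∑ i ∈ Finset.range n, (b i ω).toReal ^ 2) P :=
    integrable_finsetSum _ fun i _ => .of_bound
      ((hb i).ennreal_toReal.pow_const 2).aestronglyMeasurable 1 (ae_of_all _ fun ω => by
        rw [Real.norm_of_nonneg (sq_nonneg _)]
        exact pow_le_one₀ ENNReal.toReal_nonneg (hbR i ω))
  calc |∫ ω, ∏ i ∈ Finset.range n, (1 - (b i ω).toReal) ∂P -
        ∫ ω, expNeg (∑ i ∈ Finset.range n, b i ω) ∂P|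
      ≤ ∫ ω, |∏ i ∈ Finset.range n, (1 - (b i ω).toReal) -
        expNeg (∑ i ∈ Finset.range n, b i ω)| ∂P := by
        rw [← integral_sub hI1 hI2]
        exact abs_integral_le_integral_abs
    _ ≤ ∫ ω, ∑ i ∈ Finset.range n, (b i ω).toReal ^ 2 ∂P :=
        integral_mono (hI1.sub hI2).abs hI3 fun ω =>
          abs_prod_one_sub_sub_expNeg_sum_le _ fun i => hb1 i ω
    _ = (∫⁻ ω, ∑ i ∈ Finset.range n, b i ω ^ 2 ∂P).toReal := by
        have hbt : ∀ i ω, b i ω ^ 2 ≠ ∞ := fun i ω =>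
          ENNReal.pow_ne_top (ne_top_of_le_ne_top ENNReal.one_ne_top (hb1 i ω))
        rw [← integral_toReal (Finset.measurable_sum _ fun i _ => (hb i).pow_const 2).aemeasurable
          (ae_of_all _ fun ω => (ENNReal.sum_lt_top.2 fun i _ => (hbt i ω).lt_top))]
        refine integral_congr_ae (ae_of_all _ fun ω => ?_)
        simp only
        rw [ENNReal.toReal_sum fun i _ => hbt i ω]
        simp
    _ ≤ _ := by
        refine ENNReal.toReal_mono hfin (lintegral_mono fun ω => ?_)
        simp only
        rw [N.lintegral_points _ (hpm.pow_const 2)]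
        refine le_trans (le_of_eq (Finset.sum_congr rfl fun i _ => ?_))
          (ENNReal.sum_le_tsum (Finset.range n))
        by_cases h : i ∈ N.index ω <;> simp [b, h]

end SensorNetwork

/-! ### First and second moments of the sensor locations -/

section Moments

/-- The intensity is `lam`, and for functions `p ≥ 0` the variance of `∑ p (X_i)` is at most
`C ∫ p²`. This weak decorrelation is all that is used of the sensor locations. -/
structure HasVarianceBound {d : ℕ} {Ω : Type*} [MeasurableSpace Ω] (P : Measure Ω)
    (X : Ω → Measure (EuclideanSpace ℝ (Fin d))) (lam : ℝ) (C : ℝ≥0∞) : Prop where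
  mean : ∀ p : EuclideanSpace ℝ (Fin d) → ℝ≥0∞, Measurable p →
    ∫⁻ ω, ∫⁻ x, p x ∂(X ω) ∂P = ENNReal.ofReal lam * ∫⁻ x, p x
  secondMoment_le : ∀ p : EuclideanSpace ℝ (Fin d) → ℝ≥0∞, Measurable p → ∫⁻ x, p x ≠ ∞ →
    ∫⁻ ω, (∫⁻ x, p x ∂(X ω)) ^ 2 ∂P ≤
      (ENNReal.ofReal lam * ∫⁻ x, p x) ^ 2 + C * ∫⁻ x, p x ^ 2

variable {d : ℕ} {Ω : Type*} [MeasurableSpace Ω] {P : Measure Ω}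
  {X : Ω → Measure (EuclideanSpace ℝ (Fin d))} {lam : ℝ}

/-- Campbell's formula for the mean. -/
lemma HasIntensity.lintegral_lintegral (hX : HasIntensity P X lam) (hXm : Measurable X)
    {p : EuclideanSpace ℝ (Fin d) → ℝ≥0∞} (hp : Measurable p) :
    ∫⁻ ω, ∫⁻ x, p x ∂(X ω) ∂P = ENNReal.ofReal lam * ∫⁻ x, p x := by
  have h1 : P.bind X = ENNReal.ofReal lam • volume := by
    ext B hB
    rw [Measure.bind_apply hB hXm.aemeasurable, hX B hB]
    rfl
  rw [← Measure.lintegral_bind hXm.aemeasurable hp.aemeasurable, h1, lintegral_smul_measure,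
    smul_eq_mul]

lemma HasIntensity.ae_singleton_zero (hX : HasIntensity P X lam) (hXm : Measurable X)
    (hd : 1 ≤ d) : ∀ᵐ ω ∂P, X ω {0} = 0 := by
  have : Nonempty (Fin d) := ⟨⟨0, hd⟩⟩
  have h1 := hX {0} (measurableSet_singleton 0)
  rw [measure_singleton, mul_zero] at h1
  exact (lintegral_eq_zero_iff ((Measure.measurable_coe (measurableSet_singleton 0)).comp hXm)).1 h1

/-- Integration in polar coordinates. -/
lemma lintegral_abs_sub_one_lt_top (hd : 1 ≤ d) {h : ℝ → ℝ}
    (hSRD : IntegrableOn (fun r : ℝ => |h r - 1| * r ^ (d - 1)) (Set.Ioi 0)) :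
    ∫⁻ z : EuclideanSpace ℝ (Fin d), ENNReal.ofReal |h ‖z‖ - 1| < ∞ := by
  have : Nonempty (Fin d) := ⟨⟨0, hd⟩⟩
  have h1 : Integrable (fun z : EuclideanSpace ℝ (Fin d) => |h ‖z‖ - 1|) := by
    refine (integrable_fun_norm_addHaar volume (f := fun r => |h r - 1|)).2 ?_
    simpa [mul_comm] using hSRD
  exact h1.lintegral_lt_top

/-- The off-diagonal second moment: since `p x p y ≤ p x ^ 2 + p y ^ 2`, the excess of the pair
correlation function over `1` contributes at most a multiple of `∫ p²`. -/
lemma lintegral_lintegral_pair_le {h : ℝ → ℝ} (hh : Measurable h)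
    {p : EuclideanSpace ℝ (Fin d) → ℝ≥0∞} (hp : Measurable p) :
    ∫⁻ x, ∫⁻ y, p x * p y * ENNReal.ofReal (lam ^ 2 * h (dist x y)) ≤
      ENNReal.ofReal (lam ^ 2) * (∫⁻ x, p x) ^ 2 +
        ENNReal.ofReal (lam ^ 2) * (2 * ∫⁻ z : EuclideanSpace ℝ (Fin d),
          ENNReal.ofReal |h ‖z‖ - 1|) * ∫⁻ x, p x ^ 2 := by
  set k : EuclideanSpace ℝ (Fin d) → ℝ≥0∞ := fun z => ENNReal.ofReal |h ‖z‖ - 1|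
  have hk : Measurable k := ((hh.comp measurable_norm).sub_const 1).abs.ennreal_ofReal
  set L := ENNReal.ofReal (lam ^ 2)
  have hkxy : Measurable fun q : EuclideanSpace ℝ (Fin d) × EuclideanSpace ℝ (Fin d) =>
      k (q.1 - q.2) := hk.comp (measurable_fst.sub measurable_snd)
  -- `h ≤ 1 + |h - 1|`, and `p x * p y ≤ p x ^ 2 + p y ^ 2` in the term with `|h - 1|`.
  have hpt : ∀ x y, p x * p y * ENNReal.ofReal (lam ^ 2 * h (dist x y)) ≤
      L * (p x * p y + (p x ^ 2 * k (x - y) + p y ^ 2 * k (x - y))) := fun x y => by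
    have h1 : ENNReal.ofReal (h (dist x y)) ≤ 1 + k (x - y) := by
      have h2 : h (dist x y) ≤ 1 + |h ‖x - y‖ - 1| := by
        rw [← dist_eq_norm]
        linarith [le_abs_self (h (dist x y) - 1)]
      refine (ENNReal.ofReal_le_ofReal h2).trans ?_
      rw [ENNReal.ofReal_add zero_le_one (abs_nonneg _), ENNReal.ofReal_one]
    have h3 : p x * p y ≤ p x ^ 2 + p y ^ 2 := by
      rcases le_total (p x) (p y) with hxy | hxy
      · calc p x * p y ≤ p y * p y := by gcongr
          _ = p y ^ 2 := (sq _).symm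
          _ ≤ _ := le_add_self
      · calc p x * p y ≤ p x * p x := by gcongr
          _ = p x ^ 2 := (sq _).symm
          _ ≤ _ := le_self_add
    rw [ENNReal.ofReal_mul (sq_nonneg _)]
    calc p x * p y * (L * ENNReal.ofReal (h (dist x y)))
        ≤ p x * p y * (L * (1 + k (x - y))) := by gcongr
      _ = L * (p x * p y + p x * p y * k (x - y)) := by ring
      _ ≤ L * (p x * p y + (p x ^ 2 + p y ^ 2) * k (x - y)) := by gcongr
      _ = _ := by ring
  have hx : ∫⁻ x, ∫⁻ y, p x ^ 2 * k (x - y) = (∫⁻ z, k z) * ∫⁻ x, p x ^ 2 := by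
    have h1 : ∀ x, ∫⁻ y, p x ^ 2 * k (x - y) = (∫⁻ z, k z) * p x ^ 2 := fun x => by
      have e1 : Measurable fun y => k (x - y) := hk.comp (measurable_id.const_sub x)
      rw [lintegral_const_mul _ e1, lintegral_sub_left_eq_self k x, mul_comm]
    simp only [h1]
    rw [lintegral_const_mul _ (hp.pow_const 2)]
  have hy : ∫⁻ x, ∫⁻ y, p y ^ 2 * k (x - y) = (∫⁻ z, k z) * ∫⁻ x, p x ^ 2 := by
    rw [← hx, lintegral_lintegral_swap]
    · refine lintegral_congr fun x => lintegral_congr fun y => ?_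
      simp only [k, norm_sub_rev]
    · exact (((hp.comp measurable_snd).pow_const 2).mul hkxy).aemeasurable
  have hm1 : Measurable fun q : EuclideanSpace ℝ (Fin d) × EuclideanSpace ℝ (Fin d) =>
      p q.1 * p q.2 := (hp.comp measurable_fst).mul (hp.comp measurable_snd)
  have hm2 : Measurable fun q : EuclideanSpace ℝ (Fin d) × EuclideanSpace ℝ (Fin d) =>
      p q.1 ^ 2 * k (q.1 - q.2) := ((hp.comp measurable_fst).pow_const 2).mul hkxy
  have hm3 : Measurable fun q : EuclideanSpace ℝ (Fin d) × EuclideanSpace ℝ (Fin d) =>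
      p q.2 ^ 2 * k (q.1 - q.2) := ((hp.comp measurable_snd).pow_const 2).mul hkxy
  refine (lintegral_mono fun x => lintegral_mono fun y => hpt x y).trans (le_of_eq ?_)
  have h1 : ∀ x, ∫⁻ y, L * (p x * p y + (p x ^ 2 * k (x - y) + p y ^ 2 * k (x - y))) =
      L * (p x * (∫⁻ y, p y) +
        ((∫⁻ y, p x ^ 2 * k (x - y)) + ∫⁻ y, p y ^ 2 * k (x - y))) := fun x => by
    have e1 : Measurable fun y => p x * p y := hm1.comp measurable_prodMk_left
    have e2 : Measurable fun y => p x ^ 2 * k (x - y) := hm2.comp measurable_prodMk_left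
    have e3 : Measurable fun y => p y ^ 2 * k (x - y) := hm3.comp measurable_prodMk_left
    have e4 : Measurable fun y => p x * p y + (p x ^ 2 * k (x - y) + p y ^ 2 * k (x - y)) :=
      e1.add (e2.add e3)
    rw [lintegral_const_mul _ e4, lintegral_add_left e1, lintegral_add_left e2,
      lintegral_const_mul _ hp]
  simp only [h1]
  have f2 : Measurable fun x => ∫⁻ y, p x ^ 2 * k (x - y) := hm2.lintegral_prod_right'
  have f3 : Measurable fun x => ∫⁻ y, p y ^ 2 * k (x - y) := hm3.lintegral_prod_right'
  have f1 : Measurable fun x => p x * ∫⁻ y, p y := hp.mul_const _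
  have f4 : Measurable fun x => p x * (∫⁻ y, p y) +
      ((∫⁻ y, p x ^ 2 * k (x - y)) + ∫⁻ y, p y ^ 2 * k (x - y)) := f1.add (f2.add f3)
  rw [lintegral_const_mul _ f4, lintegral_add_left f1,
    lintegral_add_left f2, hx, hy, lintegral_mul_const _ hp]
  ring

/-- The square of a sum over a simple point process is at most the diagonal plus the off-diagonal
sum. -/
lemma sq_lintegral_le_of_simple {E : Type*} [MeasurableSpace E] [MeasurableSingletonClass E]
    {μ : Measure E} (hμ : ∀ x, μ {x} ≤ 1) {p : E → ℝ≥0∞} (hp : Measurable p) :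
    (∫⁻ x, p x ∂μ) ^ 2 ≤
      ∫⁻ x, p x ^ 2 ∂μ + ∫⁻ x, ∫⁻ y in {x}ᶜ, p x * p y ∂μ ∂μ := by
  rw [← lintegral_add_left (hp.pow_const 2), sq, ← lintegral_mul_const _ hp]
  refine lintegral_mono fun x => ?_
  simp only
  rw [lintegral_const_mul _ hp, ← lintegral_add_compl p (measurableSet_singleton x), mul_add, sq]
  gcongr
  rw [lintegral_singleton]
  calc p x * μ {x} ≤ p x * 1 := by gcongr; exact hμ x
    _ = p x := mul_one _

/-- Integrability of `|h - 1|` against Lebesgue measure on `ℝᵈ` bounds the variances: the constant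
is finite by `lintegral_abs_sub_one_lt_top`. -/
lemma IsPairCorrelation.hasVarianceBound {h : ℝ → ℝ}
    (hpair : IsPairCorrelation P X lam h) (hXm : Measurable X) (hX : HasIntensity P X lam)
    (hsimple : ∀ᵐ ω ∂P, ∀ x, X ω {x} ≤ 1)
    (hlam : 0 < lam) : HasVarianceBound P X lam (ENNReal.ofReal lam +
      ENNReal.ofReal (lam ^ 2) * (2 * ∫⁻ z : EuclideanSpace ℝ (Fin d),
        ENNReal.ofReal |h ‖z‖ - 1|)) where
  mean p hp := hX.lintegral_lintegral hXm hp
  secondMoment_le p hp _ := by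
    have h1 : ∫⁻ ω, (∫⁻ x, p x ∂(X ω)) ^ 2 ∂P ≤ ∫⁻ ω, (∫⁻ x, p x ^ 2 ∂(X ω) +
        ∫⁻ x, ∫⁻ y in {x}ᶜ, p x * p y ∂(X ω) ∂(X ω)) ∂P := by
      refine lintegral_mono_ae ?_
      filter_upwards [hsimple] with ω hω
      exact sq_lintegral_le_of_simple hω hp
    refine h1.trans ?_
    have h2 : Measurable fun ω => ∫⁻ x, p x ^ 2 ∂(X ω) :=
      (Measure.measurable_lintegral (hp.pow_const 2)).comp hXm
    rw [lintegral_add_left h2, hX.lintegral_lintegral hXm (hp.pow_const 2),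
      hpair.productDensity (fun q => p q.1 * p q.2)
        ((hp.comp measurable_fst).mul (hp.comp measurable_snd))]
    refine (add_le_add le_rfl (lintegral_lintegral_pair_le hpair.measurable hp)).trans
      (le_of_eq ?_)
    rw [mul_pow, ENNReal.ofReal_pow hlam.le]
    ring

lemma lintegral_poissonMeasure (r : ℝ≥0) :
    ∫⁻ n, (n : ℝ≥0∞) ∂(poissonMeasure r) = r ∧
      ∫⁻ n, (n : ℝ≥0∞) ^ 2 ∂(poissonMeasure r) = (r : ℝ≥0∞) ^ 2 + r := by
  -- `(n + 1) P(n + 1) = r P(n)` shifts both moments to lower ones.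
  have hrec : ∀ n : ℕ, ((n + 1 : ℕ) : ℝ≥0∞) * poissonMeasure r {n + 1} =
      r * poissonMeasure r {n} := fun n => by
    rw [poissonMeasure_singleton, poissonMeasure_singleton, ← ENNReal.ofReal_natCast (n + 1),
      ← ENNReal.ofReal_mul (by positivity), ← ENNReal.ofReal_coe_nnreal,
      ← ENNReal.ofReal_mul (by positivity)]
    congr 1
    rw [Nat.factorial_succ, pow_succ]
    push_cast
    field_simp
  have hsum : ∑' n, poissonMeasure r {n} = 1 := by
    have := lintegral_countable' (μ := poissonMeasure r) fun _ => 1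
    simpa using this.symm
  have h1 : ∑' n : ℕ, (n : ℝ≥0∞) * poissonMeasure r {n} = r := by
    rw [tsum_eq_zero_add' ENNReal.summable]
    simp only [hrec]
    rw [ENNReal.tsum_mul_left, hsum]
    simp
  refine ⟨by rw [lintegral_countable', h1], ?_⟩
  rw [lintegral_countable', tsum_eq_zero_add' ENNReal.summable]
  have h2 : ∀ n : ℕ, ((n + 1 : ℕ) : ℝ≥0∞) ^ 2 * poissonMeasure r {n + 1} =
      r * (n * poissonMeasure r {n} + poissonMeasure r {n}) := fun n => by
    rw [sq, mul_assoc, hrec]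
    push_cast
    ring
  simp only [h2]
  rw [ENNReal.tsum_mul_left, ENNReal.tsum_add, h1, hsum]
  simp
  ring

namespace IsHomogeneousPoisson

lemma lintegral_comp_count (hX : IsHomogeneousPoisson P X lam) (hXm : Measurable X)
    {B : Set (EuclideanSpace ℝ (Fin d))} (hB : MeasurableSet B) (hBfin : volume B ≠ ∞)
    {f : ℝ≥0∞ → ℝ≥0∞} (hf : Measurable f) :
    ∫⁻ ω, f (X ω B) ∂P = ∫⁻ n : ℕ, f n ∂(poissonMeasure (lam * (volume B).toReal).toNNReal) := by
  have h1 : Measurable fun ω => X ω B := (Measure.measurable_coe hB).comp hXm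
  rw [← lintegral_map hf h1, hX.count_law B hB hBfin, lintegral_map hf (by fun_prop)]

lemma coe_rate (hlam : 0 < lam) {B : Set (EuclideanSpace ℝ (Fin d))} (hBfin : volume B ≠ ∞) :
    ((lam * (volume B).toReal).toNNReal : ℝ≥0∞) = ENNReal.ofReal lam * volume B := by
  rw [← ENNReal.ofReal, ENNReal.ofReal_mul hlam.le, ENNReal.ofReal_toReal hBfin]

lemma hasIntensity (hX : IsHomogeneousPoisson P X lam) (hXm : Measurable X) (hlam : 0 < lam) :
    HasIntensity P X lam := by
  suffices h : P.bind X = ENNReal.ofReal lam • volume by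
    intro B hB
    rw [← Measure.bind_apply hB hXm.aemeasurable, h]
    rfl
  refine Measure.ext_of_iUnion_eq_univ
    (iUnion_spanningSets (volume : Measure (EuclideanSpace ℝ (Fin d)))) fun n => ?_
  ext B hB
  have hm := hB.inter (measurableSet_spanningSets (volume : Measure (EuclideanSpace ℝ (Fin d))) n)
  have hfin : volume (B ∩ spanningSets volume n) ≠ ∞ :=
    ne_top_of_le_ne_top (measure_spanningSets_lt_top volume n).ne
      (measure_mono Set.inter_subset_right)
  rw [Measure.restrict_apply hB, Measure.restrict_apply hB,
    Measure.bind_apply hm hXm.aemeasurable]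
  refine (hX.lintegral_comp_count hXm hm hfin measurable_id).trans ?_
  simp only [id]
  rw [(lintegral_poissonMeasure _).1, coe_rate hlam hfin]
  rfl

/-- The second moment of a finite linear combination of counts of disjoint sets. -/
lemma lintegral_sq_sum (hX : IsHomogeneousPoisson P X lam) (hXm : Measurable X) (hlam : 0 < lam)
    {ι : Type*} (s : Finset ι) (c : ι → ℝ≥0∞) (B : ι → Set (EuclideanSpace ℝ (Fin d)))
    (hB : ∀ i ∈ s, MeasurableSet (B i)) (hBfin : ∀ i ∈ s, volume (B i) ≠ ∞)
    (hdisj : (s : Set ι).PairwiseDisjoint B) :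
    ∫⁻ ω, (∑ i ∈ s, c i * X ω (B i)) ^ 2 ∂P =
      (∑ i ∈ s, c i * (ENNReal.ofReal lam * volume (B i))) ^ 2 +
        ∑ i ∈ s, c i ^ 2 * (ENNReal.ofReal lam * volume (B i)) := by
  classical
  have hm : ∀ i ∈ s, Measurable fun ω => X ω (B i) := fun i hi =>
    (Measure.measurable_coe (hB i hi)).comp hXm
  have hmean : ∀ i ∈ s, ∫⁻ ω, X ω (B i) ∂P = ENNReal.ofReal lam * volume (B i) := fun i hi =>
    hX.hasIntensity hXm hlam _ (hB i hi)
  have hprod : ∀ i ∈ s, ∀ j ∈ s, ∫⁻ ω, X ω (B i) * X ω (B j) ∂P =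
      ENNReal.ofReal lam * volume (B i) * (ENNReal.ofReal lam * volume (B j)) +
        if i = j then ENNReal.ofReal lam * volume (B i) else 0 := by
    intro i hi j hj
    split_ifs with hij
    · subst hij
      have h1 := hX.lintegral_comp_count hXm (hB i hi) (hBfin i hi)
        (measurable_id.pow_const 2)
      simp only [id] at h1
      rw [(lintegral_poissonMeasure _).2, coe_rate hlam (hBfin i hi)] at h1
      simpa [sq] using h1
    · have hpair := hX.count_indep 2 ![B i, B j]
        (fun k => by fin_cases k <;> simp [hB i hi, hB j hj])
        (fun k => by fin_cases k <;> simp [hBfin i hi, hBfin j hj])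
        (fun k l hkl => by
          have h2 : Disjoint (B i) (B j) := hdisj hi hj hij
          fin_cases k <;> fin_cases l <;> simp_all [Function.onFun, disjoint_comm])
      have hind := hpair.indepFun (i := 0) (j := 1) (by simp)
      rw [add_zero, ← hmean i hi, ← hmean j hj]
      exact lintegral_mul_eq_lintegral_mul_lintegral_of_indepFun (hm i hi) (hm j hj) hind
  have h1 : ∀ ω, (∑ i ∈ s, c i * X ω (B i)) ^ 2 =
      ∑ i ∈ s, ∑ j ∈ s, c i * c j * (X ω (B i) * X ω (B j)) := fun ω => by
    rw [sq, Finset.sum_mul_sum]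
    exact Finset.sum_congr rfl fun i _ => Finset.sum_congr rfl fun j _ => by ring
  have hm2 : ∀ i ∈ s, ∀ j ∈ s, Measurable fun ω => X ω (B i) * X ω (B j) := fun i hi j hj =>
    (hm i hi).mul (hm j hj)
  have hm3 : ∀ i ∈ s, ∀ j ∈ s, Measurable fun ω => c i * c j * (X ω (B i) * X ω (B j)) :=
    fun i hi j hj => (hm2 i hi j hj).const_mul _
  simp only [h1]
  rw [lintegral_finsetSum s fun i hi => Finset.measurable_sum _ fun j hj => hm3 i hi j hj]
  have h2 : ∀ i ∈ s, ∫⁻ ω, ∑ j ∈ s, c i * c j * (X ω (B i) * X ω (B j)) ∂P =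
      ∑ j ∈ s, c i * (ENNReal.ofReal lam * volume (B i)) *
        (c j * (ENNReal.ofReal lam * volume (B j))) +
        c i ^ 2 * (ENNReal.ofReal lam * volume (B i)) := fun i hi => by
    rw [lintegral_finsetSum s fun j hj => hm3 i hi j hj]
    have h3 : ∀ j ∈ s, ∫⁻ ω, c i * c j * (X ω (B i) * X ω (B j)) ∂P =
        c i * (ENNReal.ofReal lam * volume (B i)) * (c j * (ENNReal.ofReal lam * volume (B j))) +
        if i = j then c i ^ 2 * (ENNReal.ofReal lam * volume (B i)) else 0 := fun j hj => by
      rw [lintegral_const_mul _ (hm2 i hi j hj), hprod i hi j hj]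
      split_ifs with hij
      · subst hij
        ring
      · ring
    rw [Finset.sum_congr rfl h3, Finset.sum_add_distrib, Finset.sum_ite_eq, if_pos hi]
  rw [Finset.sum_congr rfl h2, Finset.sum_add_distrib, sq, Finset.sum_mul_sum]

lemma hasVarianceBound (hX : IsHomogeneousPoisson P X lam) (hXm : Measurable X) (hlam : 0 < lam) :
    HasVarianceBound P X lam (ENNReal.ofReal lam) where
  mean p hp := (hX.hasIntensity hXm hlam).lintegral_lintegral hXm hp
  secondMoment_le p hp hpfin := by
    -- By monotone convergence it suffices to treat simple functions.
    set φ : ℕ → SimpleFunc (EuclideanSpace ℝ (Fin d)) ℝ≥0∞ := SimpleFunc.eapprox p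
    have hφp : ∀ n x, φ n x ≤ p x := fun n x => by
      rw [← SimpleFunc.iSup_eapprox_apply hp x]
      exact le_iSup (fun n => φ n x) n
    have hlim : Tendsto (fun n => ∫⁻ ω, (∫⁻ x, φ n x ∂(X ω)) ^ 2 ∂P) atTop
        (𝓝 (∫⁻ ω, (∫⁻ x, p x ∂(X ω)) ^ 2 ∂P)) := by
      refine lintegral_tendsto_of_tendsto_of_monotone (fun n => ?_) (ae_of_all _ fun ω => ?_)
        (ae_of_all _ fun ω => ?_)
      · exact (((Measure.measurable_lintegral (φ n).measurable).comp hXm).pow_const 2).aemeasurable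
      · intro m n hmn
        exact pow_le_pow_left₀ zero_le
          (lintegral_mono fun x => SimpleFunc.monotone_eapprox p hmn x) 2
      · refine (ENNReal.continuous_pow 2).continuousAt.tendsto.comp ?_
        exact lintegral_tendsto_of_tendsto_of_monotone (fun n => (φ n).measurable.aemeasurable)
          (ae_of_all _ fun x m n hmn => SimpleFunc.monotone_eapprox p hmn x)
          (ae_of_all _ fun x => SimpleFunc.tendsto_eapprox hp x)
    refine le_of_tendsto' hlim fun n => ?_
    -- The value `0` is left out, as its level set may have infinite volume, where nothing is known
    -- about the counts.
    set s := (φ n).range.filter (· ≠ 0)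
    have hint : ∀ (μ : Measure (EuclideanSpace ℝ (Fin d))) (k : ℕ), k ≠ 0 →
        ∫⁻ x, φ n x ^ k ∂μ = ∑ c ∈ s, c ^ k * μ (φ n ⁻¹' {c}) := fun μ k hk => by
      have h1 := SimpleFunc.map_lintegral (μ := μ) (fun c => c ^ k) (φ n)
      rw [← SimpleFunc.lintegral_eq_lintegral] at h1
      refine h1.trans (Finset.sum_filter_of_ne (p := (· ≠ 0)) fun c _ hc hc0 => hc ?_).symm
      simp [hc0, hk]
    have hint1 : ∀ μ : Measure (EuclideanSpace ℝ (Fin d)),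
        ∫⁻ x, φ n x ∂μ = ∑ c ∈ s, c * μ (φ n ⁻¹' {c}) := fun μ => by
      simpa using hint μ 1 one_ne_zero
    have hfin : ∀ c ∈ s, volume (φ n ⁻¹' {c}) ≠ ∞ := fun c hc => by
      have h2 : c * volume (φ n ⁻¹' {c}) ≠ ∞ := by
        refine ne_top_of_le_ne_top hpfin ?_
        refine le_trans ?_ (lintegral_mono (hφp n))
        rw [hint1]
        exact Finset.single_le_sum (f := fun c => c * volume (φ n ⁻¹' {c}))
          (fun _ _ => zero_le) hc
      intro h3
      rw [h3, ENNReal.mul_top (Finset.mem_filter.1 hc).2] at h2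
      exact h2 rfl
    simp only [hint1]
    rw [hX.lintegral_sq_sum hXm hlam s (fun c => c) (fun c => φ n ⁻¹' {c})
      (fun c _ => (φ n).measurableSet_fiber c) hfin
      (fun c _ c' _ hcc => (Set.disjoint_singleton.2 hcc).preimage _)]
    have h4 : ∑ c ∈ s, c * (ENNReal.ofReal lam * volume (φ n ⁻¹' {c})) =
        ENNReal.ofReal lam * ∫⁻ x, φ n x := by
      rw [hint1, Finset.mul_sum]
      exact Finset.sum_congr rfl fun c _ => by ring
    have h5 : ∑ c ∈ s, c ^ 2 * (ENNReal.ofReal lam * volume (φ n ⁻¹' {c})) =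
        ENNReal.ofReal lam * ∫⁻ x, φ n x ^ 2 := by
      rw [hint _ 2 two_ne_zero, Finset.mul_sum]
      exact Finset.sum_congr rfl fun c _ => by ring
    rw [h4, h5]
    gcongr with x x
    · exact hφp n x
    · exact hφp n x

end IsHomogeneousPoisson

end Moments

/-! ### Detection probabilities -/

section Detection

variable {d : ℕ} {g : ℝ → ℝ}

/-- The probability `P (g |x| ≤ S b)`, for `S` of law `ρ`, that a sensor at `x` contributes a point
with first coordinate at most `b` to the observable process. -/
def detectionProb (g : ℝ → ℝ) (ρ : Measure ℝ) (b : ℝ) (x : EuclideanSpace ℝ (Fin d)) : ℝ≥0∞ :=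
  ρ {s | g ‖x‖ ≤ s * b}

lemma measurableSet_detection (hg : Measurable g) (b : ℝ) :
    MeasurableSet {q : EuclideanSpace ℝ (Fin d) × ℝ | g ‖q.1‖ ≤ q.2 * b} :=
  measurableSet_le (hg.comp measurable_fst.norm) (measurable_snd.mul_const b)

lemma detectionProb_le_one (ρ : Measure ℝ) [IsProbabilityMeasure ρ] (b : ℝ)
    (x : EuclideanSpace ℝ (Fin d)) : detectionProb g ρ b x ≤ 1 := prob_le_one

lemma markAverage_le_detectionProb (V : ℝ → ℝ) (ρ : Measure ℝ) [SFinite ρ] {b : ℝ} {c : ℝ≥0∞}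
    {u : EuclideanSpace ℝ (Fin d) × ((Fin (d - 1) → ℝ) × ℝ) → ℝ≥0∞} (huc : ∀ y, u y ≤ c)
    (hu : ∀ y, u y ≠ 0 → g ‖y.1‖ ≤ y.2.2 * b) (x : EuclideanSpace ℝ (Fin d)) :
    markAverage V ρ u x ≤ c * detectionProb g ρ b x := by
  have hS : MeasurableSet {s : ℝ | g ‖x‖ ≤ s * b} :=
    measurableSet_le measurable_const (measurable_id.mul_const b)
  have h1 : noiseLaw d ρ (Set.univ ×ˢ {s | g ‖x‖ ≤ s * b}) = detectionProb g ρ b x := by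
    rw [Measure.prod_prod, measure_univ, one_mul]
    rfl
  rw [← h1, ← lintegral_indicator_const (MeasurableSet.univ.prod hS)]
  refine lintegral_mono fun w => ?_
  by_cases hw : g ‖x‖ ≤ w.2 * b
  · rw [Set.indicator_of_mem (by simpa using hw)]
    exact huc _
  · rw [Set.indicator_of_notMem (by simpa using hw), nonpos_iff_eq_zero]
    by_contra h2
    exact hw (hu (x, (noisyAOA V x w.1, w.2)) h2)

lemma le_of_obsIntegrand_ne_zero (hg0 : ∀ r, 0 ≤ g r) {φ : Obs d → ℝ≥0∞} {b : ℝ}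
    (hφ : ∀ p, φ p ≠ 0 → (p.1 : ℝ) ≤ b) {y : EuclideanSpace ℝ (Fin d) × ((Fin (d - 1) → ℝ) × ℝ)}
    (hy : obsIntegrand g φ y ≠ 0) : g ‖y.1‖ ≤ y.2.2 * b := by
  have h1 : ∃ p, obsInclusion p = (g ‖y.1‖ / y.2.2, y.2.1) := by
    by_contra h
    refine hy ?_
    rw [obsIntegrand, Function.extend_apply' _ _ _ h]
    rfl
  obtain ⟨p, hp⟩ := h1
  rw [obsIntegrand, ← hp, measurableEmbedding_obsInclusion.injective.extend_apply] at hy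
  have h2 : (p.1 : ℝ) = g ‖y.1‖ / y.2.2 := congrArg Prod.fst hp
  have h3 : 0 < g ‖y.1‖ / y.2.2 := h2 ▸ p.1.2
  have h4 : 0 < y.2.2 := by
    by_contra h
    exact absurd h3 (not_lt.2 (div_nonpos_of_nonneg_of_nonpos (hg0 _) (not_lt.1 h)))
  have h5 := h2 ▸ hφ p hy
  rwa [div_le_iff₀ h4, mul_comm] at h5

lemma laplaceDeficit_le_detectionProb (V : ℝ → ℝ) (ρ : Measure ℝ) [SFinite ρ]
    (hg0 : ∀ r, 0 ≤ g r) {φ : Obs d → ℝ≥0∞} {b : ℝ} (hφ : ∀ p, φ p ≠ 0 → (p.1 : ℝ) ≤ b)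
    (x : EuclideanSpace ℝ (Fin d)) :
    laplaceDeficit V ρ g φ x ≤ detectionProb g ρ b x := by
  rw [← one_mul (detectionProb g ρ b x)]
  refine markAverage_le_detectionProb V ρ (fun y => ?_) (fun y hy => ?_) x
  · rw [ENNReal.ofReal_le_one]
    linarith [expNeg_nonneg (obsIntegrand g φ y)]
  · refine le_of_obsIntegrand_ne_zero hg0 hφ fun h => hy ?_
    simp [h]

lemma ofReal_le_genInverse (hg : MonotoneOn g (Set.Ioi 0)) {r y : ℝ} (hr : 0 < r) (hy : g r ≤ y) :
    ENNReal.ofReal r ≤ genInverse g y := by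
  refine le_sInf ?_
  rintro _ ⟨x, ⟨hx, hyx⟩, rfl⟩
  refine ENNReal.ofReal_le_ofReal ?_
  by_contra! h
  exact absurd (hg hx hr h.le) (not_le.2 (hy.trans_lt hyx))

lemma volume_setOf_norm_le (hd : 1 ≤ d) (y : ℝ≥0∞) :
    volume {x : EuclideanSpace ℝ (Fin d) | ENNReal.ofReal ‖x‖ ≤ y} ≤
      y ^ d * volume (Metric.ball (0 : EuclideanSpace ℝ (Fin d)) 1) := by
  by_cases hy : y = ∞
  · rw [hy, ENNReal.top_pow (by omega), ENNReal.top_mul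
      (Metric.measure_ball_pos volume 0 one_pos).ne']
    exact le_top
  · lift y to ℝ≥0 using hy
    have h1 : {x : EuclideanSpace ℝ (Fin d) | ENNReal.ofReal ‖x‖ ≤ (y : ℝ≥0∞)} =
        Metric.closedBall 0 (y : ℝ) := by
      ext x
      rw [Set.mem_ofPred_eq, mem_closedBall_zero_iff, ← ENNReal.ofReal_coe_nnreal,
        ENNReal.ofReal_le_ofReal_iff y.coe_nonneg]
    rw [h1, Measure.addHaar_closedBall _ _ y.coe_nonneg, finrank_euclideanSpace_fin,
      ENNReal.ofReal_pow y.coe_nonneg, ENNReal.ofReal_coe_nnreal]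

/-- Integrating the detection probability over the location of the sensor: by Fubini's theorem it
is at most the average of the volumes of balls of radius `g⁻¹ (S b)`. -/
lemma lintegral_detectionProb_le (hd : 1 ≤ d) (hg : Measurable g)
    (hgm : MonotoneOn g (Set.Ioi 0)) (ρ : Measure ℝ) [SFinite ρ] (b : ℝ) :
    ∫⁻ x, detectionProb (d := d) g ρ b x ≤
      inverseMoment d g ρ b * volume (Metric.ball (0 : EuclideanSpace ℝ (Fin d)) 1) := by
  have : Nonempty (Fin d) := ⟨⟨0, hd⟩⟩
  have hS := measurableSet_detection (d := d) hg b
  have h1 : ∫⁻ x, detectionProb (d := d) g ρ b x =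
      ∫⁻ s, volume {x : EuclideanSpace ℝ (Fin d) | g ‖x‖ ≤ s * b} ∂ρ :=
    (Measure.prod_apply hS).symm.trans (Measure.prod_apply_symm hS)
  rw [h1, inverseMoment, ← lintegral_mul_const' _ _ measure_ball_lt_top.ne]
  refine lintegral_mono fun s => le_trans (measure_mono_ae ?_) (volume_setOf_norm_le hd _)
  have h2 : ∀ᵐ x : EuclideanSpace ℝ (Fin d), x ≠ 0 := by
    simp [ae_iff]
  filter_upwards [h2] with x hx hxs
  exact ofReal_le_genInverse hgm (norm_pos_iff.2 hx) hxs

/-- Near the origin the detection probability is at most `1`; outside of the ball of radius `δ` a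
sensor is detected only if `S ≥ g δ / b`. -/
lemma lintegral_sq_detectionProb_le (hgm : MonotoneOn g (Set.Ioi 0)) (ρ : Measure ℝ)
    [IsProbabilityMeasure ρ] {b δ : ℝ} (hb : 0 < b) (hδ : 0 < δ) :
    ∫⁻ x, detectionProb (d := d) g ρ b x ^ 2 ≤
      volume (Metric.ball (0 : EuclideanSpace ℝ (Fin d)) δ) +
        ρ {s | g δ / b ≤ |s|} * ∫⁻ x, detectionProb (d := d) g ρ b x := by
  rw [← lintegral_const_mul' _ _ (measure_ne_top _ _),
    ← lintegral_indicator_one Metric.isOpen_ball.measurableSet, ← lintegral_add_left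
      (measurable_one.indicator Metric.isOpen_ball.measurableSet)]
  refine lintegral_mono fun x => ?_
  simp only
  by_cases hx : x ∈ Metric.ball (0 : EuclideanSpace ℝ (Fin d)) δ
  · rw [Set.indicator_of_mem hx]
    exact (pow_le_one₀ zero_le (detectionProb_le_one ρ b x)).trans le_self_add
  · rw [Set.indicator_of_notMem hx, zero_add, sq]
    refine mul_le_mul_left (measure_mono fun s hs => ?_) _
    have hδx : δ ≤ ‖x‖ := by simpa using hx
    have h1 : g δ ≤ s * b := (hgm hδ (hδ.trans_le hδx) hδx).trans hs
    exact ((div_le_iff₀ hb).2 h1).trans (le_abs_self s)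

/-- Single sensors become undetectable: sensors at distance at least `δ` because the fading
variables vanish in the limit, while those closer occupy a small volume. -/
lemma tendsto_lintegral_sq_detectionProb (hd : 1 ≤ d) (hg : Measurable g)
    (hgm : MonotoneOn g (Set.Ioi 0)) (hgpos : ∀ r, 0 < r → 0 < g r) {ν : ℝ≥0 → Measure ℝ}
    (hν : ∀ σ, IsProbabilityMeasure (ν σ))
    (hν_zero : ∀ ε : ℝ, 0 < ε → Tendsto (fun σ => ν σ {s | ε ≤ |s|}) atTop (𝓝 0))
    {b : ℝ} (hb : 0 < b) (hmom : limsup (fun σ => inverseMoment d g (ν σ) b) atTop < ∞) :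
    Tendsto (fun σ => ∫⁻ x, detectionProb (d := d) g (ν σ) b x ^ 2) atTop (𝓝 0) := by
  have : Nonempty (Fin d) := ⟨⟨0, hd⟩⟩
  obtain ⟨M, hM1, hM2⟩ := exists_between hmom
  set c := volume (Metric.ball (0 : EuclideanSpace ℝ (Fin d)) 1)
  have hMc : M * c ≠ ∞ := ENNReal.mul_ne_top hM2.ne measure_ball_lt_top.ne
  rw [ENNReal.tendsto_nhds_zero]
  intro ε hε
  have hε2 : 0 < ε / 2 := ENNReal.half_pos hε.ne'
  obtain ⟨δ, hδ, hδε⟩ : ∃ δ : ℝ, 0 < δ ∧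
      volume (Metric.ball (0 : EuclideanSpace ℝ (Fin d)) δ) ≤ ε / 2 := by
    have h1 : Tendsto (fun δ : ℝ => volume (Metric.closedBall (0 : EuclideanSpace ℝ (Fin d)) δ))
        (𝓝[>] 0) (𝓝 0) := by
      have h2 : Tendsto (fun δ : ℝ => ENNReal.ofReal (δ ^ d) * c) (𝓝[>] 0) (𝓝 0) := by
        have h3 : Tendsto (fun δ : ℝ => ENNReal.ofReal (δ ^ d)) (𝓝[>] 0) (𝓝 0) := by
          have h4 : Tendsto (fun δ : ℝ => ENNReal.ofReal (δ ^ d)) (𝓝 0) (𝓝 0) := by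
            have h5 : Continuous fun δ : ℝ => ENNReal.ofReal (δ ^ d) :=
              ENNReal.continuous_ofReal.comp (continuous_pow d)
            have h6 := h5.tendsto 0
            simp only [zero_pow (by omega : d ≠ 0), ENNReal.ofReal_zero] at h6
            exact h6
          exact h4.mono_left nhdsWithin_le_nhds
        have := ENNReal.Tendsto.mul_const h3 (Or.inr (measure_ball_lt_top
          (μ := volume) (x := (0 : EuclideanSpace ℝ (Fin d))) (r := 1)).ne)
        simpa using this
      refine h2.congr' ?_
      filter_upwards [self_mem_nhdsWithin] with δ hδ
      rw [Measure.addHaar_closedBall _ _ (le_of_lt hδ), finrank_euclideanSpace_fin]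
    obtain ⟨δ, h1, h2⟩ := ((h1.eventually_le_const hε2).and self_mem_nhdsWithin).exists
    exact ⟨δ, h2, (measure_mono Metric.ball_subset_closedBall).trans h1⟩
  have hlim : Tendsto (fun σ => ν σ {s | g δ / b ≤ |s|} * (M * c)) atTop (𝓝 0) := by
    have := ENNReal.Tendsto.mul_const (hν_zero (g δ / b) (div_pos (hgpos δ hδ) hb))
      (Or.inr hMc)
    simpa using this
  filter_upwards [hlim.eventually_le_const hε2, eventually_lt_of_limsup_lt hM1] with σ h1 h2
  have h3 : ∫⁻ x, detectionProb (d := d) g (ν σ) b x ≤ M * c :=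
    (lintegral_detectionProb_le hd hg hgm (ν σ) b).trans (mul_le_mul_left h2.le c)
  calc ∫⁻ x, detectionProb (d := d) g (ν σ) b x ^ 2
      ≤ volume (Metric.ball (0 : EuclideanSpace ℝ (Fin d)) δ) +
        ν σ {s | g δ / b ≤ |s|} * ∫⁻ x, detectionProb (d := d) g (ν σ) b x :=
        lintegral_sq_detectionProb_le hgm (ν σ) hb hδ
    _ ≤ ε / 2 + ν σ {s | g δ / b ≤ |s|} * (M * c) := by gcongr
    _ ≤ ε / 2 + ε / 2 := by gcongr
    _ = ε := ENNReal.add_halves ε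

end Detection

/-! ### The observable process of a single network -/

section ObsSpace

variable {d : ℕ}

instance instLocallyCompactSpaceObs : LocallyCompactSpace (Obs d) := by
  have : LocallyCompactSpace (Set.Ioi (0 : ℝ)) := isOpen_Ioi.locallyCompactSpace
  infer_instance

lemma exists_fst_le_of_isCompact {K : Set (Obs d)} (hK : IsCompact K) :
    ∃ b : ℝ, 0 < b ∧ ∀ p ∈ K, (p.1 : ℝ) ≤ b := by
  have h1 : Continuous fun p : Obs d => (p.1 : ℝ) := continuous_subtype_val.comp continuous_fst
  obtain ⟨b, hb⟩ := (hK.image h1).bddAbove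
  exact ⟨max b 1, lt_max_of_lt_right one_pos, fun p hp =>
    (hb (Set.mem_image_of_mem _ hp)).trans (le_max_left _ _)⟩

lemma measurableSet_fst_le (b : ℝ) : MeasurableSet {p : Obs d | (p.1 : ℝ) ≤ b} :=
  measurableSet_le (measurable_subtype_coe.comp measurable_fst) measurable_const

lemma isLocallyFiniteMeasure_of_fst_le {μ : Measure (Obs d)}
    (hμ : ∀ n : ℕ, μ {p | (p.1 : ℝ) ≤ n + 1} < ∞) : IsLocallyFiniteMeasure μ := by
  refine ⟨fun p => ?_⟩
  obtain ⟨n, hn⟩ := exists_nat_gt (p.1 : ℝ)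
  refine ⟨{p | (p.1 : ℝ) ≤ n + 1}, ?_, hμ n⟩
  have h1 : Continuous fun p : Obs d => (p.1 : ℝ) := continuous_subtype_val.comp continuous_fst
  exact (h1.tendsto p).eventually_le_const (by linarith)

end ObsSpace

namespace SensorNetwork

variable {d : ℕ} {Ω : Type*} [MeasurableSpace Ω] {N : SensorNetwork d Ω}
  {P : Measure Ω} [IsProbabilityMeasure P] {V : ℝ → ℝ} {ν : ℝ≥0 → Measure ℝ} {g : ℝ → ℝ}
  {lam : ℝ} {C : ℝ≥0∞}

/-- The Laplace functional is close to `exp (-lam ∫ p)`, with `p` the deficit function: this is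
the Laplace functional of the observable process of a Poisson network. -/
lemma IsNoiseModel.abs_integral_expNeg_observed_sub_exp_le (hN : N.IsNoiseModel P V ν)
    (hX : HasVarianceBound P N.points lam C) (hC : C ≠ ∞)
    (hV : Measurable V) (σ : ℝ≥0) [IsProbabilityMeasure (ν σ)] (hg : Measurable g)
    {φ : Obs d → ℝ≥0∞} (hφ : Measurable φ) (hfin : ∫⁻ x, laplaceDeficit V (ν σ) g φ x ≠ ∞) :
    |∫ ω, expNeg (∫⁻ p, φ p ∂(N.observed g σ ω)) ∂P -
        Real.exp (-(ENNReal.ofReal lam * ∫⁻ x, laplaceDeficit V (ν σ) g φ x).toReal)| ≤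
      (ENNReal.ofReal lam * ∫⁻ x, laplaceDeficit V (ν σ) g φ x ^ 2).toReal +
        Real.sqrt (C * ∫⁻ x, laplaceDeficit V (ν σ) g φ x ^ 2).toReal := by
  set p := laplaceDeficit V (ν σ) g φ
  have hp : Measurable p := measurable_laplaceDeficit hV (ν σ) hg hφ
  have hp2 : ∫⁻ x, p x ^ 2 ≠ ∞ := ne_top_of_le_ne_top hfin (lintegral_mono fun x =>
    pow_le_of_le_one zero_le (laplaceDeficit_le_one hV (ν σ) hg hφ x) two_ne_zero)
  have h1 := hN.abs_integral_expNeg_observed_sub_le hV σ hg hφ (by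
    rw [hX.mean _ (hp.pow_const 2)]
    exact ENNReal.mul_ne_top ENNReal.ofReal_ne_top hp2)
  rw [hX.mean _ (hp.pow_const 2)] at h1
  have h2 := abs_integral_expNeg_sub_le P
    ((Measure.measurable_lintegral hp).comp N.measurable_points)
    (ENNReal.mul_ne_top ENNReal.ofReal_ne_top hfin) (ENNReal.mul_ne_top hC hp2)
    (hX.mean p hp) (hX.secondMoment_le p hp hfin)
  exact (abs_sub_le _ _ _).trans (add_le_add h1 h2)

/-- The Laplace functional of the observable process is asymptotic to that of a Poisson network. -/
lemma IsNoiseModel.tendsto_laplaceFunctional_sub (hN : N.IsNoiseModel P V ν)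
    (hX : HasVarianceBound P N.points lam C) (hC : C ≠ ∞) (hd : 1 ≤ d)
    (hV : Measurable V) (hg : Measurable g) (hgm : MonotoneOn g (Set.Ioi 0))
    (hg0 : ∀ r, 0 ≤ g r) (hgpos : ∀ r, 0 < r → 0 < g r)
    (hν : ∀ σ, IsProbabilityMeasure (ν σ))
    (hν_zero : ∀ ε : ℝ, 0 < ε → Tendsto (fun σ => ν σ {s | ε ≤ |s|}) atTop (𝓝 0))
    (hmom : ∀ b : ℝ, 0 < b → limsup (fun σ => inverseMoment d g (ν σ) b) atTop < ∞)
    (f : C_c(Obs d, ℝ≥0)) :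
    Tendsto (fun σ => laplaceFunctional P (N.observed g σ) f -
      Real.exp (-(ENNReal.ofReal lam *
        ∫⁻ x, laplaceDeficit V (ν σ) g (fun p => (f p : ℝ≥0∞)) x).toReal)) atTop (𝓝 0) := by
  obtain ⟨b, hb, hbf⟩ := exists_fst_le_of_isCompact (d := d) f.hasCompactSupport
  have hφ : Measurable fun p => (f p : ℝ≥0∞) := f.continuous.measurable.coe_nnreal_ennreal
  have hφb : ∀ p, (f p : ℝ≥0∞) ≠ 0 → (p.1 : ℝ) ≤ b := fun p hp =>
    hbf p (subset_tsupport _ (by simpa using hp))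
  have hsq := tendsto_lintegral_sq_detectionProb hd hg hgm hgpos hν hν_zero hb (hmom b hb)
  have hdef : Tendsto (fun σ => ∫⁻ x, laplaceDeficit V (ν σ) g (fun p => (f p : ℝ≥0∞)) x ^ 2)
      atTop (𝓝 0) := by
    refine tendsto_of_tendsto_of_tendsto_of_le_of_le tendsto_const_nhds hsq (fun _ => zero_le)
      fun σ => lintegral_mono fun x => ?_
    exact pow_le_pow_left₀ zero_le (laplaceDeficit_le_detectionProb V (ν σ) hg0 hφb x) 2
  have hlim : ∀ c : ℝ≥0∞, c ≠ ∞ → Tendsto (fun σ =>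
      (c * ∫⁻ x, laplaceDeficit V (ν σ) g (fun p => (f p : ℝ≥0∞)) x ^ 2).toReal) atTop (𝓝 0) := by
    intro c hc
    have h1 := ENNReal.Tendsto.const_mul hdef (Or.inr hc)
    rw [mul_zero] at h1
    exact (ENNReal.tendsto_toReal ENNReal.zero_ne_top).comp h1
  have hbound : Tendsto (fun σ =>
      (ENNReal.ofReal lam *
        ∫⁻ x, laplaceDeficit V (ν σ) g (fun p => (f p : ℝ≥0∞)) x ^ 2).toReal +
      Real.sqrt (C * ∫⁻ x, laplaceDeficit V (ν σ) g (fun p => (f p : ℝ≥0∞)) x ^ 2).toReal)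
      atTop (𝓝 0) := by
    simpa using (hlim _ ENNReal.ofReal_ne_top).add (hlim C hC).sqrt
  refine squeeze_zero_norm' ?_ hbound
  filter_upwards [eventually_lt_of_limsup_lt (hmom b hb)] with σ hσ
  refine hN.abs_integral_expNeg_observed_sub_exp_le hX hC hV σ hg hφ ?_
  refine ne_top_of_le_ne_top ?_ ((lintegral_mono
    (laplaceDeficit_le_detectionProb V (ν σ) hg0 hφb)).trans
      (lintegral_detectionProb_le hd hg hgm (ν σ) b))
  exact ENNReal.mul_ne_top hσ.ne measure_ball_lt_top.ne

lemma IsNoiseModel.lintegral_observed_fst_le (hN : N.IsNoiseModel P V ν)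
    (hX : HasVarianceBound P N.points lam C) (hd : 1 ≤ d) (hV : Measurable V) (hg : Measurable g)
    (hgm : MonotoneOn g (Set.Ioi 0)) (hg0 : ∀ r, 0 ≤ g r) (σ : ℝ≥0)
    [IsProbabilityMeasure (ν σ)] (b : ℝ) :
    ∫⁻ ω, N.observed g σ ω {p | (p.1 : ℝ) ≤ b} ∂P ≤ ENNReal.ofReal lam *
      (inverseMoment d g (ν σ) b * volume (Metric.ball (0 : EuclideanSpace ℝ (Fin d)) 1)) := by
  set S : Set (Obs d) := {p | (p.1 : ℝ) ≤ b}
  have hS : Measurable (S.indicator (1 : Obs d → ℝ≥0∞)) :=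
    measurable_one.indicator (measurableSet_fst_le b)
  have hu := measurable_obsIntegrand hg hS
  have h1 : ∀ ω, N.observed g σ ω S = ∑' i, (N.index ω).indicator
      (fun i => obsIntegrand g (S.indicator 1) (N.mark σ i ω)) i := fun ω => by
    rw [← lintegral_indicator_one (measurableSet_fst_le b), N.lintegral_observed σ ω hS]
  simp only [h1]
  rw [hN.lintegral_tsum_mark hV σ hu, hX.mean _ (measurable_markAverage hV (ν σ) hu)]
  refine mul_le_mul_right (le_trans (lintegral_mono fun x => ?_)
    (lintegral_detectionProb_le hd hg hgm (ν σ) b)) _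
  rw [← one_mul (detectionProb g (ν σ) b x)]
  refine markAverage_le_detectionProb V (ν σ) (fun y => ?_) (fun y hy => ?_) x
  · unfold obsIntegrand
    by_cases hy : ∃ p, obsInclusion p = (g ‖y.1‖ / y.2.2, y.2.1)
    · obtain ⟨p, hp⟩ := hy
      rw [← hp, measurableEmbedding_obsInclusion.injective.extend_apply]
      exact Set.indicator_le' (fun _ _ => le_rfl) (fun _ _ => zero_le_one) p
    · rw [Function.extend_apply' _ _ _ hy]
      exact zero_le_one
  · refine le_of_obsIntegrand_ne_zero hg0 (φ := S.indicator 1) (fun p hp => ?_) hy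
    have h2 : p ∈ S := Set.mem_of_indicator_ne_zero hp
    exact h2

lemma IsNoiseModel.ae_isLocallyFiniteMeasure_observed (hN : N.IsNoiseModel P V ν)
    (hX : HasVarianceBound P N.points lam C) (hd : 1 ≤ d) (hV : Measurable V) (hg : Measurable g)
    (hgm : MonotoneOn g (Set.Ioi 0)) (hg0 : ∀ r, 0 ≤ g r) (σ : ℝ≥0)
    [IsProbabilityMeasure (ν σ)] (hmom : ∀ b : ℝ, 0 < b → inverseMoment d g (ν σ) b < ∞) :
    ∀ᵐ ω ∂P, IsLocallyFiniteMeasure (N.observed g σ ω) := by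
  have h1 : ∀ n : ℕ, ∀ᵐ ω ∂P, N.observed g σ ω {p | (p.1 : ℝ) ≤ n + 1} < ∞ := fun n => by
    refine ae_lt_top ((Measure.measurable_coe (measurableSet_fst_le _)).comp
      (N.measurable_observed hg σ)) (ne_top_of_le_ne_top ?_
        (hN.lintegral_observed_fst_le hX hd hV hg hgm hg0 σ (n + 1)))
    exact ENNReal.mul_ne_top ENNReal.ofReal_ne_top
      (ENNReal.mul_ne_top (hmom _ (by positivity)).ne measure_ball_lt_top.ne)
  filter_upwards [ae_all_iff.2 h1] with ω hω
  exact isLocallyFiniteMeasure_of_fst_le hω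

end SensorNetwork

/-! ### Tightness -/

/-- Markov's inequality for all cutoff functions at once. -/
lemma measureReal_compl_setOf_integral_le {E Ω : Type*} [TopologicalSpace E] [MeasurableSpace E]
    [BorelSpace E] [LocallyCompactSpace E] [SecondCountableTopology E] [T2Space E]
    [MeasurableSpace Ω] {P : Measure Ω} [IsProbabilityMeasure P] {Y : Ω → Measure E}
    (hY : Measurable Y) {χ : ℕ → C_c(E, ℝ)} (hχ : IsCutoffSequence χ) {c η : ℕ → ℝ≥0}
    (hη : ∀ n, 0 < η n) {ε : ℝ} (hε : 0 < ε)
    (hsum : ∑' n, (η n : ℝ≥0∞) < ENNReal.ofReal ε)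
    (hc : ∀ n, ∫⁻ ω, ∫⁻ x, ENNReal.ofReal (χ n x) ∂(Y ω) ∂P ≤ c n) :
    (P.map fun ω => toLFMeasure (Y ω)).real
      {μ : LFMeasure E | ∀ n, ∫ x, χ n x ∂μ.1 ≤ (c n + 1) / η n}ᶜ ≤ ε := by
  have hYm : Measurable fun ω => toLFMeasure (Y ω) := measurable_toLFMeasure.comp hY
  have hK := (LFMeasure.isClosed_setOf_integral_le χ
    fun n => ((c n : ℝ) + 1) / η n).measurableSet.compl
  rw [measureReal_def, Measure.map_apply hYm hK]
  refine ENNReal.toReal_le_of_le_ofReal hε.le (le_trans ?_ hsum.le)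
  have hsub : (fun ω => toLFMeasure (Y ω)) ⁻¹'
      {μ : LFMeasure E | ∀ n, ∫ x, χ n x ∂μ.1 ≤ (c n + 1) / η n}ᶜ ⊆
      ⋃ n, {ω | (((c n + 1) / η n : ℝ≥0) : ℝ≥0∞) ≤ ∫⁻ x, ENNReal.ofReal (χ n x) ∂(Y ω)} := by
    intro ω hω
    have h1 : ∃ n, ((c n : ℝ) + 1) / η n < ∫ x, χ n x ∂(toLFMeasure (Y ω)).1 := by
      simpa using hω
    obtain ⟨n, hn⟩ := h1
    refine Set.mem_iUnion.2 ⟨n, ?_⟩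
    have h2 : IsLocallyFiniteMeasure (Y ω) := by
      by_contra h
      rw [toLFMeasure_coe_of_not h, integral_zero_measure] at hn
      exact absurd hn (not_lt.2 (by positivity))
    rw [toLFMeasure_coe h2] at hn
    have h3 := ENNReal.ofReal_le_ofReal hn.le
    rw [ofReal_integral_eq_lintegral_ofReal (LFMeasure.integrable ⟨Y ω, h2⟩ (χ n))
      (ae_of_all _ (hχ.nonneg n))] at h3
    refine le_trans (le_of_eq ?_) h3
    rw [← ENNReal.ofReal_coe_nnreal]
    simp
  refine (measure_mono hsub).trans ((measure_iUnion_le _).trans (ENNReal.tsum_le_tsum fun n => ?_))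
  have hpos : (0 : ℝ≥0) < (c n + 1) / η n := div_pos (by positivity) (hη n)
  have hm : Measurable fun ω => ∫⁻ x, ENNReal.ofReal (χ n x) ∂(Y ω) :=
    (Measure.measurable_lintegral (χ n).continuous.measurable.ennreal_ofReal).comp hY
  refine (meas_ge_le_lintegral_div hm.aemeasurable (by exact_mod_cast hpos.ne')
    ENNReal.coe_ne_top).trans ?_
  refine ENNReal.div_le_of_le_mul ((hc n).trans ?_)
  rw [← ENNReal.coe_mul, ENNReal.coe_le_coe, mul_div_cancel₀ _ (hη n).ne']
  exact le_self_add

lemma exists_bound_of_eventually_le {a : ℕ → ℝ≥0∞} {M : ℝ≥0∞} (hM : M ≠ ∞)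
    (ha : ∀ k, a k < ∞) (haM : ∀ᶠ k in atTop, a k ≤ M) : ∃ B : ℝ≥0, ∀ k, a k ≤ B := by
  obtain ⟨K, hK⟩ := eventually_atTop.1 haM
  have hfin : M + ∑ k ∈ Finset.range K, a k ≠ ∞ := ENNReal.add_ne_top.2 ⟨hM,
    (ENNReal.sum_lt_top.2 fun k _ => ha k).ne⟩
  refine ⟨(M + ∑ k ∈ Finset.range K, a k).toNNReal, fun k => ?_⟩
  rw [ENNReal.coe_toNNReal hfin]
  rcases lt_or_ge k K with h | h
  · exact (Finset.single_le_sum (f := a) (fun _ _ => zero_le)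
      (Finset.mem_range.2 h)).trans le_add_self
  · exact (hK k h).trans le_self_add

/-! ### Asymptotic equality in law -/

namespace SensorNetwork

section TwoNetworks

variable {d : ℕ} {Ω Ω' : Type*} [MeasurableSpace Ω] [MeasurableSpace Ω']
  {P : Measure Ω} [IsProbabilityMeasure P] {P' : Measure Ω'} [IsProbabilityMeasure P']
  {N : SensorNetwork d Ω} {N' : SensorNetwork d Ω'} {V : ℝ → ℝ} {ν : ℝ≥0 → Measure ℝ}
  {g : ℝ → ℝ} {lam : ℝ} {C C' : ℝ≥0∞}

lemma IsNoiseModel.lintegral_observed_cutoff_le (hN : N.IsNoiseModel P V ν)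
    (hX : HasVarianceBound P N.points lam C) (hd : 1 ≤ d) (hV : Measurable V) (hg : Measurable g)
    (hgm : MonotoneOn g (Set.Ioi 0)) (hg0 : ∀ r, 0 ≤ g r) (σ : ℝ≥0)
    [IsProbabilityMeasure (ν σ)] {b : ℝ} {χ : Obs d → ℝ} (hχ : ∀ p, χ p ≤ 1)
    (hχb : ∀ p, χ p ≠ 0 → (p.1 : ℝ) ≤ b) :
    ∫⁻ ω, ∫⁻ p, ENNReal.ofReal (χ p) ∂(N.observed g σ ω) ∂P ≤ ENNReal.ofReal lam *
      (inverseMoment d g (ν σ) b * volume (Metric.ball (0 : EuclideanSpace ℝ (Fin d)) 1)) := by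
  refine le_trans (lintegral_mono fun ω => ?_)
    (hN.lintegral_observed_fst_le hX hd hV hg hgm hg0 σ b)
  rw [← lintegral_indicator_one (measurableSet_fst_le b)]
  refine lintegral_mono fun p => ?_
  by_cases hp : (p.1 : ℝ) ≤ b
  · rw [Set.indicator_of_mem (by exact hp)]
    exact ENNReal.ofReal_le_one.2 (hχ p)
  · rw [not_imp_comm.1 (hχb p) hp, ENNReal.ofReal_zero]
    exact zero_le

/-- Along a sequence of noise levels with finite moments, the laws of the observable processes of
two networks of the same intensity are asymptotically equal: their Laplace functionals are, and
the moment bounds give tightness. -/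
lemma IsNoiseModel.tendsto_seq_integral_toLFMeasure_sub (hN : N.IsNoiseModel P V ν)
    (hN' : N'.IsNoiseModel P' V ν) (hX : HasVarianceBound P N.points lam C)
    (hX' : HasVarianceBound P' N'.points lam C') (hC : C ≠ ∞) (hC' : C' ≠ ∞) (hd : 1 ≤ d)
    (hV : Measurable V) (hg : Measurable g) (hgm : MonotoneOn g (Set.Ioi 0))
    (hg0 : ∀ r, 0 ≤ g r) (hgpos : ∀ r, 0 < r → 0 < g r)
    (hν : ∀ σ, IsProbabilityMeasure (ν σ))
    (hν_zero : ∀ ε : ℝ, 0 < ε → Tendsto (fun σ => ν σ {s | ε ≤ |s|}) atTop (𝓝 0))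
    (hmom : ∀ b : ℝ, 0 < b → limsup (fun σ => inverseMoment d g (ν σ) b) atTop < ∞)
    {u : ℕ → ℝ≥0} (hu : Tendsto u atTop atTop)
    (hfin : ∀ k, ∀ b : ℝ, 0 < b → inverseMoment d g (ν (u k)) b < ∞)
    (F : LFMeasure (Obs d) →ᵇ ℝ) :
    Tendsto (fun k => (∫ ω, F (toLFMeasure (N.observed g (u k) ω)) ∂P) -
      ∫ ω, F (toLFMeasure (N'.observed g (u k) ω)) ∂P') atTop (𝓝 0) := by
  have hm : ∀ k, Measurable fun ω => toLFMeasure (N.observed g (u k) ω) := fun k =>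
    measurable_toLFMeasure.comp (N.measurable_observed hg (u k))
  have hm' : ∀ k, Measurable fun ω => toLFMeasure (N'.observed g (u k) ω) := fun k =>
    measurable_toLFMeasure.comp (N'.measurable_observed hg (u k))
  have : ∀ k, IsProbabilityMeasure (P.map fun ω => toLFMeasure (N.observed g (u k) ω)) :=
    fun k => Measure.isProbabilityMeasure_map (hm k).aemeasurable
  have : ∀ k, IsProbabilityMeasure (P'.map fun ω => toLFMeasure (N'.observed g (u k) ω)) :=
    fun k => Measure.isProbabilityMeasure_map (hm' k).aemeasurable
  have key := LFMeasure.tendsto_integral_sub (l := atTop)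
    (fun k => P.map fun ω => toLFMeasure (N.observed g (u k) ω))
    (fun k => P'.map fun ω => toLFMeasure (N'.observed g (u k) ω)) ?_ ?_ F
  · have hF : Measurable F := F.continuous.measurable
    refine key.congr fun k => ?_
    rw [integral_map (hm k).aemeasurable hF.aestronglyMeasurable,
      integral_map (hm' k).aemeasurable hF.aestronglyMeasurable]
  · intro f
    have hf : Measurable (LFMeasure.expNegIntegral f) :=
      (LFMeasure.expNegIntegral f).continuous.measurable
    have h1 := ((hN.tendsto_laplaceFunctional_sub hX hC hd hV hg hgm hg0 hgpos hν hν_zero hmom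
      f).sub (hN'.tendsto_laplaceFunctional_sub hX' hC' hd hV hg hgm hg0 hgpos hν hν_zero hmom
      f)).comp hu
    simp only [sub_sub_sub_cancel_right, sub_zero] at h1
    refine h1.congr fun k => ?_
    simp only [Function.comp_apply, laplaceFunctional]
    rw [integral_map (hm k).aemeasurable hf.aestronglyMeasurable,
      integral_map (hm' k).aemeasurable hf.aestronglyMeasurable]
    congr 1
    · refine integral_congr_ae ?_
      filter_upwards [hN.ae_isLocallyFiniteMeasure_observed hX hd hV hg hgm hg0 (u k) (hfin k)]
        with ω hω
      rw [LFMeasure.expNegIntegral_apply, toLFMeasure_coe hω]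
    · refine integral_congr_ae ?_
      filter_upwards [hN'.ae_isLocallyFiniteMeasure_observed hX' hd hV hg hgm hg0 (u k) (hfin k)]
        with ω hω
      rw [LFMeasure.expNegIntegral_apply, toLFMeasure_coe hω]
  · intro ε hε
    obtain ⟨χ, hχ⟩ := exists_isCutoffSequence (Obs d)
    choose b hb hχb using fun n => exists_fst_le_of_isCompact (χ n).hasCompactSupport
    have hχb' : ∀ n p, χ n p ≠ 0 → (p.1 : ℝ) ≤ b n := fun n p hp =>
      hχb n p (subset_tsupport _ hp)
    have hc : ∀ n, ∃ B : ℝ≥0, ∀ k, ENNReal.ofReal lam * (inverseMoment d g (ν (u k)) (b n) *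
        volume (Metric.ball (0 : EuclideanSpace ℝ (Fin d)) 1)) ≤ B := fun n => by
      obtain ⟨M, hM1, hM2⟩ := exists_between (hmom (b n) (hb n))
      obtain ⟨B, hB⟩ := exists_bound_of_eventually_le hM2.ne (fun k => hfin k (b n) (hb n))
        (hu.eventually ((eventually_lt_of_limsup_lt hM1).mono fun _ => le_of_lt))
      refine ⟨(ENNReal.ofReal lam *
        (B * volume (Metric.ball (0 : EuclideanSpace ℝ (Fin d)) 1))).toNNReal, fun k => ?_⟩
      rw [ENNReal.coe_toNNReal (ENNReal.mul_ne_top ENNReal.ofReal_ne_top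
        (ENNReal.mul_ne_top ENNReal.coe_ne_top measure_ball_lt_top.ne))]
      gcongr
      exact hB k
    choose c hc using hc
    obtain ⟨η, hη, hsum⟩ := ENNReal.exists_pos_sum_of_countable (ENNReal.ofReal_pos.2 hε).ne' ℕ
    refine ⟨_, LFMeasure.isCompact_setOf_integral_le hχ fun n => ((c n : ℝ) + 1) / η n,
      LFMeasure.isClosed_setOf_integral_le χ _, Eventually.of_forall fun k => ⟨?_, ?_⟩⟩
    · exact measureReal_compl_setOf_integral_le (N.measurable_observed hg (u k)) hχ hη hε hsum
        fun n => (hN.lintegral_observed_cutoff_le hX hd hV hg hgm hg0 (u k) (hχ.le_one n)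
          (hχb' n)).trans (hc n k)
    · exact measureReal_compl_setOf_integral_le (N'.measurable_observed hg (u k)) hχ hη hε hsum
        fun n => (hN'.lintegral_observed_cutoff_le hX' hd hV hg hgm hg0 (u k) (hχ.le_one n)
          (hχb' n)).trans (hc n k)

/-- For fixed `b` the moments are bounded only from a threshold that may depend on `b`, so that no
single threshold need serve all cutoff functions. Along a sequence this is harmless: the finitely
many exceptional moments are finite. -/
lemma IsNoiseModel.tendsto_integral_toLFMeasure_sub (hN : N.IsNoiseModel P V ν)
    (hN' : N'.IsNoiseModel P' V ν) (hX : HasVarianceBound P N.points lam C)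
    (hX' : HasVarianceBound P' N'.points lam C') (hC : C ≠ ∞) (hC' : C' ≠ ∞) (hd : 1 ≤ d)
    (hV : Measurable V) (hg : Measurable g) (hgm : MonotoneOn g (Set.Ioi 0))
    (hg0 : ∀ r, 0 ≤ g r) (hgpos : ∀ r, 0 < r → 0 < g r)
    (hν : ∀ σ, IsProbabilityMeasure (ν σ))
    (hν_zero : ∀ ε : ℝ, 0 < ε → Tendsto (fun σ => ν σ {s | ε ≤ |s|}) atTop (𝓝 0))
    (hmom : ∀ b : ℝ, 0 < b → limsup (fun σ => inverseMoment d g (ν σ) b) atTop < ∞)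
    (hfin : ∀ᶠ σ in atTop, ∀ b : ℝ, 0 < b → inverseMoment d g (ν σ) b < ∞)
    (F : LFMeasure (Obs d) →ᵇ ℝ) :
    Tendsto (fun σ => (∫ ω, F (toLFMeasure (N.observed g σ ω)) ∂P) -
      ∫ ω, F (toLFMeasure (N'.observed g σ ω)) ∂P') atTop (𝓝 0) := by
  refine tendsto_of_seq_tendsto fun u hu => ?_
  obtain ⟨k₀, hk₀⟩ := eventually_atTop.1 (hu.eventually hfin)
  refine (tendsto_add_atTop_iff_nat k₀).1 ?_
  exact hN.tendsto_seq_integral_toLFMeasure_sub hN' hX hX' hC hC' hd hV hg hgm hg0 hgpos hν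
    hν_zero hmom ((tendsto_add_atTop_iff_nat k₀).2 hu) (fun k => hk₀ _ (Nat.le_add_left _ _)) F

end TwoNetworks

/-! ### Values at the origin -/

section Origin

variable {d : ℕ} {Ω : Type*} [MeasurableSpace Ω] {P : Measure Ω} {N : SensorNetwork d Ω}

lemma ae_pos_ne_zero (h : ∀ᵐ ω ∂P, N.points ω {0} = 0) :
    ∀ᵐ ω ∂P, ∀ i ∈ N.index ω, N.pos i ω ≠ 0 := by
  filter_upwards [h] with ω hω i hi hp
  rw [← lintegral_indicator_one (measurableSet_singleton 0), N.lintegral_points ω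
    (measurable_one.indicator (measurableSet_singleton 0)), ENNReal.tsum_eq_zero] at hω
  simpa [hi, hp] using hω i

lemma observed_congr {g g' : ℝ → ℝ} (hg : ∀ r, 0 < r → g r = g' r) {ω : Ω}
    (hω : ∀ i ∈ N.index ω, N.pos i ω ≠ 0) (σ : ℝ≥0) : N.observed g σ ω = N.observed g' σ ω := by
  unfold observed
  congr 2
  funext i
  rw [hg _ (norm_pos_iff.2 (hω i i.2))]

/-- The noise model involves the variance function only at the norms of the used locations. -/
lemma IsNoiseModel.congr {V V' : ℝ → ℝ} {ν : ℝ≥0 → Measure ℝ} (hN : N.IsNoiseModel P V ν)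
    (hV : ∀ r, 0 < r → V r = V' r) (hpos : ∀ᵐ ω ∂P, ∀ i ∈ N.index ω, N.pos i ω ≠ 0) :
    N.IsNoiseModel P V' ν where
  fading_law := hN.fading_law
  fading_iIndep := hN.fading_iIndep
  fading_indep := hN.fading_indep
  aoa_cond J B hB G hG := by
    rw [hN.aoa_cond J B hB G hG]
    -- the integrand involves only the positions of used sensors
    have hm : MeasurableSet (G ∩ {ω | ∀ i ∈ J, i ∈ N.index ω}) := by
      refine (N.locationAlgebra_le _ hG).inter ?_
      simp only [Set.ofPred_forall]
      exact .iInter fun i => .iInter fun _ => N.measurableSet_index i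
    refine lintegral_congr_ae ?_
    filter_upwards [ae_restrict_of_ae hpos, ae_restrict_mem hm] with ω hω hωG
    refine Finset.prod_congr rfl fun i hi => ?_
    rw [hV _ (norm_pos_iff.2 (hω i (hωG.2 i hi)))]

end Origin

end SensorNetwork

lemma inverseMoment_congr {g g' : ℝ → ℝ} (hg : ∀ r, 0 < r → g r = g' r) (d : ℕ) (μ : Measure ℝ)
    (b : ℝ) : inverseMoment d g μ b = inverseMoment d g' μ b := by
  have h1 : genInverse g = genInverse g' := by
    funext y
    unfold genInverse
    congr 2
    ext x
    exact and_congr_right fun hx => by rw [hg x hx]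
  rw [inverseMoment, inverseMoment, h1]

/-- A function that is nonnegative and nondecreasing on `(0, ∞)` stays nondecreasing when it is
set to `0` on `(-∞, 0]`. -/
lemma monotone_indicator_Ioi {g : ℝ → ℝ} (hg : MonotoneOn g (Set.Ioi 0))
    (hpos : ∀ r, 0 < r → 0 ≤ g r) : Monotone ((Set.Ioi 0).indicator g) := by
  intro r s hrs
  by_cases hr : 0 < r
  · rw [Set.indicator_of_mem (Set.mem_Ioi.2 hr), Set.indicator_of_mem (Set.mem_Ioi.2
      (hr.trans_le hrs))]
    exact hg hr (hr.trans_le hrs) hrs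
  · rw [Set.indicator_of_notMem (by simpa using hr)]
    exact Set.indicator_nonneg (fun t ht => hpos t ht) s

lemma tendstoInDistribution_congr_of_tendsto_sub {Ω Ω' Z ι : Type*} [MeasurableSpace Ω]
    [MeasurableSpace Ω'] [TopologicalSpace Z] [MeasurableSpace Z] [OpensMeasurableSpace Z]
    {P : Measure Ω} [IsProbabilityMeasure P] {P' : Measure Ω'} [IsProbabilityMeasure P']
    {l : Filter ι} {X : ι → Ω → Z} {X' : ι → Ω' → Z} (hX' : ∀ i, AEMeasurable (X' i) P')
    (h : ∀ F : Z →ᵇ ℝ, Tendsto (fun i => (∫ ω, F (X i ω) ∂P) - ∫ ω, F (X' i ω) ∂P') l (𝓝 0))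
    {Q : Measure Z} [IsProbabilityMeasure Q]
    (hXQ : TendstoInDistribution X l id (fun _ => P) Q) :
    TendstoInDistribution X' l id (fun _ => P') Q where
  forall_aemeasurable := hX'
  aemeasurable_limit := aemeasurable_id
  tendsto := by
    have hX := hXQ.forall_aemeasurable
    have h1 := ProbabilityMeasure.tendsto_iff_forall_integral_tendsto.1 hXQ.tendsto
    refine ProbabilityMeasure.tendsto_iff_forall_integral_tendsto.2 fun F => ?_
    have hF : Measurable F := F.continuous.measurable
    have h2 := (h1 F).sub (h F)
    rw [sub_zero] at h2
    refine h2.congr fun i => ?_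
    simp only [ProbabilityMeasure.coe_mk]
    rw [integral_map (hX i) hF.aestronglyMeasurable, integral_map (hX' i) hF.aestronglyMeasurable]
    ring

end

theorem theorem1 (d : ℕ) (hd : 1 ≤ d)
    -- the two probability spaces and networks
    {Ω Ω' : Type*} [MeasurableSpace Ω] [MeasurableSpace Ω']
    (P : Measure Ω) [IsProbabilityMeasure P] (P' : Measure Ω') [IsProbabilityMeasure P']
    (Ξ : SensorNetwork d Ω) (Φ : SensorNetwork d Ω')
    (lam : ℝ) (hlam : 0 < lam)
    -- the sensor locations of `Ξ`
    (hΞ : IsSimpleLocallyFinite P Ξ.points)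
    (hΞ_stat : IsStationaryProcess P Ξ.points) (hΞ_iso : IsIsotropicProcess P Ξ.points)
    (hΞ_int : HasIntensity P Ξ.points lam)
    (h : ℝ → ℝ) (hΞ_pair : IsPairCorrelation P Ξ.points lam h)
    (hSRD : IntegrableOn (fun r : ℝ => |h r - 1| * r ^ (d - 1)) (Set.Ioi 0))
    -- the sensor locations of `Φ`
    (hΦ : IsHomogeneousPoisson P' Φ.points lam)
    -- the reciprocal path-loss function
    (g : ℝ → ℝ) (hg_pos : ∀ r, 0 < r → 0 < g r) (hg_mono : MonotoneOn g (Set.Ioi 0))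
    (hg_left : ∀ r, 0 < r → ContinuousWithinAt g (Set.Iic r) r)
    (hg_zero : Tendsto g (𝓝[>] 0) (𝓝 0))
    -- the variance function of the angular errors
    (V : ℝ → ℝ) (hV_mono : MonotoneOn V (Set.Ioi 0))
    (hV_bdd : ∃ m M : ℝ, 0 < m ∧ ∀ r, 0 < r → m ≤ V r ∧ V r ≤ M)
    -- the laws of the fading variables `S(σ)`
    (ν : ℝ≥0 → Measure ℝ) (hν_prob : ∀ σ, IsProbabilityMeasure (ν σ))
    (hν_pos : ∀ σ, ν σ (Set.Iic 0) = 0)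
    (hν_zero : ∀ ε : ℝ, 0 < ε → Tendsto (fun σ => ν σ {s | ε ≤ |s|}) atTop (𝓝 0))
    (hν_moment : ∀ b : ℝ, 0 < b → limsup (fun σ => inverseMoment d g (ν σ) b) atTop < ∞)
    -- the noise in both networks
    (hΞ_noise : Ξ.IsNoiseModel P V ν) (hΦ_noise : Φ.IsNoiseModel P' V ν) :
    -- the Laplace functionals of the observable processes are asymptotically equal
    (∀ f : C_c(Obs d, ℝ≥0),
      Tendsto (fun σ => laplaceFunctional P (Ξ.observed g σ) f -
        laplaceFunctional P' (Φ.observed g σ) f) atTop (𝓝 0)) ∧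
    -- if all the moments are finite for large `σ`, then the observable processes are point
    -- processes for large `σ`, asymptotically equal in law, and with the same limits in law
    ((∀ᶠ σ in atTop, ∀ b : ℝ, 0 < b → inverseMoment d g (ν σ) b < ∞) →
      (∀ᶠ σ in atTop, (∀ᵐ ω ∂P, IsLocallyFiniteMeasure (Ξ.observed g σ ω)) ∧
        (∀ᵐ ω ∂P', IsLocallyFiniteMeasure (Φ.observed g σ ω))) ∧
      (∀ F : LFMeasure (Obs d) →ᵇ ℝ,
        Tendsto (fun σ => (∫ ω, F (toLFMeasure (Ξ.observed g σ ω)) ∂P) -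
          ∫ ω, F (toLFMeasure (Φ.observed g σ ω)) ∂P') atTop (𝓝 0)) ∧
      (∀ (Q : Measure (LFMeasure (Obs d))) [IsProbabilityMeasure Q],
        TendstoInDistribution (fun σ ω => toLFMeasure (Ξ.observed g σ ω)) atTop id
            (fun _ => P) Q ↔
          TendstoInDistribution (fun σ ω => toLFMeasure (Φ.observed g σ ω)) atTop id
            (fun _ => P') Q)) := by
  have hΞm := Ξ.measurable_points
  have hΦm := Φ.measurable_points
  have hΦ_int := hΦ.hasIntensity hΦm hlam
  have hXΞ := hΞ_pair.hasVarianceBound hΞm hΞ_int hΞ.simple hlam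
  have hXΦ := hΦ.hasVarianceBound hΦm hlam
  have hC : ENNReal.ofReal lam + ENNReal.ofReal (lam ^ 2) *
      (2 * ∫⁻ z : EuclideanSpace ℝ (Fin d), ENNReal.ofReal |h ‖z‖ - 1|) ≠ ∞ :=
    ENNReal.add_ne_top.2 ⟨ENNReal.ofReal_ne_top, ENNReal.mul_ne_top ENNReal.ofReal_ne_top
      (ENNReal.mul_ne_top (by simp) (lintegral_abs_sub_one_lt_top hd hSRD).ne)⟩
  have hposΞ := SensorNetwork.ae_pos_ne_zero (hΞ_int.ae_singleton_zero hΞm hd)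
  have hposΦ := SensorNetwork.ae_pos_ne_zero (hΦ_int.ae_singleton_zero hΦm hd)
  obtain ⟨m, M, hm, hmM⟩ := hV_bdd
  -- Almost surely no sensor is at the origin, so `g` and `V` may be set to `0` on `(-∞, 0]`; the
  -- new functions are monotone, hence measurable.
  set g₀ : ℝ → ℝ := (Set.Ioi 0).indicator g
  set V₀ : ℝ → ℝ := (Set.Ioi 0).indicator V
  have hgg : ∀ r, 0 < r → g r = g₀ r := fun r hr => (Set.indicator_of_mem hr g).symm
  have hVV : ∀ r, 0 < r → V r = V₀ r := fun r hr => (Set.indicator_of_mem hr V).symm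
  have hg₀ : Monotone g₀ := monotone_indicator_Ioi hg_mono fun r hr => (hg_pos r hr).le
  have hV₀ : Measurable V₀ :=
    (monotone_indicator_Ioi hV_mono fun r hr => hm.le.trans (hmM r hr).1).measurable
  have hg₀m : Measurable g₀ := hg₀.measurable
  have hg₀mono : MonotoneOn g₀ (Set.Ioi 0) := hg₀.monotoneOn _
  have hg₀nn : ∀ r, 0 ≤ g₀ r := Set.indicator_nonneg fun r hr => (hg_pos r hr).le
  have hg₀pos : ∀ r, 0 < r → 0 < g₀ r := fun r hr => hgg r hr ▸ hg_pos r hr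
  have hNΞ := hΞ_noise.congr hVV hposΞ
  have hNΦ := hΦ_noise.congr hVV hposΦ
  simp only [inverseMoment_congr hgg] at hν_moment ⊢
  have hobsΞ : ∀ σ, ∀ᵐ ω ∂P, Ξ.observed g σ ω = Ξ.observed g₀ σ ω := fun σ =>
    hposΞ.mono fun ω hω => SensorNetwork.observed_congr hgg hω σ
  have hobsΦ : ∀ σ, ∀ᵐ ω ∂P', Φ.observed g σ ω = Φ.observed g₀ σ ω := fun σ =>
    hposΦ.mono fun ω hω => SensorNetwork.observed_congr hgg hω σ
  refine ⟨fun f => ?_, fun hfin => ?_⟩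
  · have h1 := (hNΞ.tendsto_laplaceFunctional_sub hXΞ hC hd hV₀ hg₀m hg₀mono hg₀nn hg₀pos hν_prob
      hν_zero hν_moment f).sub (hNΦ.tendsto_laplaceFunctional_sub hXΦ ENNReal.ofReal_ne_top hd hV₀
      hg₀m hg₀mono hg₀nn hg₀pos hν_prob hν_zero hν_moment f)
    simp only [sub_sub_sub_cancel_right, sub_zero] at h1
    refine h1.congr fun σ => ?_
    unfold laplaceFunctional
    congr 1
    · exact integral_congr_ae ((hobsΞ σ).mono fun ω hω => by simp only [hω])
    · exact integral_congr_ae ((hobsΦ σ).mono fun ω hω => by simp only [hω])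
  · have hlim : ∀ F : LFMeasure (Obs d) →ᵇ ℝ,
        Tendsto (fun σ => (∫ ω, F (toLFMeasure (Ξ.observed g σ ω)) ∂P) -
          ∫ ω, F (toLFMeasure (Φ.observed g σ ω)) ∂P') atTop (𝓝 0) := fun F => by
      refine (hNΞ.tendsto_integral_toLFMeasure_sub hNΦ hXΞ hXΦ hC ENNReal.ofReal_ne_top hd hV₀
        hg₀m hg₀mono hg₀nn hg₀pos hν_prob hν_zero hν_moment hfin F).congr fun σ => ?_
      congr 1
      · exact integral_congr_ae ((hobsΞ σ).mono fun ω hω => by simp only [hω])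
      · exact integral_congr_ae ((hobsΦ σ).mono fun ω hω => by simp only [hω])
    have hmΞ : ∀ σ, AEMeasurable (fun ω => toLFMeasure (Ξ.observed g σ ω)) P := fun σ =>
      (measurable_toLFMeasure.comp (Ξ.measurable_observed hg₀m σ)).aemeasurable.congr
        ((hobsΞ σ).mono fun ω hω => by simp only [Function.comp_apply, hω])
    have hmΦ : ∀ σ, AEMeasurable (fun ω => toLFMeasure (Φ.observed g σ ω)) P' := fun σ =>
      (measurable_toLFMeasure.comp (Φ.measurable_observed hg₀m σ)).aemeasurable.congr
        ((hobsΦ σ).mono fun ω hω => by simp only [Function.comp_apply, hω])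
    refine ⟨?_, hlim, fun Q _ => ⟨tendstoInDistribution_congr_of_tendsto_sub hmΦ hlim,
      tendstoInDistribution_congr_of_tendsto_sub hmΞ fun F => ?_⟩⟩
    · filter_upwards [hfin] with σ hσ
      have := hν_prob σ
      constructor
      · filter_upwards [hobsΞ σ, hNΞ.ae_isLocallyFiniteMeasure_observed hXΞ hd hV₀ hg₀m hg₀mono
          hg₀nn σ hσ] with ω h1 h2
        rwa [h1]
      · filter_upwards [hobsΦ σ, hNΦ.ae_isLocallyFiniteMeasure_observed hXΦ hd hV₀ hg₀m hg₀mono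
          hg₀nn σ hσ] with ω h1 h2
        rwa [h1]
    · simpa using (hlim F).neg
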